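/- Let $\mathfrak g$ be of type $A^{(2)}_{2n-1}$ ($n\ge 3$), $B^{(1)}_n$ ($n\ge 3$) or $D^{(1)}_n$ ($n\ge 4$), with Dynkin nodes $0,1,\dots,n$ labelled as in Kac, and let $r\ge 2$ be even with $r\le n$, $r\le n-1$, $r\le n-2$ respectively. Let $k,l\ge 1$. Let $B^{r,k}$ be the Kirillov–Reshetikhin crystal, realized by Kashiwara–Nakashima tableaux whose shapes are obtained from $k$ columns of height $r$ by removing vertical dominoes. On it $e_0=\sigma e_1\sigma$ and $f_0=\sigma f_1\sigma$, where $\sigma$ is the involution that commutes with $e_i,f_i$ for $2\le i\le n$ and is given on $\{2,\dots,n\}$-highest elements by $\Phi\circ\mathfrak S\circ\Phi^{-1}$. Here $\Phi$ is the standard bijection from $\pm$-diagrams to $\{2,\dots,n\}$-highest tableaux. The involution $\mathfrak S$ keeps the inner shape of a $\pm$-diagram; write $c_i$ for the number of inner columns of height $i$, with $c_0$ chosen so that $\sum_{i\ge0}c_i=k$. Above the inner columns of each height $i<r$, $\mathfrak S$ interchanges the numbers of $+$ and of $-$ if $i\not\equiv r \pmod 2$, and replaces the number $p_i$ of $\mp$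 pairs by $c_i-p_i$ if $i\equiv r\pmod 2$. Elements of $B^{1,l}$ are written in coordinates $x=(x_1,\dots,x_n,(x_0),\bar x_n,\dots,\bar x_1)$, where $x_i,\bar x_i,x_0$ are the numbers of letters $i,\bar i,0$ in the corresponding one-row tableau ($x_0$ occurs only for $B_n^{(1)}$), with the standard affine crystal structure; $1^l$ is the element with $x_1=l$. Tensor products follow the rule $e_i(b\otimes b')=e_ib\otimes b'$ if $\varphi_i(b)\ge\varepsilon_i(b')$, and $e_i(b\otimes b')=b\otimes e_ib'$ otherwise. For a word, $e_{a_1a_2\cdots a_m}=e_{a_m}\cdots e_{a_2}e_{a_1}$. Let $\mu=\sum_{i=2,\,\mathrm{even}}^r\mu_i\Lambda_i$ be one of the dominant weights that occur in $B^{r,k}$. Set $\mu_0=k-\sum_{i>0}\mu_i$, and write $\mu$ also for the highest weight tableau of weight $\mu$. Let $x\in B^{1,l}$ be such that $\mu\otimes x\in B^{r,k}\otimes B^{1,l}$ is annihilated by $e_1,\dots,e_n$. Put $c=\max(x_1-\mu_0,0)$ and $x_{n+1}=0$. Define $$s_{2i}=2k-\sum_{j=0,\,\mathrm{even}}^{2i}\mu_j+c+x_{2i+1}+\sum_{j=2,\,\mathrm{even}}^{2i}\bar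 x_j,\qquad s_{2i+1}=s_{2i}-x_{2i+1}\qquad(1\le i\le r/2),$$ $$\alpha=k+c+\sum_{j=2,\,\mathrm{even}}^{r}\bar x_j,\qquad \bar s_{2i}=\bar s_{2i+1}=\alpha-\sum_{j=2i+2,\,\mathrm{even}}^r\mu_j+\sum_{j=2i+2}^{r+1}x_j\qquad(1\le i\le r/2-1),$$ $$\bar{\bar s}_1=2k+l-x_1+c,\qquad \bar{\bar s}_{2i}=\bar{\bar s}_{2i+1}=2k-\sum_{j=0,\,\mathrm{even}}^{2i}\mu_j\qquad(1\le i\le r/2-1),$$ $$\bar{\bar{\bar s}}_1=0,\qquad \bar{\bar{\bar s}}_{2i-1}=\bar{\bar{\bar s}}_{2i-2}=k-\sum_{j=2i,\,\mathrm{even}}^r\mu_j\qquad(2\le i\le r/2).$$ For integers $a,b,t$ let $T_{a,b}(t)$ be the word $a^t(a+1)^t\cdots(n-1)^t\,n^{t}\,(n-1)^t(n-2)^t\cdots b^t$ for $A^{(2)}_{2n-1}$, the same word with $n^{t}$ replaced by $n^{2t}$ for $B^{(1)}_n$, and $a^t(a+1)^t\cdots (n-1)^tn^t\,(n-2)^t(n-3)^t\cdots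 b^t$ for $D^{(1)}_n$. Here the ascending part runs from $a$ to $n$ and the descending part ends at $b$; a part whose range is empty is omitted. Let $\boldsymbol b_3=\boldsymbol b_{3,1}\boldsymbol b_{3,2}$ with $$\boldsymbol b_{3,1}=2^{s_2}3^{s_3}\cdots r^{s_r}\;T_{r+1,r}(\alpha)\;(r-1)^{\bar s_{r-1}}\cdots 2^{\bar s_2},$$ $$\boldsymbol b_{3,2}=1^{\bar{\bar s}_1}2^{\bar{\bar s}_2}\cdots(r-1)^{\bar{\bar s}_{r-1}}\;T_{r,r}(k)\;(r-1)^{\bar{\bar{\bar s}}_{r-1}}\cdots 2^{\bar{\bar{\bar s}}_2}1^{\bar{\bar{\bar s}}_1}.$$ Then, in $B^{r,k}\otimes B^{1,l}$, $$e_{\boldsymbol b_3}\,e_0^{\,2k-\mu_0+c}(\mu\otimes x)=\bar\mu\otimes 1^l,\qquad\text{where}\quad \bar\mu=\sum_{i=2,\,\mathrm{even}}^r\mu_i\Lambda_i+\mu_0\Lambda_2 .$$ -/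

import Mathlib

namespace KRcrystals

/-- The three families of affine Lie algebras: `D` is `D_n^{(1)}`, `B` is `B_n^{(1)}`, and `A` is
`A_{2n-1}^{(2)}`.  The underlying classical types are `D_n`, `B_n`, `C_n` respectively. -/
inductive AffineType
  | D
  | B
  | A

/-- The range of `r` for which `B^{r,k}` is considered (with the usual lower bounds on the rank). -/
def AdmissibleRank : AffineType → ℕ → ℕ → Prop
  | .D, n, r => 4 ≤ n ∧ 1 ≤ r ∧ r + 2 ≤ n
  | .B, n, r => 3 ≤ n ∧ 1 ≤ r ∧ r + 1 ≤ n
  | .A, n, r => 3 ≤ n ∧ 1 ≤ r ∧ r ≤ n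

/-! ### Kashiwara operators, `ε_i`, `φ_i`, tensor products -/

/-- A family of Kashiwara operators `e_i`, `f_i` on `β`; `none` is the element `0`. -/
structure Ops (β : Type) where
  e : ℕ → β → Option β
  f : ℕ → β → Option β

/-- `m`-fold application of a partial map. -/
def iterOpt {β : Type} (g : β → Option β) : ℕ → β → Option β
  | 0, b => some b
  | m + 1, b => (g b).bind (iterOpt g m)

/-- `max {m | g^m b ≠ 0}`. -/
noncomputable def maxIter {β : Type} (g : β → Option β) (b : β) : ℕ :=
  sSup {m | iterOpt g m b ≠ none}

noncomputable def Ops.eps {β : Type} (C : Ops β) (i : ℕ) (b : β) : ℕ := maxIter (C.e i) b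

noncomputable def Ops.phi {β : Type} (C : Ops β) (i : ℕ) (b : β) : ℕ := maxIter (C.f i) b

/-- The tensor product rule. -/
noncomputable def Ops.tensor {β γ : Type} (C : Ops β) (D : Ops γ) : Ops (β × γ) where
  e i b :=
    if D.eps i b.2 ≤ C.phi i b.1 then (C.e i b.1).map (fun c => (c, b.2))
    else (D.e i b.2).map (fun d => (b.1, d))
  f i b :=
    if D.eps i b.2 < C.phi i b.1 then (C.f i b.1).map (fun c => (c, b.2))
    else (D.f i b.2).map (fun d => (b.1, d))

/-- `e_𝐚 = e_{a_m} ⋯ e_{a_1}` for a word `𝐚 = a_1 ⋯ a_m`. -/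
def Ops.eWord {β : Type} (C : Ops β) : List ℕ → β → Option β
  | [], b => some b
  | i :: w, b => (C.e i b).bind (C.eWord w)

/-- `f_𝐚 = f_{a_m} ⋯ f_{a_1}` for a word `𝐚 = a_1 ⋯ a_m`. -/
def Ops.fWord {β : Type} (C : Ops β) : List ℕ → β → Option β
  | [], b => some b
  | i :: w, b => (C.f i b).bind (C.fWord w)

/-! ### The crystal of the vector representation and its tensor powers

The letter `i` is the integer `i`, the letter `i` with a bar is the integer `-i`, and the letter `0`
(type `B_n` only) is the integer `0`. -/

/-- `f_i`, `1 ≤ i ≤ n`, on the crystal of the vector representation. -/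
def vecF (X : AffineType) (n i : ℕ) (a : ℤ) : Option ℤ :=
  if 1 ≤ i ∧ i < n then
    if a = i then some (i + 1) else if a = -(i + 1) then some (-i) else none
  else if i = n then
    match X with
    | .B => if a = n then some 0 else if a = 0 then some (-n) else none
    | .A => if a = n then some (-n) else none
    | .D => if a = n - 1 then some (-n) else if a = n then some (-(n - 1)) else none
  else none

/-- `e_i`, `1 ≤ i ≤ n`, on the crystal of the vector representation. -/
def vecE (X : AffineType) (n i : ℕ) (a : ℤ) : Option ℤ :=
  if 1 ≤ i ∧ i < n then
    if a = i + 1 then some i else if a = -i then some (-(i + 1)) else none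
  else if i = n then
    match X with
    | .B => if a = 0 then some n else if a = -n then some 0 else none
    | .A => if a = -n then some n else none
    | .D => if a = -n then some (n - 1) else if a = -(n - 1) then some n else none
  else none

/-- The number of times a partial map can be applied to a letter (strings in the vector
representation have length at most two). -/
def letterString (g : ℤ → Option ℤ) (a : ℤ) : ℕ :=
  match g a with
  | none => 0
  | some b => if (g b).isNone then 1 else 2

/-- The reduced `i`-signature of a word, regarded as an element of a tensor power of the vector
representation: the number of `-` (which is `ε_i`) and the number of `+` (which is `φ_i`) left after
deleting all adjacent pairs `+-`. -/
def wordSig (X : AffineType) (n i : ℕ) : List ℤ → ℕ × ℕ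
  | [] => (0, 0)
  | a :: w =>
    (letterString (vecE X n i) a + ((wordSig X n i w).1 - letterString (vecF X n i) a),
      (wordSig X n i w).2 + (letterString (vecF X n i) a - (wordSig X n i w).1))

/-- `e_i`, `1 ≤ i ≤ n`, on words: the tensor product rule. -/
def wordE (X : AffineType) (n i : ℕ) : List ℤ → Option (List ℤ)
  | [] => none
  | a :: w =>
    if (wordSig X n i w).1 ≤ letterString (vecF X n i) a then (vecE X n i a).map (fun b => b :: w)
    else (wordE X n i w).map (fun v => a :: v)

/-- `f_i`, `1 ≤ i ≤ n`, on words: the tensor product rule. -/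
def wordF (X : AffineType) (n i : ℕ) : List ℤ → Option (List ℤ)
  | [] => none
  | a :: w =>
    if (wordSig X n i w).1 < letterString (vecF X n i) a then (vecF X n i a).map (fun b => b :: w)
    else (wordF X n i w).map (fun v => a :: v)

/-! ### Tableaux -/

/-- A filling of a Young diagram (French notation) by letters: the heights of its columns, listed
from right to left, and its Japanese reading word (columns from right to left, each column from
bottom to top).  Columns of height `0` are allowed: a tableau in `B^{r,k}` always has `k` columns. -/
@[ext]
structure Tableau where
  heights : List ℕ
  word : List ℤ

/-- The tableau with given columns (listed from right to left, each read from bottom to top). -/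
def Tableau.ofColumns (cols : List (List ℤ)) : Tableau := ⟨cols.map List.length, cols.flatten⟩

/-- The classical Kashiwara operators on tableaux, through the Japanese reading word. -/
def tableauOps (X : AffineType) (n : ℕ) : Ops Tableau where
  e i T := (wordE X n i T.word).map (fun w => ⟨T.heights, w⟩)
  f i T := (wordF X n i T.word).map (fun w => ⟨T.heights, w⟩)

/-- The string of letters `a, a+1, …, b` (empty if `b < a`). -/
def letterRange (a b : ℕ) : List ℤ := (List.range' a (b + 1 - a)).map (fun j => (j : ℤ))

/-- The dominant weights `μ = ∑_{i>0} μ_i Λ_i` obtained from `k Λ_r` by removing vertical dominoes.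
`μ i` is the number of columns of height `i` among the `k` columns, including `i = 0`; in
particular `μ 0 = k - ∑_{i>0} μ_i`. -/
def IsKRWeight (r k : ℕ) (μ : ℕ → ℕ) : Prop :=
  ∑ i ∈ Finset.range (r + 1), μ i = k ∧ ∀ i, μ i ≠ 0 → i ≤ r ∧ i % 2 = r % 2

/-- The highest weight tableau of weight `μ`: every column of height `i` is `1 2 ⋯ i`. -/
def highestTableau (r : ℕ) (μ : ℕ → ℕ) : Tableau :=
  .ofColumns ((List.range (r + 1)).flatMap fun i => List.replicate (μ i) (letterRange 1 i))

/-- The underlying set of `B^{r,k}`: the disjoint union of the classical crystals `B(Λ)`, where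
`B(Λ)` is the connected component of the highest weight tableau of weight `Λ` under the classical
Kashiwara operators. -/
def krCrystal (X : AffineType) (n r k : ℕ) : Set Tableau :=
  {b | ∃ Λ, IsKRWeight r k Λ ∧
    Relation.ReflTransGen
      (fun T T' => ∃ i, (tableauOps X n).e i T = some T' ∨ (tableauOps X n).f i T = some T')
      (highestTableau r Λ) b}

/-! ### `±`-diagrams -/

/-- Data of a sequence of three partitions `λ, μ, Λ` with at most `k` columns:
`inner j`, `mid j`, `outer j` are the heights of their `j`-th columns from the left. -/
@[ext]
structure PMData (k : ℕ) where
  inner : Fin k → ℕ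
  mid : Fin k → ℕ
  outer : Fin k → ℕ

/-- `λ ⊆ μ ⊆ Λ` is a `±`-diagram whose outer shape occurs in `B^{r,k}`: `μ / λ` (the cells `+`) and
`Λ / μ` (the cells `-`) are horizontal strips; in type `C_n` the inner shape has no column of
height `n`. -/
def IsPMDiagram (X : AffineType) (n r : ℕ) {k : ℕ} (P : PMData k) : Prop :=
  Antitone P.inner ∧ Antitone P.mid ∧ Antitone P.outer ∧
  (∀ j, P.inner j ≤ P.mid j ∧ P.mid j ≤ P.inner j + 1) ∧
  (∀ j, P.mid j ≤ P.outer j ∧ P.outer j ≤ P.mid j + 1) ∧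
  (∀ j, P.outer j ≤ r ∧ P.outer j % 2 = r % 2) ∧
  (X = .A → ∀ j, P.inner j < n)

/-- The columns of a `±`-diagram from left to right, as triples of heights. -/
def PMData.columns {k : ℕ} (P : PMData k) : List (ℕ × ℕ × ℕ) :=
  List.ofFn fun j => (P.inner j, P.mid j, P.outer j)

/-- The heights of the symbols `+` from left to right, ignoring those at height `n`. -/
def plusHeights (n : ℕ) (cols : List (ℕ × ℕ × ℕ)) : List ℕ :=
  (cols.filter fun c => c.2.1 = c.1 + 1 ∧ c.2.1 ≠ n).map fun c => c.2.1

/-- The letter placed at a symbol `-`: `1` with a bar, or, if it is met by a `+` at height `h`,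
`h + 1` with a bar. -/
def minusLetter : List ℕ → ℤ
  | [] => -1
  | h :: _ => -((h : ℤ) + 1)

/-- The string of length `m` filling the rest of a column: `2 3 ⋯ m+1`, or, if it is met by a `+` at
height `h`, `1 2 ⋯ h h+2 ⋯ m+1`. -/
def columnString (m : ℕ) : List ℕ → List ℤ
  | [] => letterRange 2 (m + 1)
  | h :: _ => letterRange 1 h ++ letterRange (h + 2) (m + 1)

/-- Fill the columns from left to right (each from top to bottom), where the second argument lists
the `+` that have not been used yet; each letter `1` with a bar and each string `2 3 ⋯` that is met
uses one of them.  The result lists each column from bottom to top. -/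
def fillColumns (n : ℕ) : List (ℕ × ℕ × ℕ) → List ℕ → List (List ℤ)
  | [], _ => []
  | (i, m, o) :: cs, ps =>
    if m = i + 1 ∧ m = n then letterRange 1 n :: fillColumns n cs ps
    else if o = m + 1 then
      if m = 0 then [minusLetter ps] :: fillColumns n cs ps.tail
      else (columnString m ps.tail ++ [minusLetter ps]) :: fillColumns n cs ps.tail.tail
    else
      if m = 0 then [] :: fillColumns n cs ps
      else columnString m ps :: fillColumns n cs ps.tail

/-- The map `Φ` from `±`-diagrams to `{2,…,n}`-highest tableaux. -/
def Phi (n : ℕ) {k : ℕ} (P : PMData k) : Tableau :=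
  .ofColumns (fillColumns n P.columns (plusHeights n P.columns)).reverse

open Classical in
/-- The inverse of `Φ`. -/
noncomputable def PhiInv (X : AffineType) (n r k : ℕ) (b : Tableau) : Option (PMData k) :=
  if h : ∃ P : PMData k, IsPMDiagram X n r P ∧ Phi n P = b then some h.choose else none

/-- Number of columns of the inner shape of height `i`. -/
def PMData.innerCount {k : ℕ} (P : PMData k) (i : ℕ) : ℕ :=
  (Finset.univ.filter fun j => P.inner j = i).card

/-- Number of columns of the inner shape of height `i` with a `+` and no `-` above. -/
def PMData.plusCount {k : ℕ} (P : PMData k) (i : ℕ) : ℕ :=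
  (Finset.univ.filter fun j => P.inner j = i ∧ P.mid j = i + 1 ∧ P.outer j = i + 1).card

/-- Number of columns of the inner shape of height `i` with a pair `∓` above. -/
def PMData.pairCount {k : ℕ} (P : PMData k) (i : ℕ) : ℕ :=
  (Finset.univ.filter fun j => P.inner j = i ∧ P.mid j = i + 1 ∧ P.outer j = i + 2).card

/-- The position (starting from `0`) of the column `j` among the columns of the inner shape of the
same height. -/
def PMData.position {k : ℕ} (P : PMData k) (j : Fin k) : ℕ :=
  (Finset.univ.filter fun j' => P.inner j' = P.inner j ∧ j' < j).card

/-- The involution `𝔖` on `±`-diagrams.  The inner shape is kept.  Above the inner columns of height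
`i < r`, `i ≢ r (mod 2)`, the number of `+` and the number of `-` are interchanged; above those of
height `i < r`, `i ≡ r (mod 2)`, the number `p_i` of pairs `∓` becomes `c_i - p_i`.  (Among inner
columns of equal height, the `+` stand to the left of the `-`, and the pairs to the left of the
empty columns.) -/
def frakS (r : ℕ) {k : ℕ} (P : PMData k) : PMData k where
  inner := P.inner
  mid j :=
    if P.inner j = r then P.mid j
    else if P.inner j % 2 = r % 2 then
      if P.position j < P.innerCount (P.inner j) - P.pairCount (P.inner j) then P.inner j + 1
      else P.inner j
    else
      if P.position j < P.innerCount (P.inner j) - P.plusCount (P.inner j) then P.inner j + 1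
      else P.inner j
  outer j :=
    if P.inner j = r then P.outer j
    else if P.inner j % 2 = r % 2 then
      if P.position j < P.innerCount (P.inner j) - P.pairCount (P.inner j) then P.inner j + 2
      else P.inner j
    else P.inner j + 1

/-! ### The automorphism `σ` and the affine crystal structure of `B^{r,k}` -/

/-- For a list `w` of indices, the word `𝐚` obtained by applying to `b` successively the maximal
possible power of `e_i`, for `i` running through `w`. -/
def maximalRaising (X : AffineType) (n : ℕ) : List ℕ → Tableau → List ℕ
  | [], _ => []
  | i :: w, b =>
    match iterOpt ((tableauOps X n).e i) (wordSig X n i b.word).1 b with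
    | none => []
    | some b' => List.replicate (wordSig X n i b.word).1 i ++ maximalRaising X n w b'

/-- A word `𝐚` in the letters `2, …, n` such that `e_𝐚 b` is `{2,…,n}`-highest: sweep `n` times
through `2, 3, …, n, n-1, …, 2` with maximal powers (this list of indices contains a reduced word
of the longest element of the Weyl group for `{2,…,n}`). -/
def raisingWord (X : AffineType) (n : ℕ) (b : Tableau) : List ℕ :=
  maximalRaising X n
    (List.replicate n (List.range' 2 (n - 1) ++ (List.range' 2 (n - 2)).reverse)).flatten b

/-- `σ(b) = f_{Rev(𝐚)} ∘ Φ ∘ 𝔖 ∘ Φ⁻¹ ∘ e_𝐚 (b)`. -/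
noncomputable def sigma (X : AffineType) (n r k : ℕ) (b : Tableau) : Option Tableau :=
  (((tableauOps X n).eWord (raisingWord X n b) b).bind (PhiInv X n r k)).bind fun P =>
    (tableauOps X n).fWord (raisingWord X n b).reverse (Phi n (frakS r P))

/-- The affine Kashiwara operators of `B^{r,k}`: the classical ones for `i ≠ 0`, and
`e_0 = σ ∘ e_1 ∘ σ`, `f_0 = σ ∘ f_1 ∘ σ`. -/
noncomputable def krOps (X : AffineType) (n r k : ℕ) : Ops Tableau where
  e i b :=
    if i = 0 then
      ((sigma X n r k b).bind ((tableauOps X n).e 1)).bind (sigma X n r k)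
    else (tableauOps X n).e i b
  f i b :=
    if i = 0 then
      ((sigma X n r k b).bind ((tableauOps X n).f 1)).bind (sigma X n r k)
    else (tableauOps X n).f i b

/-! ### The crystal `B^{1,l}` in the coordinate representation

An element is a function `x : ℤ → ℕ`; `x i = x_i`, `x (-i)` is `x_i` with a bar, `x 0 = x_0`. -/

/-- The letters of the vector representation. -/
def letters (X : AffineType) (n : ℕ) : Set ℤ :=
  {a | -(n : ℤ) ≤ a ∧ a ≤ n ∧ (a = 0 → X = .B)}

/-- The underlying set of `B^{1,l}`. -/
def rowCrystal (X : AffineType) (n l : ℕ) : Set (ℤ → ℕ) :=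
  {x | (∀ a, x a ≠ 0 → a ∈ letters X n) ∧ ∑ a ∈ Finset.Icc (-(n : ℤ)) n, x a = l ∧
    (X = .B → x 0 ≤ 1) ∧ (X = .D → x n = 0 ∨ x (-n) = 0)}

/-- The Japanese reading word of the one-row tableau with coordinates `x`. -/
def rowWord (n : ℕ) (x : ℤ → ℕ) : List ℤ :=
  ((List.range' 1 n).flatMap fun i => List.replicate (x (-(i : ℤ))) (-(i : ℤ))) ++
    List.replicate (x 0) 0 ++
    ((List.range' 1 n).reverse.flatMap fun i => List.replicate (x (i : ℤ)) (i : ℤ))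

/-- The affine Kashiwara operators of `B^{1,l}`. -/
def rowOps (X : AffineType) (n : ℕ) : Ops (ℤ → ℕ) where
  e i x :=
    if i = 0 then
      if x (-2) < x 2 then
        some (Function.update (Function.update x 2 (x 2 - 1)) (-1) (x (-1) + 1))
      else if 0 < x 1 then
        some (Function.update (Function.update x 1 (x 1 - 1)) (-2) (x (-2) + 1))
      else none
    else (wordE X n i (rowWord n x)).map fun w a => w.count a
  f i x :=
    if i = 0 then
      if x 2 < x (-2) then
        some (Function.update (Function.update x 1 (x 1 + 1)) (-2) (x (-2) - 1))
      else if 0 < x (-1) then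
        some (Function.update (Function.update x 2 (x 2 + 1)) (-1) (x (-1) - 1))
      else none
    else (wordF X n i (rowWord n x)).map fun w a => w.count a

/-! ### The word `𝐛₃` -/

/-- `a^{t_a} (a+1)^{t_{a+1}} ⋯ b^{t_b}`, empty if `b < a`. -/
def wordUp (a b : ℕ) (t : ℕ → ℕ) : List ℕ :=
  (List.range' a (b + 1 - a)).flatMap fun i => List.replicate (t i) i

/-- `b^{t_b} (b-1)^{t_{b-1}} ⋯ a^{t_a}`, empty if `b < a`. -/
def wordDown (b a : ℕ) (t : ℕ → ℕ) : List ℕ :=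
  (List.range' a (b + 1 - a)).reverse.flatMap fun i => List.replicate (t i) i

/-- `a^t (a+1)^t ⋯ (n-1)^t n^t (n-1)^t ⋯ b^t` in type `A_{2n-1}^{(2)}`; in type `B_n^{(1)}` the
exponent of `n` is `2t`, and in type `D_n^{(1)}` the descending part starts from `n-2`. -/
def wordTurn : AffineType → (n a b t : ℕ) → List ℕ
  | .A, n, a, b, t => wordUp a n (fun _ => t) ++ wordDown (n - 1) b (fun _ => t)
  | .B, n, a, b, t => wordUp a n (fun i => if i = n then 2 * t else t) ++
      wordDown (n - 1) b (fun _ => t)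
  | .D, n, a, b, t => wordUp a n (fun _ => t) ++ wordDown (n - 2) b (fun _ => t)

section Exponents

variable (r k l : ℕ) (μ : ℕ → ℕ) (x : ℤ → ℕ)

/-- `∑ μ_j` over even `j` with `a ≤ j ≤ b`. -/
def evenSum (a b : ℕ) : ℕ := ∑ j ∈ (Finset.Icc a b).filter Even, μ j

/-- The sum of the coordinates `x_j` with a bar over even `j` with `2 ≤ j ≤ b`. -/
def evenBarSum (b : ℕ) : ℕ := ∑ j ∈ (Finset.Icc 2 b).filter Even, x (-(j : ℤ))

/-- `c = (x_1 - μ_0)_+` (truncated subtraction). -/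
def cExp : ℕ := x 1 - μ 0

/-- `s_i` for even `i`. -/
def sEven (i : ℕ) : ℕ :=
  2 * k - evenSum μ 0 i + cExp μ x + x ((i : ℤ) + 1) + evenBarSum x i

/-- `s_i`. -/
def sExp (i : ℕ) : ℕ := if Even i then sEven k μ x i else sEven k μ x (i - 1) - x (i : ℤ)

/-- `α`. -/
def alphaExp : ℕ := k + cExp μ x + evenBarSum x r

/-- `s_i` with one bar: `s̄_{2m} = s̄_{2m+1}`, where `m = i / 2`. -/
def sBar (i : ℕ) : ℕ :=
  alphaExp r k μ x - evenSum μ (2 * (i / 2) + 2) r +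
    ∑ j ∈ Finset.Icc (2 * (i / 2) + 2) (r + 1), x (j : ℤ)

/-- `s_i` with two bars: for `i ≥ 2` the values at `2m` and `2m+1` agree, where `m = i / 2`. -/
def sBarBar (i : ℕ) : ℕ :=
  if i = 1 then 2 * k + l - x 1 + cExp μ x else 2 * k - evenSum μ 0 (2 * (i / 2))

/-- `s_i` with three bars: for `i ≥ 2` the values at `2m-2` and `2m-1` agree, where
`m = (i + 2) / 2`. -/
def sBarBarBar (i : ℕ) : ℕ :=
  if i = 1 then 0 else k - evenSum μ (2 * ((i + 2) / 2)) r

/-- The word `𝐛_{3,1}`. -/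
def wordB31 (X : AffineType) (n : ℕ) : List ℕ :=
  wordUp 2 r (sExp k μ x) ++ wordTurn X n (r + 1) r (alphaExp r k μ x) ++
    wordDown (r - 1) 2 (sBar r k μ x)

/-- The word `𝐛_{3,2}`. -/
def wordB32 (X : AffineType) (n : ℕ) : List ℕ :=
  wordUp 1 (r - 1) (sBarBar k l μ x) ++ wordTurn X n r r k ++ wordDown (r - 1) 1 (sBarBarBar r k μ)

/-- The word `𝐛₃ = 𝐛_{3,1} 𝐛_{3,2}`. -/
def wordB3 (X : AffineType) (n : ℕ) : List ℕ := wordB31 r k μ x X n ++ wordB32 r k l μ x X n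

end Exponents

/-- `μ̄ = ∑_{i ≥ 2 even} μ_i Λ_i + μ_0 Λ_2`. -/
def muBar (μ : ℕ → ℕ) (i : ℕ) : ℕ :=
  if i = 0 then 0 else if i = 2 then μ 2 + μ 0 else μ i

end KRcrystals

open KRcrystals

namespace KRcrystals

/-! ### Letters -/

theorem letterString_of_two {g : ℤ → Option ℤ} {p q p' q' : ℤ}
    (hg : ∀ a, g a = if a = p then some q else if a = p' then some q' else none)
    (h1 : q ≠ p) (h2 : q ≠ p') (h3 : q' ≠ p) (h4 : q' ≠ p') (a : ℤ) :
    letterString g a = if a = p ∨ a = p' then 1 else 0 := by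
  unfold letterString
  rw [hg a]
  by_cases ha : a = p
  · simp [ha, hg q, h1, h2]
  · by_cases hb : a = p'
    · have : p' ≠ p := fun h => ha (hb.trans h)
      simp [hb, this, hg q', h3, h4]
    · simp [ha, hb]

theorem letterString_vecE_lt (X : AffineType) {n i : ℕ} (h1 : 1 ≤ i) (h2 : i < n) (a : ℤ) :
    letterString (vecE X n i) a = if a = i + 1 ∨ a = -i then 1 else 0 :=
  letterString_of_two (q := i) (q' := -(i + 1))
    (fun a => by simp only [vecE, h1, h2, and_self, if_true])
    (by omega) (by omega) (by omega) (by omega) a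

theorem letterString_vecF_lt (X : AffineType) {n i : ℕ} (h1 : 1 ≤ i) (h2 : i < n) (a : ℤ) :
    letterString (vecF X n i) a = if a = i ∨ a = -(i + 1) then 1 else 0 :=
  letterString_of_two (q := i + 1) (q' := -i)
    (fun a => by simp only [vecF, h1, h2, and_self, if_true])
    (by omega) (by omega) (by omega) (by omega) a

theorem letterString_vecE_A {n : ℕ} (hn : 1 ≤ n) (a : ℤ) :
    letterString (vecE .A n n) a = if a = -n then 1 else 0 := by
  unfold letterString vecE
  by_cases ha : a = -n
  · simp [ha]; omega
  · simp [ha]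

theorem letterString_vecF_A {n : ℕ} (hn : 1 ≤ n) (a : ℤ) :
    letterString (vecF .A n n) a = if a = n then 1 else 0 := by
  unfold letterString vecF
  by_cases ha : a = n
  · simp [ha]; omega
  · simp [ha]

theorem letterString_vecE_B {n : ℕ} (hn : 1 ≤ n) (a : ℤ) :
    letterString (vecE .B n n) a = if a = -n then 2 else if a = 0 then 1 else 0 := by
  unfold letterString vecE
  by_cases ha : a = -n
  · have : ¬ (n = 0) := by omega
    simp [ha, this]
  · by_cases hb : a = 0
    · subst hb
      have : ¬ (0 = -(n : ℤ)) := by omega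
      have h2 : ¬ (n = 0) := by omega
      simp [h2]
    · simp [ha, hb]

theorem letterString_vecF_B {n : ℕ} (hn : 1 ≤ n) (a : ℤ) :
    letterString (vecF .B n n) a = if a = n then 2 else if a = 0 then 1 else 0 := by
  unfold letterString vecF
  by_cases ha : a = n
  · have : ¬ (0 = (n : ℤ)) := by omega
    subst ha
    simp [this]
  · by_cases hb : a = 0
    · subst hb
      have : ¬ (0 = (n : ℤ)) := by omega
      have h2 : ¬ (n = 0) := by omega
      have h3 : ¬ (-(n : ℤ) = n) := by omega
      simp [this, h2, h3]
    · simp [ha, hb]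

theorem letterString_vecE_D {n : ℕ} (hn : 2 ≤ n) (a : ℤ) :
    letterString (vecE .D n n) a = if a = -n ∨ a = -(n - 1) then 1 else 0 :=
  letterString_of_two (q := n - 1) (q' := n)
    (fun a => by simp only [vecE, lt_irrefl, and_false, if_false, if_true])
    (by omega) (by omega) (by omega) (by omega) a

theorem letterString_vecF_D {n : ℕ} (hn : 2 ≤ n) (a : ℤ) :
    letterString (vecF .D n n) a = if a = n - 1 ∨ a = n then 1 else 0 :=
  letterString_of_two (q := -n) (q' := -(n - 1))
    (fun a => by simp only [vecF, lt_irrefl, and_false, if_false, if_true])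
    (by omega) (by omega) (by omega) (by omega) a

theorem letterString_eq_zero {g : ℤ → Option ℤ} {a : ℤ} : letterString g a = 0 ↔ g a = none := by
  unfold letterString
  cases h : g a with
  | none => simp
  | some b => simp only [reduceCtorEq, iff_false]; split_ifs <;> simp

theorem vecE_eq_some {X : AffineType} {n i : ℕ} (hn : 2 ≤ n) {a b : ℤ}
    (h : vecE X n i a = some b) :
    vecF X n i b = some a ∧
      letterString (vecE X n i) b + 1 = letterString (vecE X n i) a ∧
      letterString (vecF X n i) b = letterString (vecF X n i) a + 1 := by
  by_cases hi : 1 ≤ i ∧ i < n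
  · rw [letterString_vecE_lt X hi.1 hi.2, letterString_vecE_lt X hi.1 hi.2,
      letterString_vecF_lt X hi.1 hi.2, letterString_vecF_lt X hi.1 hi.2]
    unfold vecE at h
    unfold vecF
    rw [if_pos hi] at h ⊢
    have := hi.1
    by_cases h1 : a = i + 1
    · rw [if_pos h1] at h
      obtain rfl : (i : ℤ) = b := by simpa using h
      refine ⟨by simp [h1], ?_, ?_⟩ <;> split_ifs <;> omega
    · rw [if_neg h1] at h
      by_cases h2 : a = -i
      · rw [if_pos h2] at h
        obtain rfl : -((i : ℤ) + 1) = b := by simpa using h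
        refine ⟨?_, ?_, ?_⟩
        · rw [if_neg (by omega), if_pos rfl, h2]
        all_goals split_ifs <;> omega
      · rw [if_neg h2] at h; simp at h
  · by_cases hin : i = n
    · subst hin
      cases X with
      | D =>
        rw [letterString_vecE_D hn, letterString_vecE_D hn, letterString_vecF_D hn,
          letterString_vecF_D hn]
        simp only [vecE, vecF, lt_irrefl, and_false, if_false, if_true] at h ⊢
        by_cases h1 : a = -i
        · rw [if_pos h1] at h
          obtain rfl : (i : ℤ) - 1 = b := by simpa using h
          refine ⟨by simp [h1], ?_, ?_⟩ <;> split_ifs <;> omega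
        · rw [if_neg h1] at h
          by_cases h2 : a = -(i - 1)
          · rw [if_pos h2] at h
            obtain rfl : (i : ℤ) = b := by simpa using h
            refine ⟨?_, ?_, ?_⟩
            · rw [if_neg (by omega), if_pos rfl, h2]
            all_goals split_ifs <;> omega
          · rw [if_neg h2] at h; simp at h
      | B =>
        rw [letterString_vecE_B (by omega), letterString_vecE_B (by omega),
          letterString_vecF_B (by omega), letterString_vecF_B (by omega)]
        simp only [vecE, vecF, lt_irrefl, and_false, if_false, if_true] at h ⊢
        by_cases h1 : a = 0
        · rw [if_pos h1] at h
          obtain rfl : (i : ℤ) = b := by simpa using h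
          refine ⟨by simp [h1], ?_, ?_⟩ <;> split_ifs <;> omega
        · rw [if_neg h1] at h
          by_cases h2 : a = -i
          · rw [if_pos h2] at h
            obtain rfl : (0 : ℤ) = b := by simpa using h
            refine ⟨?_, ?_, ?_⟩
            · rw [if_neg (by omega), if_pos rfl, h2]
            all_goals split_ifs <;> omega
          · rw [if_neg h2] at h; simp at h
      | A =>
        rw [letterString_vecE_A (by omega), letterString_vecE_A (by omega),
          letterString_vecF_A (by omega), letterString_vecF_A (by omega)]
        simp only [vecE, vecF, lt_irrefl, and_false, if_false, if_true] at h ⊢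
        by_cases h1 : a = -i
        · rw [if_pos h1] at h
          obtain rfl : (i : ℤ) = b := by simpa using h
          refine ⟨by simp [h1], ?_, ?_⟩ <;> split_ifs <;> omega
        · rw [if_neg h1] at h; simp at h
    · unfold vecE at h
      rw [if_neg hi, if_neg hin] at h; simp at h

theorem vecF_eq_some {X : AffineType} {n i : ℕ} (hn : 2 ≤ n) {a b : ℤ}
    (h : vecF X n i a = some b) : vecE X n i b = some a := by
  by_cases hi : 1 ≤ i ∧ i < n
  · unfold vecF at h
    unfold vecE
    rw [if_pos hi] at h ⊢
    have := hi.1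
    split_ifs at h with h1 h2
    · obtain rfl : (i : ℤ) + 1 = b := by simpa using h
      simp [h1]
    · obtain rfl : -(i : ℤ) = b := by simpa using h
      rw [if_neg (by omega), if_pos rfl, h2]
  · by_cases hin : i = n
    · subst hin
      cases X with
      | D =>
        simp only [vecE, vecF, lt_irrefl, and_false, if_false, if_true] at h ⊢
        split_ifs at h with h1 h2
        · obtain rfl : -(i : ℤ) = b := by simpa using h
          simp [h1]
        · obtain rfl : -((i : ℤ) - 1) = b := by simpa using h
          rw [if_neg (by omega), if_pos rfl, h2]
      | B =>
        simp only [vecE, vecF, lt_irrefl, and_false, if_false, if_true] at h ⊢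
        split_ifs at h with h1 h2
        · obtain rfl : (0 : ℤ) = b := by simpa using h
          simp [h1]
        · obtain rfl : -(i : ℤ) = b := by simpa using h
          rw [if_neg (by omega), if_pos rfl, h2]
      | A =>
        simp only [vecE, vecF, lt_irrefl, and_false, if_false, if_true] at h ⊢
        split_ifs at h with h1
        obtain rfl : -(i : ℤ) = b := by simpa using h
        simp [h1]
    · unfold vecF at h
      rw [if_neg hi, if_neg hin] at h; simp at h

/-! ### Words -/

section Words

variable {X : AffineType} {n i : ℕ}

theorem wordSig_append (u v : List ℤ) :
    wordSig X n i (u ++ v) =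
      ((wordSig X n i u).1 + ((wordSig X n i v).1 - (wordSig X n i u).2),
        (wordSig X n i v).2 + ((wordSig X n i u).2 - (wordSig X n i v).1)) := by
  induction u with
  | nil => simp [wordSig]
  | cons a u ih =>
    simp only [List.cons_append, wordSig, ih, Prod.mk.injEq]
    omega

theorem wordE_eq_none {w : List ℤ} : wordE X n i w = none ↔ (wordSig X n i w).1 = 0 := by
  induction w with
  | nil => simp [wordE, wordSig]
  | cons a w ih =>
    simp only [wordE, wordSig]
    split_ifs with h
    · rw [Option.map_eq_none_iff, ← letterString_eq_zero]; omega
    · rw [Option.map_eq_none_iff, ih]; omega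

theorem wordF_eq_none {w : List ℤ} : wordF X n i w = none ↔ (wordSig X n i w).2 = 0 := by
  induction w with
  | nil => simp [wordF, wordSig]
  | cons a w ih =>
    simp only [wordF, wordSig]
    split_ifs with h
    · rw [Option.map_eq_none_iff, ← letterString_eq_zero]; omega
    · rw [Option.map_eq_none_iff, ih]; omega

theorem wordE_append (u v : List ℤ) :
    wordE X n i (u ++ v) =
      if (wordSig X n i v).1 ≤ (wordSig X n i u).2 then (wordE X n i u).map (· ++ v)
      else (wordE X n i v).map (u ++ ·) := by
  induction u with
  | nil =>
    by_cases h : (wordSig X n i v).1 = 0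
    · rw [if_pos (by omega), List.nil_append, wordE_eq_none.2 h]; rfl
    · rw [if_neg (by simp only [wordSig]; omega)]; simp
  | cons a u ih =>
    have e1 := congrArg Prod.fst (wordSig_append (X := X) (n := n) (i := i) u v)
    have e2 : (wordSig X n i (a :: u)).2 =
      (wordSig X n i u).2 + (letterString (vecF X n i) a - (wordSig X n i u).1) := rfl
    simp only at e1
    rw [List.cons_append, show wordE X n i (a :: (u ++ v)) =
      if (wordSig X n i (u ++ v)).1 ≤ letterString (vecF X n i) a then
        (vecE X n i a).map (fun b => b :: (u ++ v))
      else (wordE X n i (u ++ v)).map (fun v => a :: v) from rfl,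
      show wordE X n i (a :: u) =
      if (wordSig X n i u).1 ≤ letterString (vecF X n i) a then
        (vecE X n i a).map (fun b => b :: u)
      else (wordE X n i u).map (fun v => a :: v) from rfl]
    by_cases h1 : (wordSig X n i (u ++ v)).1 ≤ letterString (vecF X n i) a
    · rw [if_pos h1, if_pos (by omega), if_pos (by omega), Option.map_map]; rfl
    · rw [if_neg h1, ih]
      by_cases h2 : (wordSig X n i v).1 ≤ (wordSig X n i u).2
      · rw [if_pos h2, if_pos (by omega), if_neg (by omega), Option.map_map, Option.map_map]; rfl
      · rw [if_neg h2, if_neg (by omega), Option.map_map]; rfl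

theorem wordE_eq_some (hn : 2 ≤ n) {w w' : List ℤ} (h : wordE X n i w = some w') :
    wordF X n i w' = some w ∧ (wordSig X n i w').1 + 1 = (wordSig X n i w).1 ∧
      (wordSig X n i w').2 = (wordSig X n i w).2 + 1 ∧ w'.length = w.length := by
  induction w generalizing w' with
  | nil => simp [wordE] at h
  | cons a w ih =>
    simp only [wordE] at h
    split_ifs at h with hc
    · obtain ⟨b, hb, rfl⟩ := Option.map_eq_some_iff.1 h
      obtain ⟨h1, h2, h3⟩ := vecE_eq_some hn hb
      simp only [wordF, wordSig, List.length_cons, and_true]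
      rw [if_pos (by omega), h1]
      exact ⟨rfl, by omega, by omega⟩
    · obtain ⟨v, hv, rfl⟩ := Option.map_eq_some_iff.1 h
      obtain ⟨h1, h2, h3, h4⟩ := ih hv
      simp only [wordF, wordSig, List.length_cons, h4, and_true]
      rw [if_neg (by omega), h1]
      exact ⟨rfl, by omega, by omega⟩

theorem wordF_eq_some (hn : 2 ≤ n) {w w' : List ℤ} (h : wordF X n i w = some w') :
    wordE X n i w' = some w := by
  induction w generalizing w' with
  | nil => simp [wordF] at h
  | cons a w ih =>
    simp only [wordF] at h
    split_ifs at h with hc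
    · obtain ⟨b, hb, rfl⟩ := Option.map_eq_some_iff.1 h
      have hb' := vecF_eq_some hn hb
      have := (vecE_eq_some hn hb').2.2
      simp only [wordE]
      rw [if_pos (by omega), hb']
      rfl
    · obtain ⟨v, hv, rfl⟩ := Option.map_eq_some_iff.1 h
      have h1 := ih hv
      have := (wordE_eq_some hn h1).2.1
      simp only [wordE]
      rw [if_neg (by omega), h1]
      rfl

end Words

/-! ### Iteration -/

theorem iterOpt_succ {β : Type} (g : β → Option β) (m : ℕ) (b : β) :
    iterOpt g (m + 1) b = (g b).bind (iterOpt g m) := rfl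

theorem iterOpt_add {β : Type} (g : β → Option β) (m m' : ℕ) (b : β) :
    iterOpt g (m + m') b = (iterOpt g m b).bind (iterOpt g m') := by
  induction m generalizing b with
  | zero => simp [iterOpt]
  | succ m ih =>
    rw [Nat.add_right_comm, iterOpt_succ, iterOpt_succ]
    cases g b with
    | none => rfl
    | some c => simp [ih]

/-- The number of possible applications of a partial map is read off from a function that drops
by one at each application. -/
theorem maxIter_eq {β : Type} (g : β → Option β) (P : β → Prop) (N : β → ℕ)
    (h0 : ∀ b, P b → N b = 0 → g b = none)
    (h1 : ∀ b, P b → N b ≠ 0 → ∃ b', g b = some b' ∧ P b' ∧ N b' + 1 = N b)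
    {b : β} (hb : P b) : maxIter g b = N b := by
  have key : ∀ m b, P b → (iterOpt g m b ≠ none ↔ m ≤ N b) := by
    intro m
    induction m with
    | zero => intro b _; simp [iterOpt]
    | succ m ih =>
      intro b hb
      rw [iterOpt_succ]
      by_cases h : N b = 0
      · simp [h0 b hb h, h]
      · obtain ⟨b', hb', hP, hN⟩ := h1 b hb h
        rw [hb', Option.bind_some, ih b' hP]; omega
  have : {m | iterOpt g m b ≠ none} = Set.Iic (N b) := by
    ext m; simpa using key m b hb
  rw [maxIter, this, csSup_Iic]

theorem iterOpt_wordE_length {X : AffineType} {n i : ℕ} (hn : 2 ≤ n) {s : ℕ} {w w' : List ℤ}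
    (h : iterOpt (wordE X n i) s w = some w') : w'.length = w.length := by
  induction s generalizing w with
  | zero => simp only [iterOpt, Option.some.injEq] at h; rw [h]
  | succ s ih =>
    rw [iterOpt_succ] at h
    obtain ⟨v, hv, hv'⟩ := Option.bind_eq_some_iff.1 h
    rw [ih hv', (wordE_eq_some hn hv).2.2.2]

theorem iterOpt_wordE_sig {X : AffineType} {n i : ℕ} (hn : 2 ≤ n) {s : ℕ} {w w' : List ℤ}
    (h : iterOpt (wordE X n i) s w = some w') :
    (wordSig X n i w').1 + s = (wordSig X n i w).1 ∧
      (wordSig X n i w').2 = (wordSig X n i w).2 + s := by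
  induction s generalizing w with
  | zero => simp only [iterOpt, Option.some.injEq] at h; simp [h]
  | succ s ih =>
    rw [iterOpt_succ] at h
    obtain ⟨v, hv, hv'⟩ := Option.bind_eq_some_iff.1 h
    have h1 := ih hv'
    have h2 := wordE_eq_some hn hv
    omega

theorem iterOpt_wordE_append {X : AffineType} {n i : ℕ} (hn : 2 ≤ n) {s s' : ℕ}
    {u v u' v' : List ℤ} (hu : iterOpt (wordE X n i) s u = some u')
    (hv : iterOpt (wordE X n i) s' v = some v')
    (hle : s' ≤ (wordSig X n i v).1 - (wordSig X n i u).2)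
    (h : s = 0 ∨ s' = (wordSig X n i v).1 - (wordSig X n i u).2) :
    iterOpt (wordE X n i) (s + s') (u ++ v) = some (u' ++ v') := by
  have right : ∀ t v, t ≤ (wordSig X n i v).1 - (wordSig X n i u).2 →
      iterOpt (wordE X n i) t (u ++ v) = (iterOpt (wordE X n i) t v).map (u ++ ·) := by
    intro t
    induction t with
    | zero => intro v _; simp [iterOpt]
    | succ t ih =>
      intro v ht
      rw [iterOpt_succ, iterOpt_succ, wordE_append, if_neg (by omega)]
      cases hw : wordE X n i v with
      | none => rfl
      | some w =>
        have := wordE_eq_some hn hw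
        simp [ih w (by omega)]
  have left : ∀ t u v, (wordSig X n i v).1 ≤ (wordSig X n i u).2 →
      iterOpt (wordE X n i) t (u ++ v) = (iterOpt (wordE X n i) t u).map (· ++ v) := by
    intro t
    induction t with
    | zero => intro u v _; simp [iterOpt]
    | succ t ih =>
      intro u v ht
      rw [iterOpt_succ, iterOpt_succ, wordE_append, if_pos ht]
      cases hw : wordE X n i u with
      | none => rfl
      | some w =>
        have := wordE_eq_some hn hw
        simp [ih w v (by omega)]
  rw [Nat.add_comm, iterOpt_add, right s' v hle, hv]
  simp only [Option.map_some, Option.bind_some]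
  rcases Nat.eq_zero_or_pos s with rfl | hs
  · simp only [iterOpt, Option.some.injEq] at hu; simp [iterOpt, hu]
  · have := iterOpt_wordE_sig hn hv
    rw [left s u v' (by omega), hu]; rfl

/-! ### Maximal raising with a carry -/

/-- When `w` is preceded by a word with `φ_i = C` that is not raised, then the maximal power of `e_i`
acts on `w` by its `s`-th power, with result `w'`, and both words together have `φ_i = C'`. -/
structure Raise (X : AffineType) (n i C : ℕ) (w w' : List ℤ) (C' s : ℕ) : Prop where
  exp : s = (wordSig X n i w).1 - C
  carry : C' = (wordSig X n i w).2 + (C - (wordSig X n i w).1)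
  iter : iterOpt (wordE X n i) s w = some w'

section Raise

variable {X : AffineType} {n i : ℕ}

theorem Raise.append (hn : 2 ≤ n) {C C1 C2 s1 s2 : ℕ} {u u' v v' : List ℤ}
    (hu : Raise X n i C u u' C1 s1) (hv : Raise X n i C1 v v' C2 s2) :
    Raise X n i C (u ++ v) (u' ++ v') C2 (s1 + s2) := by
  obtain ⟨a1, a2, a3⟩ := hu
  obtain ⟨b1, b2, b3⟩ := hv
  refine ⟨?_, ?_, iterOpt_wordE_append hn a3 b3 (by omega) (by omega)⟩ <;>
    rw [wordSig_append] <;> simp only <;> omega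

theorem Raise.nil (C : ℕ) : Raise X n i C [] [] C 0 :=
  ⟨by simp [wordSig], by simp [wordSig], rfl⟩

theorem Raise.of_sig {w : List ℤ} {C : ℕ} (h : (wordSig X n i w).1 ≤ C) :
    Raise X n i C w w ((wordSig X n i w).2 + (C - (wordSig X n i w).1)) 0 :=
  ⟨by omega, rfl, rfl⟩

theorem Raise.eps_eq_zero {w w' : List ℤ} {C' : ℕ} (h : Raise X n i 0 w w' C' 0) :
    (wordSig X n i w).1 = 0 := by have := h.exp; omega

theorem Raise.inert {a : ℤ} (he : letterString (vecE X n i) a = 0)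
    (hf : letterString (vecF X n i) a = 0) (C : ℕ) : Raise X n i C [a] [a] C 0 :=
  ⟨by simp [wordSig, he], by simp [wordSig, he, hf], rfl⟩

theorem Raise.plus {a : ℤ} (he : letterString (vecE X n i) a = 0)
    (hf : letterString (vecF X n i) a = 1) (C : ℕ) : Raise X n i C [a] [a] (C + 1) 0 :=
  ⟨by simp [wordSig, he], by simp [wordSig, he, hf]; omega, rfl⟩

theorem Raise.minus_matched {a : ℤ} (he : letterString (vecE X n i) a = 1)
    (hf : letterString (vecF X n i) a = 0) (C : ℕ) : Raise X n i (C + 1) [a] [a] C 0 :=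
  ⟨by simp [wordSig, he], by simp [wordSig, he, hf], rfl⟩

theorem Raise.minus {a b : ℤ} (he : letterString (vecE X n i) a = 1)
    (hf : letterString (vecF X n i) a = 0) (hab : vecE X n i a = some b) :
    Raise X n i 0 [a] [b] 0 1 :=
  ⟨by simp [wordSig, he], by simp [wordSig, he, hf], by simp [iterOpt, wordE, wordSig, hab]⟩

theorem Raise.inert_list {w : List ℤ} (he : ∀ a ∈ w, letterString (vecE X n i) a = 0)
    (hf : ∀ a ∈ w, letterString (vecF X n i) a = 0) (C : ℕ) : Raise X n i C w w C 0 := by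
  have : wordSig X n i w = (0, 0) := by
    induction w with
    | nil => rfl
    | cons a w ih =>
      simp only [List.mem_cons, forall_eq_or_imp] at he hf
      simp [wordSig, he.1, hf.1, ih he.2 hf.2]
  exact ⟨by simp [this], by simp [this], rfl⟩

theorem wordSig_fst_append_eq_zero {u v : List ℤ} (hu : (wordSig X n i u).1 = 0)
    (hv : (wordSig X n i v).1 = 0) : (wordSig X n i (u ++ v)).1 = 0 := by
  rw [wordSig_append]; simp [hu, hv]

end Raise

/-! ### Words given by columns -/

/-- The concatenation `f (k-1) ++ ⋯ ++ f 1 ++ f 0`. -/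
def concatCols : ℕ → (ℕ → List ℤ) → List ℤ
  | 0, _ => []
  | k + 1, f => f k ++ concatCols k f

theorem concatCols_congr {k : ℕ} {f g : ℕ → List ℤ} (h : ∀ c < k, f c = g c) :
    concatCols k f = concatCols k g := by
  induction k with
  | zero => rfl
  | succ k ih => rw [concatCols, concatCols, h k (by omega), ih fun c hc => h c (by omega)]

theorem Raise.concat {X : AffineType} {n i : ℕ} (hn : 2 ≤ n) {k : ℕ} {f g : ℕ → List ℤ}
    (cy s : ℕ → ℕ) (h : ∀ c < k, Raise X n i (cy (c + 1)) (f c) (g c) (cy c) (s c)) :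
    Raise X n i (cy k) (concatCols k f) (concatCols k g) (cy 0) (∑ c ∈ Finset.range k, s c) := by
  induction k with
  | zero => exact Raise.nil _
  | succ k ih =>
    rw [Finset.sum_range_succ, Nat.add_comm (∑ c ∈ _, _)]
    exact (h k (by omega)).append hn (ih fun c hc => h c (by omega))

theorem wordSig_fst_concat_eq_zero {X : AffineType} {n i k : ℕ} {f : ℕ → List ℤ}
    (h : ∀ c < k, (wordSig X n i (f c)).1 = 0) : (wordSig X n i (concatCols k f)).1 = 0 := by
  induction k with
  | zero => rfl
  | succ k ih =>
    exact wordSig_fst_append_eq_zero (h k (by omega)) (ih fun c hc => h c (by omega))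

theorem Raise.concat_zero {X : AffineType} {n i : ℕ} (hn : 2 ≤ n) {k : ℕ} {f g : ℕ → List ℤ}
    (s : ℕ → ℕ) (C : ℕ) (h : ∀ c < k, Raise X n i C (f c) (g c) C (s c)) :
    Raise X n i C (concatCols k f) (concatCols k g) C (∑ c ∈ Finset.range k, s c) :=
  Raise.concat hn (fun _ => C) s h

/-- Split the columns into `c < t` and `c ≥ t`. -/
theorem concatCols_add (t k : ℕ) (f : ℕ → List ℤ) :
    concatCols (t + k) f = concatCols k (fun c => f (t + c)) ++ concatCols t f := by
  induction k with
  | zero => simp [concatCols]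
  | succ k ih => rw [← Nat.add_assoc, concatCols, ih, concatCols, List.append_assoc]

theorem concatCols_eq_flatten (k : ℕ) (f : ℕ → List ℤ) :
    concatCols k f = ((List.range k).map f).reverse.flatten := by
  induction k with
  | zero => rfl
  | succ k ih => rw [concatCols, ih, List.range_succ]; simp

/-! ### Strings of consecutive letters -/

theorem letterRange_eq (a b : ℕ) : letterRange a b = (List.range' a (b + 1 - a)).map Nat.cast := by
  simp [letterRange, List.map_eq_flatMap]

theorem mem_letterRange {a b : ℕ} {v : ℤ} : v ∈ letterRange a b ↔ (a : ℤ) ≤ v ∧ v ≤ b := by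
  simp only [letterRange_eq, List.mem_map, List.mem_range'_1]
  constructor
  · rintro ⟨j, hj, rfl⟩; omega
  · intro h; exact ⟨v.toNat, by omega, by omega⟩

@[simp] theorem length_letterRange (a b : ℕ) : (letterRange a b).length = b + 1 - a := by
  simp [letterRange_eq]

theorem letterRange_of_lt {a b : ℕ} (h : b < a) : letterRange a b = [] := by
  rw [letterRange_eq, show b + 1 - a = 0 by omega]; rfl

theorem letterRange_cons {a b : ℕ} (h : a ≤ b) :
    letterRange a b = (a : ℤ) :: letterRange (a + 1) b := by
  rw [letterRange_eq, letterRange_eq, show b + 1 - a = (b + 1 - (a + 1)) + 1 by omega, List.range'_succ]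
  rfl

theorem letterRange_append {a m b : ℕ} (h1 : a ≤ m + 1) (h2 : m ≤ b) :
    letterRange a m ++ letterRange (m + 1) b = letterRange a b := by
  rw [letterRange_eq, letterRange_eq, letterRange_eq, ← List.map_append,
    show b + 1 - a = (m + 1 - a) + (b + 1 - (m + 1)) by omega, ← List.range'_append_1,
    show a + (m + 1 - a) = m + 1 by omega]

theorem letterRange_self (a : ℕ) : letterRange a a = [(a : ℤ)] := by
  rw [letterRange_cons le_rfl, letterRange_of_lt (by omega)]

theorem letterRange_snoc {a b : ℕ} (h : a ≤ b) (hb : 1 ≤ b) :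
    letterRange a (b - 1) ++ [(b : ℤ)] = letterRange a b := by
  rw [← letterRange_self b, ← letterRange_append (a := a) (m := b - 1) (b := b) (by omega) (by omega),
    show b - 1 + 1 = b by omega]

/-- The letters `a, …, i` without `p`. -/
def gapRange (a p i : ℕ) : List ℤ := letterRange a (p - 1) ++ letterRange (p + 1) i

section Lt

variable {X : AffineType} {n m : ℕ}

theorem Raise.letter_inert (h1 : 1 ≤ m) (h2 : m < n) {v : ℤ} (ha : v ≠ m) (hb : v ≠ m + 1)
    (hc : v ≠ -m) (hd : v ≠ -(m + 1)) (C : ℕ) : Raise X n m C [v] [v] C 0 := by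
  apply Raise.inert
  · rw [letterString_vecE_lt X h1 h2, if_neg (by tauto)]
  · rw [letterString_vecF_lt X h1 h2, if_neg (by tauto)]

theorem Raise.letters_inert (h1 : 1 ≤ m) (h2 : m < n) {w : List ℤ}
    (h : ∀ v ∈ w, v ≠ m ∧ v ≠ m + 1 ∧ v ≠ -m ∧ v ≠ -(m + 1)) (C : ℕ) :
    Raise X n m C w w C 0 := by
  apply Raise.inert_list
  · intro v hv; have := h v hv; rw [letterString_vecE_lt X h1 h2, if_neg (by tauto)]
  · intro v hv; have := h v hv; rw [letterString_vecF_lt X h1 h2, if_neg (by tauto)]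

theorem Raise.letter_plus (h1 : 1 ≤ m) (h2 : m < n) (C : ℕ) :
    Raise X n m C [(m : ℤ)] [(m : ℤ)] (C + 1) 0 := by
  apply Raise.plus
  · rw [letterString_vecE_lt X h1 h2, if_neg (by omega)]
  · rw [letterString_vecF_lt X h1 h2, if_pos (by omega)]

theorem Raise.neg_plus (h1 : 1 ≤ m) (h2 : m < n) (C : ℕ) :
    Raise X n m C [-((m : ℤ) + 1)] [-((m : ℤ) + 1)] (C + 1) 0 := by
  apply Raise.plus
  · rw [letterString_vecE_lt X h1 h2, if_neg (by omega)]
  · rw [letterString_vecF_lt X h1 h2, if_pos (by omega)]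

theorem Raise.letter_minus_matched (h1 : 1 ≤ m) (h2 : m < n) (C : ℕ) :
    Raise X n m (C + 1) [(m : ℤ) + 1] [(m : ℤ) + 1] C 0 := by
  apply Raise.minus_matched
  · rw [letterString_vecE_lt X h1 h2, if_pos (by omega)]
  · rw [letterString_vecF_lt X h1 h2, if_neg (by omega)]

theorem Raise.neg_minus_matched (h1 : 1 ≤ m) (h2 : m < n) (C : ℕ) :
    Raise X n m (C + 1) [-(m : ℤ)] [-(m : ℤ)] C 0 := by
  apply Raise.minus_matched
  · rw [letterString_vecE_lt X h1 h2, if_pos (by omega)]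
  · rw [letterString_vecF_lt X h1 h2, if_neg (by omega)]

theorem Raise.letter_minus (h1 : 1 ≤ m) (h2 : m < n) :
    Raise X n m 0 [(m : ℤ) + 1] [(m : ℤ)] 0 1 := by
  apply Raise.minus
  · rw [letterString_vecE_lt X h1 h2, if_pos (by omega)]
  · rw [letterString_vecF_lt X h1 h2, if_neg (by omega)]
  · simp [vecE, h1, h2]

theorem Raise.neg_minus (h1 : 1 ≤ m) (h2 : m < n) :
    Raise X n m 0 [-(m : ℤ)] [-((m : ℤ) + 1)] 0 1 := by
  apply Raise.minus
  · rw [letterString_vecE_lt X h1 h2, if_pos (by omega)]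
  · rw [letterString_vecF_lt X h1 h2, if_neg (by omega)]
  · unfold vecE; rw [if_pos ⟨h1, h2⟩, if_neg (by omega), if_pos rfl]

theorem Raise.range_inert (h1 : 1 ≤ m) (h2 : m < n) {a b : ℕ}
    (h : b < a ∨ b < m ∨ m + 1 < a ∨ (a ≤ m ∧ m + 1 ≤ b)) (C : ℕ) :
    Raise X n m C (letterRange a b) (letterRange a b) C 0 := by
  by_cases hab : a ≤ m ∧ m + 1 ≤ b
  · rw [← letterRange_append (a := a) (m := m - 1) (b := b) (by omega) (by omega),
      show m - 1 + 1 = m by omega, letterRange_cons (a := m) (by omega),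
      letterRange_cons (a := m + 1) (by omega)]
    have e : letterRange a (m - 1) ++ (m : ℤ) :: ((m + 1 : ℕ) : ℤ) :: letterRange (m + 1 + 1) b =
      letterRange a (m - 1) ++ ([(m : ℤ)] ++ ([(m : ℤ) + 1] ++ letterRange (m + 1 + 1) b)) := by
      simp
    rw [e]
    refine (Raise.letters_inert h1 h2 ?_ C).append (by omega) (s2 := 0) ((Raise.letter_plus h1 h2 C).append
      (by omega) (s2 := 0) ((Raise.letter_minus_matched h1 h2 C).append (by omega) (s2 := 0)
        (Raise.letters_inert h1 h2 ?_ C))) <;>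
    · intro v hv
      rw [mem_letterRange] at hv
      push_cast at hv
      omega
  · apply Raise.letters_inert h1 h2
    intro v hv
    rw [mem_letterRange] at hv
    omega

theorem Raise.range_plus (h1 : 1 ≤ m) (h2 : m < n) {a : ℕ} (h : a ≤ m) (C : ℕ) :
    Raise X n m C (letterRange a m) (letterRange a m) (C + 1) 0 := by
  rw [← letterRange_snoc h (by omega)]
  refine (Raise.letters_inert h1 h2 ?_ C).append (by omega) (s2 := 0) (Raise.letter_plus h1 h2 C)
  intro v hv
  rw [mem_letterRange] at hv
  omega

theorem Raise.range_minus_matched (h1 : 1 ≤ m) (h2 : m < n) {b : ℕ} (h : m + 1 ≤ b) (C : ℕ) :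
    Raise X n m (C + 1) (letterRange (m + 1) b) (letterRange (m + 1) b) C 0 := by
  rw [letterRange_cons h]
  refine (Raise.letter_minus_matched (X := X) h1 h2 C).append (by omega) (s2 := 0)
    (v := letterRange (m + 2) b) (Raise.letters_inert h1 h2 ?_ C)
  intro v hv
  rw [mem_letterRange] at hv
  push_cast at hv
  omega

theorem Raise.range_minus (h1 : 1 ≤ m) (h2 : m < n) {b : ℕ} (h : m + 1 ≤ b) :
    Raise X n m 0 (letterRange (m + 1) b) ((m : ℤ) :: letterRange (m + 2) b) 0 1 := by
  rw [letterRange_cons h]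
  refine (Raise.letter_minus (X := X) h1 h2).append (by omega) (s2 := 0)
    (v := letterRange (m + 2) b) (Raise.letters_inert h1 h2 ?_ 0)
  intro v hv
  rw [mem_letterRange] at hv
  push_cast at hv
  omega

theorem Raise.gap_inert (h1 : 1 ≤ m) (h2 : m < n) {a p i : ℕ} (ham : a ≤ m) (hpi : p ≤ i)
    (h : i < m ∨ (p < m ∧ m < i) ∨ (p = m ∧ i = m) ∨ m + 1 < p) (C : ℕ) :
    Raise X n m C (gapRange a p i) (gapRange a p i) C 0 :=
  (Raise.range_inert h1 h2 (by omega) C).append (by omega) (s2 := 0)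
    (Raise.range_inert h1 h2 (by omega) C)

theorem Raise.gap_plus (h1 : 1 ≤ m) (h2 : m < n) {a p i : ℕ} (ham : a ≤ m)
    (h : (p < m ∧ i = m) ∨ p = m + 1) (C : ℕ) :
    Raise X n m C (gapRange a p i) (gapRange a p i) (C + 1) 0 := by
  rcases h with ⟨h, rfl⟩ | rfl
  · exact (Raise.range_inert h1 h2 (by omega) C).append (by omega) (s2 := 0)
      (Raise.range_plus h1 h2 (by omega) C)
  · exact (Raise.range_plus h1 h2 ham C).append (by omega) (s2 := 0)
      (Raise.range_inert h1 h2 (by omega) _)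

theorem Raise.gap_minus_matched (h1 : 1 ≤ m) (h2 : m < n) {a i : ℕ} (hi : m < i) (C : ℕ) :
    Raise X n m (C + 1) (gapRange a m i) (gapRange a m i) C 0 :=
  (Raise.range_inert h1 h2 (by omega) _).append (by omega) (s2 := 0)
    (Raise.range_minus_matched h1 h2 (by omega) C)

theorem Raise.gap_minus (h1 : 1 ≤ m) (h2 : m < n) {a i : ℕ} (ham : a ≤ m) (hi : m < i) :
    Raise X n m 0 (gapRange a m i) (gapRange a (m + 1) i) 0 1 := by
  have e : gapRange a (m + 1) i = letterRange a (m - 1) ++ ((m : ℤ) :: letterRange (m + 2) i) := by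
    rw [gapRange, show m + 1 - 1 = m by omega, ← letterRange_snoc ham h1]; simp
  rw [e]
  exact (Raise.range_inert h1 h2 (by omega) _).append (by omega) (s1 := 0)
    (Raise.range_minus h1 h2 (by omega))

end Lt

theorem gapRange_self {a i : ℕ} : gapRange a i i = letterRange a (i - 1) := by
  rw [gapRange, letterRange_of_lt (a := i + 1) (by omega), List.append_nil]

/-! ### The node `n` -/

/-- The bound on the heights of the columns. -/
def HeightBound : AffineType → ℕ → ℕ → Prop
  | .A, n, i => i ≤ n
  | .B, n, i => i + 1 ≤ n
  | .D, n, i => i + 2 ≤ n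

theorem HeightBound.mono {X : AffineType} {n i j : ℕ} (h : HeightBound X n i) (hj : j ≤ i) :
    HeightBound X n j := by
  cases X <;> simp only [HeightBound] at * <;> omega

theorem HeightBound.le {X : AffineType} {n i : ℕ} (h : HeightBound X n i) : i ≤ n := by
  cases X <;> simp only [HeightBound] at * <;> omega

/-- The number of steps from the letter `n` with a bar to `turnTop`. -/
def turnExp : AffineType → ℕ
  | .B => 2
  | _ => 1

/-- The letter obtained from the letter `n` with a bar by the maximal power of `e_n`. -/
def turnTop : AffineType → ℕ → ℕ
  | .D, n => n - 1
  | _, n => n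

section Last

variable {X : AffineType} {n : ℕ}

theorem Raise.last_letters_inert (hn : 2 ≤ n) {w : List ℤ}
    (h : ∀ v ∈ w, v ≠ 0 ∧ v ≠ n ∧ v ≠ -n ∧ (X = .D → v ≠ n - 1 ∧ v ≠ -(n - 1))) (C : ℕ) :
    Raise X n n C w w C 0 := by
  apply Raise.inert_list
  · intro v hv
    have := h v hv
    cases X with
    | A => rw [letterString_vecE_A (by omega), if_neg (by tauto)]
    | B => rw [letterString_vecE_B (by omega), if_neg (by tauto), if_neg (by tauto)]
    | D => rw [letterString_vecE_D hn, if_neg (by tauto)]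
  · intro v hv
    have := h v hv
    cases X with
    | A => rw [letterString_vecF_A (by omega), if_neg (by tauto)]
    | B => rw [letterString_vecF_B (by omega), if_neg (by tauto), if_neg (by tauto)]
    | D => rw [letterString_vecF_D hn, if_neg (by tauto)]

theorem Raise.last_range_inert (hn : 2 ≤ n) {a b : ℕ} (ha : 1 ≤ a) (hb : HeightBound X n b)
    (h : X = .A → b < n) (C : ℕ) :
    Raise X n n C (letterRange a b) (letterRange a b) C 0 := by
  apply Raise.last_letters_inert hn
  intro v hv
  rw [mem_letterRange] at hv
  cases X <;> simp only [HeightBound] at hb <;> simp at h ⊢ <;> omega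

theorem Raise.last_neg_inert (hn : 2 ≤ n) {q : ℕ} (ha : 1 ≤ q) (hb : HeightBound X n q)
    (h : X = .A → q < n) (C : ℕ) :
    Raise X n n C [-(q : ℤ)] [-(q : ℤ)] C 0 := by
  apply Raise.last_letters_inert hn
  intro v hv
  rw [List.mem_singleton] at hv
  cases X <;> simp only [HeightBound] at hb <;> simp at h ⊢ <;> omega

theorem Raise.last_gap_inert (hn : 2 ≤ n) {a p i : ℕ} (ha : 1 ≤ a) (hb : HeightBound X n i)
    (hp : 1 ≤ p) (hpi : p ≤ i) (h : X = .A → i < n ∨ p = i) (C : ℕ) :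
    Raise X n n C (gapRange a p i) (gapRange a p i) C 0 := by
  by_cases hpe : p = i
  · subst hpe
    rw [gapRange_self]
    exact Raise.last_range_inert hn ha (hb.mono (by omega)) (fun _ => by have := hb.le; omega) C
  · refine (Raise.last_range_inert hn ha (hb.mono (by omega)) (fun _ => by have := hb.le; omega)
      C).append (by omega) (s2 := 0) (Raise.last_range_inert hn (by omega) hb
        (fun hX => by have := h hX; omega) C)

theorem Raise.last_range_plus (hn : 2 ≤ n) {a : ℕ} (ha : 1 ≤ a) (han : a ≤ n) (C : ℕ) :
    Raise .A n n C (letterRange a n) (letterRange a n) (C + 1) 0 := by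
  rw [← letterRange_snoc han (by omega)]
  refine (Raise.last_range_inert hn ha (by simp [HeightBound]) (fun _ => by omega) C).append hn
    (s2 := 0) (Raise.plus ?_ ?_ C)
  · rw [letterString_vecE_A (by omega), if_neg (by omega)]
  · rw [letterString_vecF_A (by omega), if_pos rfl]

theorem Raise.last_gap_plus (hn : 2 ≤ n) {a p : ℕ} (ha : 1 ≤ a) (hp : p < n) (C : ℕ) :
    Raise .A n n C (gapRange a p n) (gapRange a p n) (C + 1) 0 :=
  (Raise.last_range_inert hn ha (by simp [HeightBound]; omega) (fun _ => by omega) C).append hn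
    (s2 := 0) (Raise.last_range_plus hn (by omega) (by omega) C)

theorem Raise.last_neg_minus_matched (hn : 2 ≤ n) (C : ℕ) :
    Raise .A n n (C + 1) [-(n : ℤ)] [-(n : ℤ)] C 0 := by
  apply Raise.minus_matched
  · rw [letterString_vecE_A (by omega), if_pos rfl]
  · rw [letterString_vecF_A (by omega), if_neg (by omega)]

theorem Raise.last_neg (X : AffineType) (hn : 2 ≤ n) :
    Raise X n n 0 [-(n : ℤ)] [(turnTop X n : ℤ)] 0 (turnExp X) := by
  cases X with
  | A =>
    apply Raise.minus
    · rw [letterString_vecE_A (by omega), if_pos rfl]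
    · rw [letterString_vecF_A (by omega), if_neg (by omega)]
    · simp [vecE, turnTop]
  | D =>
    apply Raise.minus
    · rw [letterString_vecE_D hn, if_pos (Or.inl rfl)]
    · rw [letterString_vecF_D hn, if_neg (by omega)]
    · simp only [vecE, lt_irrefl, and_false, if_false, if_true, turnTop, Option.some.injEq]
      omega
  | B =>
    have h1 : letterString (vecE .B n n) (-(n : ℤ)) = 2 := by
      rw [letterString_vecE_B (by omega), if_pos rfl]
    have h2 : letterString (vecF .B n n) (-(n : ℤ)) = 0 := by
      rw [letterString_vecF_B (by omega), if_neg (by omega), if_neg (by omega)]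
    have h3 : ¬ n = 0 := by omega
    refine ⟨?_, ?_, ?_⟩
    · simp [wordSig, h1, turnExp]
    · simp [wordSig, h1, h2]
    · simp [iterOpt, wordE, wordSig, vecE, turnTop, turnExp, h3]

end Last

/-- A word whose letters are all the letter `1` with a bar is not affected by the nodes `2, …, n`. -/
theorem Raise.trail {X : AffineType} {n m : ℕ} (hn : 3 ≤ n) (h1 : 2 ≤ m) (h2 : m ≤ n) {w : List ℤ}
    (hw : ∀ v ∈ w, v = -1) (C : ℕ) : Raise X n m C w w C 0 := by
  rcases Nat.lt_or_ge m n with h | h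
  · apply Raise.letters_inert (by omega) h
    intro v hv; have := hw v hv; omega
  · obtain rfl : m = n := by omega
    apply Raise.last_letters_inert (by omega)
    intro v hv; have := hw v hv
    refine ⟨by omega, by omega, by omega, fun _ => by omega⟩

/-! ### Columns which are raised around the turn -/

/-- The column `a, …, h` without one letter `p ≤ M`, and with the letter `M` with a bar. -/
def upColumn (a : ℕ) (trail : List ℤ) (h M : ℕ) : List ℤ :=
  gapRange a (min h M) h ++ [-(M : ℤ)] ++ trail

/-- The column `a, …, h - 1` together with a letter `M ≥ h`. -/
def downColumn (a : ℕ) (trail : List ℤ) (h M : ℕ) : List ℤ :=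
  letterRange a (h - 1) ++ [((max h M : ℕ) : ℤ)] ++ trail

section Tall

variable {X : AffineType} {n a : ℕ} {trail : List ℤ}

theorem Raise.upColumn {m : ℕ} (hn : 3 ≤ n) (htr : ∀ v ∈ trail, v = -1) (ha : a ≤ 2)
    (h1 : 2 ≤ m) (h2 : m < n) (h : ℕ) :
    Raise X n m 0 (upColumn a trail h m) (upColumn a trail h (m + 1)) 0
      (1 + if m < h then 1 else 0) := by
  have key : Raise X n m 0 (gapRange a (min h m) h) (gapRange a (min h (m + 1)) h) 0
      (if m < h then 1 else 0) := by
    split_ifs with hm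
    · rw [min_eq_right (by omega), min_eq_right (by omega)]
      exact Raise.gap_minus (by omega) h2 (by omega) hm
    · rw [min_eq_left (by omega), min_eq_left (by omega)]
      exact Raise.gap_inert (by omega) h2 (by omega) le_rfl (by omega) 0
  have := (key.append (by omega) (Raise.neg_minus (by omega) h2)).append (by omega)
    (Raise.trail hn (by omega) (by omega) htr 0)
  rw [Nat.add_comm 1, KRcrystals.upColumn, KRcrystals.upColumn, Nat.cast_succ]
  exact this

theorem Raise.turnColumn (hn : 3 ≤ n) (htr : ∀ v ∈ trail, v = -1) (ha1 : 1 ≤ a) {h : ℕ}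
    (hh : HeightBound X n h) (h1 : 1 ≤ h) :
    Raise X n n 0 (KRcrystals.upColumn a trail h n) (downColumn a trail h (turnTop X n)) 0
      (turnExp X) := by
  rw [KRcrystals.upColumn, downColumn, min_eq_left hh.le, max_eq_right, gapRange_self]
  · have := ((Raise.last_range_inert (X := X) (by omega) ha1 (hh.mono (j := h - 1) (by omega))
      (fun _ => by have := hh.le; omega) 0).append (by omega) (Raise.last_neg X (by omega))).append
      (by omega) (Raise.trail hn (by omega) (by omega) htr 0)
    rw [Nat.zero_add, Nat.add_zero] at this
    exact this
  · cases X <;> simp only [turnTop, HeightBound] at * <;> omega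

theorem Raise.downColumn {m : ℕ} (hn : 3 ≤ n) (htr : ∀ v ∈ trail, v = -1) (ha : a ≤ 2)
    (h1 : 2 ≤ m) (h2 : m < n) {h C : ℕ} (hh : 2 ≤ h) (hC : h ≤ m → C = 0) :
    Raise X n m C (downColumn a trail h (m + 1)) (downColumn a trail h m) C
      (if h ≤ m then 1 else 0) := by
  split_ifs with hm
  · obtain rfl := hC hm
    rw [KRcrystals.downColumn, KRcrystals.downColumn, max_eq_right (by omega), max_eq_right hm]
    have := ((Raise.range_inert (X := X) (m := m) (a := a) (b := h - 1) (by omega) h2 (by omega)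
      0).append (by omega) (Raise.letter_minus (by omega) h2)).append (by omega)
      (Raise.trail hn (by omega) (by omega) htr 0)
    exact_mod_cast this
  · rw [KRcrystals.downColumn, KRcrystals.downColumn, max_eq_left (by omega),
      max_eq_left (by omega), letterRange_snoc (by omega) (by omega)]
    exact (Raise.range_inert (by omega) h2 (by omega) C).append (by omega) (s2 := 0)
      (Raise.trail hn (by omega) (by omega) htr C)

theorem downColumn_of_le {h M : ℕ} (ha : a ≤ h) (hh : 1 ≤ h) (hM : M ≤ h) :
    KRcrystals.downColumn a trail h M = letterRange a h ++ trail := by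
  rw [KRcrystals.downColumn, max_eq_left hM, letterRange_snoc ha hh]

/-- A string of letters starting with `1` or `2` is highest for the nodes `2, …, n`. -/
theorem wordSig_range_fst {m : ℕ} (hn : 3 ≤ n) (ha1 : 1 ≤ a) (ha : a ≤ 2) (h1 : 2 ≤ m) (h2 : m ≤ n)
    {h : ℕ} (hh : HeightBound X n h) : (wordSig X n m (letterRange a h)).1 = 0 := by
  rcases Nat.lt_or_ge m n with h | h'
  · rcases Nat.lt_trichotomy m ‹ℕ› with h3 | h3 | h3
    · exact (Raise.range_inert (by omega) h (by omega) 0).eps_eq_zero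
    · subst h3; exact (Raise.range_plus (by omega) h (by omega) 0).eps_eq_zero
    · exact (Raise.range_inert (by omega) h (by omega) 0).eps_eq_zero
  · obtain rfl : m = n := by omega
    by_cases hA : X = .A ∧ h = m
    · obtain ⟨rfl, rfl⟩ := hA
      exact (Raise.last_range_plus (by omega) ha1 (by omega) 0).eps_eq_zero
    · exact (Raise.last_range_inert (by omega) ha1 hh
        (fun hX => by have := hh.le; have : h ≠ m := fun e => hA ⟨hX, e⟩; omega) 0).eps_eq_zero

theorem wordSig_trail_fst {m : ℕ} (hn : 3 ≤ n) (h1 : 2 ≤ m) (h2 : m ≤ n)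
    (htr : ∀ v ∈ trail, v = -1) : (wordSig X n m trail).1 = 0 :=
  (Raise.trail hn h1 h2 htr 0).eps_eq_zero

end Tall

/-! ### Blocks of columns which are raised around the turn -/

section TallBlock

variable {X : AffineType} {n a t : ℕ} {trail : List ℤ} {h : ℕ → ℕ}

theorem Raise.upBlock {m : ℕ} (hn : 3 ≤ n) (htr : ∀ v ∈ trail, v = -1) (ha : a ≤ 2)
    (h1 : 2 ≤ m) (h2 : m < n) (h : ℕ → ℕ) (t : ℕ) :
    Raise X n m 0 (concatCols t fun c => KRcrystals.upColumn a trail (h c) m)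
      (concatCols t fun c => KRcrystals.upColumn a trail (h c) (m + 1)) 0
      (∑ c ∈ Finset.range t, (1 + if m < h c then 1 else 0)) :=
  Raise.concat_zero (by omega) _ 0 fun c _ => Raise.upColumn hn htr ha h1 h2 (h c)

theorem Raise.turnBlock (hn : 3 ≤ n) (htr : ∀ v ∈ trail, v = -1) (ha1 : 1 ≤ a)
    (hh : ∀ c < t, 2 ≤ h c ∧ HeightBound X n (h c)) :
    Raise X n n 0 (concatCols t fun c => KRcrystals.upColumn a trail (h c) n)
      (concatCols t fun c => KRcrystals.downColumn a trail (h c) (turnTop X n)) 0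
      (t * turnExp X) := by
  have := Raise.concat_zero (X := X) (i := n) (n := n) (by omega) (k := t)
    (f := fun c => KRcrystals.upColumn a trail (h c) n)
    (g := fun c => KRcrystals.downColumn a trail (h c) (turnTop X n))
    (fun _ => turnExp X) 0 fun c hc =>
      Raise.turnColumn hn htr ha1 (hh c hc).2 (by have := (hh c hc).1; omega)
  simpa using this

theorem Raise.downBlock {m C : ℕ} (hn : 3 ≤ n) (htr : ∀ v ∈ trail, v = -1) (ha : a ≤ 2)
    (h1 : 2 ≤ m) (h2 : m < n) (hh : ∀ c < t, 2 ≤ h c) (hC : ∀ c < t, h c ≤ m → C = 0) :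
    Raise X n m C (concatCols t fun c => KRcrystals.downColumn a trail (h c) (m + 1))
      (concatCols t fun c => KRcrystals.downColumn a trail (h c) m) C
      (∑ c ∈ Finset.range t, if h c ≤ m then 1 else 0) :=
  Raise.concat_zero (by omega) _ C fun c hc =>
    Raise.downColumn hn htr ha h1 h2 (hh c hc) (hC c hc)

end TallBlock

/-! ### Raising along a list of nodes -/

/-- The maximal powers of `e_i` for the nodes `i` in the list have the exponents given in the list
and lead from `w` to `w'`. -/
def RaisePath (X : AffineType) (n : ℕ) : List (ℕ × ℕ) → List ℤ → List ℤ → Prop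
  | [], w, w' => w = w'
  | p :: L, w, w' => ∃ v C, Raise X n p.1 0 w v C p.2 ∧ RaisePath X n L v w'

section RaisePath

variable {X : AffineType} {n : ℕ}

theorem RaisePath.append {L L' : List (ℕ × ℕ)} {w w' w'' : List ℤ} (h : RaisePath X n L w w')
    (h' : RaisePath X n L' w' w'') : RaisePath X n (L ++ L') w w'' := by
  induction L generalizing w with
  | nil => obtain rfl : w = w' := h; exact h'
  | cons p L ih =>
    obtain ⟨v, C, h1, h2⟩ := h
    exact ⟨v, C, h1, ih h2⟩

theorem RaisePath.single {i s C : ℕ} {w w' : List ℤ} (h : Raise X n i 0 w w' C s) :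
    RaisePath X n [(i, s)] w w' := ⟨w', C, h, rfl⟩

theorem RaisePath.up {s : ℕ → ℕ} {W : ℕ → List ℤ} {a len : ℕ}
    (h : ∀ m, a ≤ m → m < a + len → ∃ C, Raise X n m 0 (W m) (W (m + 1)) C (s m)) :
    RaisePath X n ((List.range' a len).map fun m => (m, s m)) (W a) (W (a + len)) := by
  induction len generalizing a with
  | zero => rfl
  | succ len ih =>
    rw [List.range'_succ]
    obtain ⟨C, hC⟩ := h a le_rfl (by omega)
    refine ⟨_, C, hC, ?_⟩
    have := ih (a := a + 1) fun m h1 h2 => h m (by omega) (by omega)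
    rwa [show a + 1 + len = a + (len + 1) by omega] at this

theorem RaisePath.down {s : ℕ → ℕ} {W : ℕ → List ℤ} {a len : ℕ}
    (h : ∀ m, a ≤ m → m < a + len → ∃ C, Raise X n m 0 (W (m + 1)) (W m) C (s m)) :
    RaisePath X n ((List.range' a len).reverse.map fun m => (m, s m)) (W (a + len)) (W a) := by
  induction len generalizing a with
  | zero => rfl
  | succ len ih =>
    rw [List.range'_succ, List.reverse_cons, List.map_append]
    have := ih (a := a + 1) fun m h1 h2 => h m (by omega) (by omega)
    rw [show a + 1 + len = a + (len + 1) by omega] at this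
    obtain ⟨C, hC⟩ := h a le_rfl (by omega)
    exact this.append (RaisePath.single hC)

theorem RaisePath.idle {L : List ℕ} {w : List ℤ} (h : ∀ i ∈ L, (wordSig X n i w).1 = 0) :
    RaisePath X n (L.map fun i => (i, 0)) w w := by
  induction L with
  | nil => rfl
  | cons i L ih =>
    exact ⟨w, _, Raise.of_sig (by simp [h i (by simp)]), ih fun j hj => h j (by simp [hj])⟩

/-- The word with the exponents of a path. -/
def pathWord (L : List (ℕ × ℕ)) : List ℕ := L.flatMap fun p => List.replicate p.2 p.1

theorem pathWord_append (L L' : List (ℕ × ℕ)) : pathWord (L ++ L') = pathWord L ++ pathWord L' := by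
  simp [pathWord]

theorem pathWord_zero (L : List ℕ) : pathWord (L.map fun i => (i, 0)) = [] := by
  simp [pathWord]

theorem Ops.eWord_append {β : Type} (C : Ops β) (u v : List ℕ) (b : β) :
    C.eWord (u ++ v) b = (C.eWord u b).bind (C.eWord v) := by
  induction u generalizing b with
  | nil => rfl
  | cons i u ih =>
    simp only [List.cons_append, Ops.eWord]
    cases C.e i b with
    | none => rfl
    | some c => simp [ih]

theorem Ops.fWord_append {β : Type} (C : Ops β) (u v : List ℕ) (b : β) :
    C.fWord (u ++ v) b = (C.fWord u b).bind (C.fWord v) := by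
  induction u generalizing b with
  | nil => rfl
  | cons i u ih =>
    simp only [List.cons_append, Ops.fWord]
    cases C.f i b with
    | none => rfl
    | some c => simp [ih]

theorem Ops.eWord_replicate {β : Type} (C : Ops β) (i s : ℕ) (b : β) :
    C.eWord (List.replicate s i) b = iterOpt (C.e i) s b := by
  induction s generalizing b with
  | zero => rfl
  | succ s ih =>
    rw [List.replicate_succ, Ops.eWord, iterOpt_succ]
    cases C.e i b with
    | none => rfl
    | some c => simp [ih]

theorem iterOpt_tableau_e (X : AffineType) (n i s : ℕ) (T : Tableau) :
    iterOpt ((tableauOps X n).e i) s T =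
      (iterOpt (wordE X n i) s T.word).map fun w => ⟨T.heights, w⟩ := by
  induction s generalizing T with
  | zero => rfl
  | succ s ih =>
    rw [iterOpt_succ, iterOpt_succ]
    simp only [tableauOps] at ih ⊢
    cases wordE X n i T.word with
    | none => rfl
    | some w => simp [ih]

theorem RaisePath.maximalRaising {L : List (ℕ × ℕ)} {w w' : List ℤ} (h : RaisePath X n L w w')
    (H : List ℕ) : maximalRaising X n (L.map Prod.fst) ⟨H, w⟩ = pathWord L := by
  induction L generalizing w with
  | nil => rfl
  | cons p L ih =>
    obtain ⟨v, C, h1, h2⟩ := h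
    have hs : (wordSig X n p.1 w).1 = p.2 := by have := h1.exp; omega
    simp only [List.map_cons, KRcrystals.maximalRaising, hs, iterOpt_tableau_e, h1.iter,
      Option.map_some]
    rw [ih h2]
    simp [pathWord]

theorem RaisePath.eWord {L : List (ℕ × ℕ)} {w w' : List ℤ} (h : RaisePath X n L w w')
    (H : List ℕ) : (tableauOps X n).eWord (pathWord L) ⟨H, w⟩ = some ⟨H, w'⟩ := by
  induction L generalizing w with
  | nil => obtain rfl : w = w' := h; rfl
  | cons p L ih =>
    obtain ⟨v, C, h1, h2⟩ := h
    have : pathWord (p :: L) = List.replicate p.2 p.1 ++ pathWord L := by simp [pathWord]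
    rw [this, Ops.eWord_append, Ops.eWord_replicate, iterOpt_tableau_e, h1.iter]
    exact ih h2

theorem fWord_reverse_of_eWord (hn : 2 ≤ n) {u : List ℕ} {b b' : Tableau}
    (h : (tableauOps X n).eWord u b = some b') :
    (tableauOps X n).fWord u.reverse b' = some b := by
  induction u generalizing b with
  | nil => obtain rfl : b = b' := by simpa [Ops.eWord] using h
           rfl
  | cons i u ih =>
    obtain ⟨c, hc, hc'⟩ := Option.bind_eq_some_iff.1 (by simpa only [Ops.eWord] using h)
    rw [List.reverse_cons, Ops.fWord_append, ih hc', Option.bind_some]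
    obtain ⟨w, hw, rfl⟩ := Option.map_eq_some_iff.1 hc
    simp [Ops.fWord, tableauOps, (wordE_eq_some hn hw).1]

end RaisePath

/-! ### Sweeps -/

/-- The nodes `2, …, n-1, n, n-1, …, 2` with exponents. -/
def sweepList (n : ℕ) (u : ℕ → ℕ) (s : ℕ) (v : ℕ → ℕ) : List (ℕ × ℕ) :=
  ((List.range' 2 (n - 2)).map fun m => (m, u m)) ++ [(n, s)] ++
    (List.range' 2 (n - 2)).reverse.map fun m => (m, v m)

theorem sweepList_fst {n : ℕ} (hn : 2 ≤ n) (u : ℕ → ℕ) (s : ℕ) (v : ℕ → ℕ) :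
    (sweepList n u s v).map Prod.fst =
      List.range' 2 (n - 1) ++ (List.range' 2 (n - 2)).reverse := by
  have : List.range' 2 (n - 1) = List.range' 2 (n - 2) ++ [n] := by
    rw [show n - 1 = n - 2 + 1 by omega, List.range'_1_concat, show 2 + (n - 2) = n by omega]
  rw [this, sweepList]
  simp [Function.comp_def]

theorem RaisePath.raisingWord {X : AffineType} {n : ℕ} (hn : 2 ≤ n) {u v : ℕ → ℕ} {s : ℕ}
    {w w' : List ℤ} (h : RaisePath X n (sweepList n u s v) w w')
    (hw : ∀ m, 2 ≤ m → m ≤ n → (wordSig X n m w').1 = 0) (H : List ℕ) :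
    raisingWord X n ⟨H, w⟩ = pathWord (sweepList n u s v) := by
  rw [KRcrystals.raisingWord, show n = (n - 1) + 1 by omega, List.replicate_succ,
    show n - 1 + 1 = n by omega, List.flatten_cons, ← sweepList_fst hn u s v]
  set L := sweepList n u s v
  have h2 : RaisePath X n (L ++
      (List.replicate (n - 1) (L.map Prod.fst)).flatten.map fun i => (i, 0)) w w' := by
    refine h.append (RaisePath.idle fun i hi => ?_)
    obtain ⟨l, hl, hil⟩ := List.mem_flatten.1 hi
    obtain ⟨_, rfl⟩ := List.mem_replicate.1 hl
    rw [sweepList_fst hn] at hil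
    simp only [List.mem_append, List.mem_reverse, List.mem_range'_1] at hil
    exact hw i (by omega) (by omega)
  have h3 := h2.maximalRaising H
  rw [pathWord_append, pathWord_zero, List.append_nil, List.map_append] at h3
  simpa [Function.comp_def] using h3

/-- Raising a word consisting of columns `c < t`, which go around the turn, preceded by a word `O`
which is stationary from the node `n` on. -/
theorem raisePath_sweep {X : AffineType} {n a t : ℕ} {trail : List ℤ} {h : ℕ → ℕ} (hn : 3 ≤ n)
    (htr : ∀ v ∈ trail, v = -1) (ha1 : 1 ≤ a) (ha : a ≤ 2)
    (hh : ∀ c < t, 2 ≤ h c ∧ HeightBound X n (h c)) {O : ℕ → List ℤ} {so : ℕ → ℕ}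
    (hup : ∀ m, 2 ≤ m → m < n → ∃ C, Raise X n m 0 (O m) (O (m + 1)) C (so m) ∧ (0 < t → C = 0))
    (hlast : ∃ C, Raise X n n 0 (O n) (O n) C 0 ∧ (0 < t → C = 0))
    (hdown : ∀ m, 2 ≤ m → m < n →
      ∃ C, Raise X n m 0 (O n) (O n) C 0 ∧ ∀ c < t, h c ≤ m → C = 0) :
    let w' := O n ++ concatCols t fun c => letterRange a (h c) ++ trail
    RaisePath X n
      (sweepList n (fun m => so m + ∑ c ∈ Finset.range t, (1 + if m < h c then 1 else 0))
        (t * turnExp X)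
        (fun m => if turnTop X n ≤ m then 0 else
          ∑ c ∈ Finset.range t, if h c ≤ m then 1 else 0))
      (O 2 ++ concatCols t fun c => upColumn a trail (h c) 2) w' ∧
    ∀ m, 2 ≤ m → m ≤ n → (wordSig X n m w').1 = 0 := by
  intro w'
  have turn : RaisePath X n [(n, t * turnExp X)] (O n ++ concatCols t fun c => upColumn a trail (h c) n)
      (O n ++ concatCols t fun c => downColumn a trail (h c) (min n (turnTop X n))) := by
    obtain ⟨C, hC, hC'⟩ := hlast
    rw [← Nat.zero_add (t * _)]
    rcases Nat.eq_zero_or_pos t with rfl | ht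
    · rw [Nat.zero_mul]
      exact RaisePath.single (hC.append (by omega) (Raise.nil C))
    · rw [hC' ht] at hC
      refine RaisePath.single (hC.append (by omega) (C2 := 0) ?_)
      rw [min_eq_right (by cases X <;> simp [turnTop])]
      exact Raise.turnBlock hn htr ha1 hh
  refine ⟨(RaisePath.append ?_ turn).append ?_, ?_⟩
  · have := RaisePath.up (X := X) (n := n) (a := 2) (len := n - 2)
      (W := fun M => O M ++ concatCols t fun c => upColumn a trail (h c) M)
      (s := fun m => so m + ∑ c ∈ Finset.range t, (1 + if m < h c then 1 else 0)) ?_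
    · rwa [show 2 + (n - 2) = n by omega] at this
    · intro m h1 h2
      obtain ⟨C, hC, hC'⟩ := hup m h1 (by omega)
      rcases Nat.eq_zero_or_pos t with rfl | ht
      · exact ⟨C, hC.append (by omega) (Raise.nil C)⟩
      · obtain rfl := hC' ht
        exact ⟨0, hC.append (by omega) (Raise.upBlock hn htr ha h1 (by omega) h t)⟩
  · have := RaisePath.down (X := X) (n := n) (a := 2) (len := n - 2)
      (W := fun M => O n ++ concatCols t fun c => downColumn a trail (h c) (min M (turnTop X n)))
      (s := fun m => if turnTop X n ≤ m then 0 else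
          ∑ c ∈ Finset.range t, if h c ≤ m then 1 else 0) ?_
    · rw [show 2 + (n - 2) = n by omega] at this
      have e : w' = O n ++ concatCols t fun c => downColumn a trail (h c) (min 2 (turnTop X n)) := by
        simp only [w']
        congr 1
        apply concatCols_congr
        intro c hc
        have := (hh c hc).1
        rw [downColumn_of_le (by omega) (by omega) ((min_le_left _ _).trans this)]
      rwa [e]
    · intro m h1 h2
      obtain ⟨C, hC, hC'⟩ := hdown m h1 (by omega)
      by_cases hD : turnTop X n ≤ m
      · obtain ⟨rfl, rfl⟩ : X = .D ∧ m = n - 1 := by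
          cases X <;> simp only [turnTop] at hD <;> first | omega | exact ⟨rfl, by omega⟩
        simp only [turnTop, le_refl, if_true]
        rw [min_self, min_eq_right (by omega)]
        refine ⟨_, Raise.of_sig (le_of_eq ?_)⟩
        apply wordSig_fst_append_eq_zero hC.eps_eq_zero
        apply wordSig_fst_concat_eq_zero
        intro c hc
        obtain ⟨h3, h4⟩ := hh c hc
        simp only [HeightBound] at h4
        rw [downColumn, max_eq_right (by omega)]
        exact (((Raise.range_inert (by omega) (by omega) (by omega) 0).append (by omega) (s1 := 0)
          (s2 := 0) (Raise.letter_plus (by omega) (by omega) 0)).append (by omega) (s2 := 0)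
          (Raise.trail hn (by omega) (by omega) htr _)).eps_eq_zero
      · have hm : m + 1 ≤ turnTop X n := by omega
        simp only [if_neg hD]
        rw [min_eq_left hm, min_eq_left (by omega : m ≤ turnTop X n), ← Nat.zero_add (∑ c ∈ _, _)]
        exact ⟨C, hC.append (by omega)
          (Raise.downBlock hn htr ha h1 (by omega) (fun c hc => (hh c hc).1) hC')⟩
  · intro m h1 h2
    apply wordSig_fst_append_eq_zero
    · rcases Nat.lt_or_ge m n with h3 | h3
      · obtain ⟨C, hC, _⟩ := hdown m h1 h3
        exact hC.eps_eq_zero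
      · obtain rfl : m = n := by omega
        obtain ⟨C, hC, _⟩ := hlast
        exact hC.eps_eq_zero
    · apply wordSig_fst_concat_eq_zero
      intro c hc
      exact wordSig_fst_append_eq_zero (wordSig_range_fst hn ha1 ha h1 h2 (hh c hc).2)
        (wordSig_trail_fst hn h1 h2 htr)

/-- The heights of the `k` columns, from left to right, of a tableau whose shape is a dominant weight
in `B^{r,k}` without empty columns; by convention `h c = 1` from the index `k` on. -/
structure ColumnHeights (k r : ℕ) (h : ℕ → ℕ) : Prop where
  anti : Antitone h
  even : ∀ c < k, h c % 2 = 0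
  two_le : ∀ c < k, 2 ≤ h c
  le : ∀ c, h c ≤ r
  one : ∀ c, k ≤ c → h c = 1

/-- The number of columns of height `m` from the index `x` on. -/
def countFrom (h : ℕ → ℕ) (k m x : ℕ) : ℕ := ((Finset.Ico x k).filter fun c => h c = m).card

namespace ColumnHeights

variable {k r m : ℕ} {h : ℕ → ℕ} (H : ColumnHeights k r h)
include H

theorem one_le (c : ℕ) : 1 ≤ h c := by
  rcases Nat.lt_or_ge c k with hc | hc
  · have := H.two_le c hc; omega
  · rw [H.one c hc]

theorem countFrom_succ (hm : 2 ≤ m) (x : ℕ) :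
    countFrom h k m x = countFrom h k m (x + 1) + if h x = m then 1 else 0 := by
  rcases Nat.lt_or_ge x k with hx | hx
  · have : Finset.Ico x k = insert x (Finset.Ico (x + 1) k) := by
      ext c; simp; omega
    rw [countFrom, this, Finset.filter_insert]
    split_ifs with hxm
    · rw [Finset.card_insert_of_notMem (by simp)]; rfl
    · rfl
  · rw [if_neg (by rw [H.one x hx]; omega), countFrom, countFrom, Finset.Ico_eq_empty (by omega),
      Finset.Ico_eq_empty (by omega)]
    rfl

theorem countFrom_of_lt {x y : ℕ} (hxy : x ≤ y) (hy : m < h y) :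
    countFrom h k m x = countFrom h k m (y + 1) := by
  unfold countFrom
  congr 1
  ext c
  simp only [Finset.mem_filter, Finset.mem_Ico]
  constructor
  · rintro ⟨hc, rfl⟩
    refine ⟨⟨?_, hc.2⟩, rfl⟩
    by_contra hcy
    have := H.anti (show c ≤ y by omega)
    omega
  · rintro ⟨hc, rfl⟩
    exact ⟨⟨by omega, hc.2⟩, rfl⟩

theorem countFrom_eq_zero {x : ℕ} (hx : h x < m) : countFrom h k m x = 0 := by
  rw [countFrom, Finset.card_eq_zero, Finset.filter_eq_empty_iff]
  intro c hc
  have := H.anti (Finset.mem_Ico.1 hc).1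
  omega

omit H in
theorem countFrom_antitone {x y : ℕ} (hxy : x ≤ y) : countFrom h k m y ≤ countFrom h k m x :=
  Finset.card_le_card (Finset.filter_subset_filter _ (Finset.Ico_subset_Ico_left hxy))

omit H in
theorem countFrom_of_le {x : ℕ} (hx : k ≤ x) : countFrom h k m x = 0 := by
  rw [countFrom, Finset.Ico_eq_empty (by omega)]; rfl

end ColumnHeights

section Columns

variable {X : AffineType} {n k r m : ℕ} {h : ℕ → ℕ}

/-! ### Columns with a gap and a barred letter -/

theorem Raise.gap_up (H : ColumnHeights k r h) (h1 : 2 ≤ m) (h2 : m < n) {x y : ℕ} (hxy : x ≤ y) :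
    Raise X n m (countFrom h k m (x + 1) - countFrom h k m (y + 2))
      (gapRange 1 (min (h (y + 1)) m) (h x)) (gapRange 1 (min (h (y + 1)) (m + 1)) (h x))
      (countFrom h k m x - countFrom h k m (y + 1)) (if m < h (y + 1) then 1 else 0) := by
  have e1 := H.countFrom_succ h1 x
  have e2 := H.countFrom_succ h1 (y + 1)
  rw [show y + 1 + 1 = y + 2 from rfl] at e2
  have e3 := H.anti (show x ≤ y + 1 by omega)
  have e4 := ColumnHeights.countFrom_antitone (h := h) (k := k) (m := m)
    (show x + 1 ≤ y + 1 by omega)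
  rcases Nat.lt_trichotomy (h (y + 1)) m with c1 | c1 | c1
  · rw [if_neg (by omega), min_eq_left (by omega), min_eq_left (by omega)]
    rw [if_neg (by omega)] at e2
    by_cases c2 : h x = m
    · rw [if_pos c2] at e1
      rw [e1, e2, Nat.add_zero, Nat.sub_add_comm (by omega), c2]
      exact Raise.gap_plus (by omega) h2 (by omega) (by omega) _
    · rw [if_neg c2] at e1
      rw [e1, e2]
      exact Raise.gap_inert (by omega) h2 (by omega) e3 (by omega) _
  · rw [if_neg (by omega), min_eq_left (by omega), min_eq_left (by omega), c1]
    rw [if_pos (by omega)] at e2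
    by_cases c2 : h x = m
    · rw [if_pos c2] at e1
      rw [e1, e2, Nat.add_sub_add_right, c2]
      exact Raise.gap_inert (by omega) h2 (by omega) le_rfl (by omega) _
    · rw [if_neg c2] at e1
      rw [e1, Nat.add_zero, show countFrom h k m (x + 1) - countFrom h k m (y + 2) =
        countFrom h k m (x + 1) - countFrom h k m (y + 1) + 1 by omega]
      exact Raise.gap_minus_matched (by omega) h2 (by omega) _
  · have e5 := H.countFrom_of_lt (show x ≤ y + 1 by omega) c1
    have e6 := H.countFrom_of_lt (show y + 1 ≤ y + 1 by omega) c1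
    rw [show y + 1 + 1 = y + 2 from rfl] at e5 e6
    rw [if_neg (by omega)] at e1
    rw [if_pos c1, min_eq_right (by omega), min_eq_right (by omega),
      show countFrom h k m (x + 1) - countFrom h k m (y + 2) = 0 by omega,
      show countFrom h k m x - countFrom h k m (y + 1) = 0 by omega]
    exact Raise.gap_minus (by omega) h2 (by omega) (by omega)

theorem Raise.neg_letter_inert (h1 : 1 ≤ m) (h2 : m < n) {q : ℕ} (ha : q ≠ m) (hb : q ≠ m + 1)
    (C : ℕ) : Raise X n m C [-(q : ℤ)] [-(q : ℤ)] C 0 := by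
  rcases Nat.eq_zero_or_pos q with rfl | hq
  · exact Raise.letter_inert h1 h2 (by omega) (by omega) (by omega) (by omega) C
  · exact Raise.letter_inert h1 h2 (by omega) (by omega) (by omega) (by omega) C

theorem Raise.neg_up (H : ColumnHeights k r h) (h1 : 2 ≤ m) (h2 : m < n) {x y : ℕ} (hxy : x ≤ y) :
    Raise X n m (countFrom h k m x - countFrom h k m (y + 1))
      [-((min (h y) m : ℕ) : ℤ)] [-((min (h y) (m + 1) : ℕ) : ℤ)]
      (countFrom h k m x - countFrom h k m y) (if m < h y then 1 else 0) := by
  have e2 := H.countFrom_succ h1 y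
  have e4 := ColumnHeights.countFrom_antitone (h := h) (k := k) (m := m) hxy
  rcases Nat.lt_trichotomy (h y) m with c1 | c1 | c1
  · rw [if_neg (by omega), min_eq_left (by omega), min_eq_left (by omega)]
    rw [if_neg (by omega)] at e2
    rw [e2]
    exact Raise.neg_letter_inert (by omega) h2 (by omega) (by omega) _
  · rw [if_neg (by omega), min_eq_left (by omega), min_eq_left (by omega), c1]
    rw [if_pos (by omega)] at e2
    rw [show countFrom h k m x - countFrom h k m (y + 1) =
        countFrom h k m x - countFrom h k m y + 1 by omega]
    exact Raise.neg_minus_matched (by omega) h2 _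
  · have e5 := H.countFrom_of_lt hxy c1
    have e6 := H.countFrom_of_lt le_rfl c1
    rw [if_pos c1, min_eq_right (by omega), min_eq_right (by omega),
      show countFrom h k m x - countFrom h k m (y + 1) = 0 by omega,
      show countFrom h k m x - countFrom h k m y = 0 by omega, Nat.cast_succ]
    exact Raise.neg_minus (by omega) h2

theorem Raise.gap_last (H : ColumnHeights k r h) (hn : 3 ≤ n) (hr : HeightBound X n r) {x y : ℕ}
    (hxy : x ≤ y) :
    Raise X n n (countFrom h k n (x + 1) - countFrom h k n (y + 2))
      (gapRange 1 (h (y + 1)) (h x)) (gapRange 1 (h (y + 1)) (h x))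
      (countFrom h k n x - countFrom h k n (y + 1)) 0 := by
  have e1 := H.countFrom_succ (show 2 ≤ n by omega) x
  have e2 := H.countFrom_succ (show 2 ≤ n by omega) (y + 1)
  rw [show y + 1 + 1 = y + 2 from rfl] at e2
  have e3 := H.anti (show x ≤ y + 1 by omega)
  have e4 := ColumnHeights.countFrom_antitone (h := h) (k := k) (m := n)
    (show x + 1 ≤ y + 1 by omega)
  have e5 := hr.mono (H.le x)
  have e6 := e5.le
  by_cases c1 : h x = n
  · obtain rfl : X = .A := by
      cases X <;> simp only [HeightBound] at e5 <;> first | omega | rfl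
    rw [if_pos c1] at e1
    by_cases c2 : h (y + 1) = n
    · rw [if_pos c2] at e2
      rw [e1, e2, Nat.add_sub_add_right]
      exact Raise.last_gap_inert (by omega) le_rfl e5 (H.one_le _) e3 (fun _ => by omega) _
    · rw [if_neg c2] at e2
      rw [e1, e2, Nat.add_zero, Nat.sub_add_comm (by omega), c1]
      exact Raise.last_gap_plus (by omega) le_rfl (by omega) _
  · rw [if_neg c1] at e1
    rw [if_neg (by omega)] at e2
    rw [e1, e2]
    exact Raise.last_gap_inert (by omega) le_rfl e5 (H.one_le _) e3 (fun _ => by omega) _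

theorem Raise.neg_last (H : ColumnHeights k r h) (hn : 3 ≤ n) (hr : HeightBound X n r) {x y : ℕ}
    (hxy : x ≤ y) :
    Raise X n n (countFrom h k n x - countFrom h k n (y + 1))
      [-((h y : ℕ) : ℤ)] [-((h y : ℕ) : ℤ)] (countFrom h k n x - countFrom h k n y) 0 := by
  have e2 := H.countFrom_succ (show 2 ≤ n by omega) y
  have e4 := ColumnHeights.countFrom_antitone (h := h) (k := k) (m := n) hxy
  have e5 := hr.mono (H.le y)
  have e6 := e5.le
  by_cases c1 : h y = n
  · obtain rfl : X = .A := by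
      cases X <;> simp only [HeightBound] at e5 <;> first | omega | rfl
    rw [if_pos c1] at e2
    rw [show countFrom h k n x - countFrom h k n (y + 1) =
        countFrom h k n x - countFrom h k n y + 1 by omega, c1]
    exact Raise.last_neg_minus_matched (by omega) _
  · rw [if_neg c1] at e2
    rw [e2]
    exact Raise.last_neg_inert (by omega) (H.one_le _) e5 (fun _ => by omega) _

theorem Raise.gap_down (H : ColumnHeights k r h) (h1 : 2 ≤ m) (h2 : m < n) {x y : ℕ}
    (hxy : x ≤ y) :
    Raise X n m
      (countFrom h k m (x + 1) - countFrom h k m (y + 2) + countFrom h k (m + 1) (y + 2))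
      (gapRange 1 (h (y + 1)) (h x)) (gapRange 1 (h (y + 1)) (h x))
      (countFrom h k m x - countFrom h k m (y + 1) + countFrom h k (m + 1) (y + 1)) 0 := by
  have e1 := H.countFrom_succ h1 x
  have e2 := H.countFrom_succ h1 (y + 1)
  have e0 := H.countFrom_succ (show 2 ≤ m + 1 by omega) (y + 1)
  rw [show y + 1 + 1 = y + 2 from rfl] at e2 e0
  have e3 := H.anti (show x ≤ y + 1 by omega)
  have e4 := ColumnHeights.countFrom_antitone (h := h) (k := k) (m := m)
    (show x + 1 ≤ y + 1 by omega)
  generalize countFrom h k m x = a1 at *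
  generalize countFrom h k m (x + 1) = a2 at *
  generalize countFrom h k m (y + 1) = a3 at *
  generalize countFrom h k m (y + 2) = a4 at *
  generalize countFrom h k (m + 1) (y + 1) = a5 at *
  generalize countFrom h k (m + 1) (y + 2) = a6 at *
  by_cases p1 : (h (y + 1) < m ∧ h x = m) ∨ h (y + 1) = m + 1
  · rw [show a1 - a3 + a5 = a2 - a4 + a6 + 1 by (split_ifs at * <;> omega)]
    exact Raise.gap_plus (by omega) h2 (by omega) p1 _
  · by_cases p2 : h (y + 1) = m ∧ m < h x
    · rw [show a2 - a4 + a6 = a1 - a3 + a5 + 1 by (split_ifs at * <;> omega), p2.1]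
      exact Raise.gap_minus_matched (by omega) h2 p2.2 _
    · rw [show a1 - a3 + a5 = a2 - a4 + a6 by (split_ifs at * <;> omega)]
      exact Raise.gap_inert (by omega) h2 (by omega) e3 (by omega) _

theorem Raise.neg_down (H : ColumnHeights k r h) (h1 : 2 ≤ m) (h2 : m < n) {x y : ℕ}
    (hxy : x ≤ y) :
    Raise X n m
      (countFrom h k m x - countFrom h k m (y + 1) + countFrom h k (m + 1) (y + 1))
      [-((h y : ℕ) : ℤ)] [-((h y : ℕ) : ℤ)]
      (countFrom h k m x - countFrom h k m y + countFrom h k (m + 1) y) 0 := by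
  have e2 := H.countFrom_succ h1 y
  have e0 := H.countFrom_succ (show 2 ≤ m + 1 by omega) y
  have e4 := ColumnHeights.countFrom_antitone (h := h) (k := k) (m := m) hxy
  generalize countFrom h k m x = a1 at *
  generalize countFrom h k m (y + 1) = a3 at *
  generalize countFrom h k m y = a4 at *
  generalize countFrom h k (m + 1) (y + 1) = a5 at *
  generalize countFrom h k (m + 1) y = a6 at *
  by_cases p1 : h y = m + 1
  · rw [show a1 - a4 + a6 = a1 - a3 + a5 + 1 by (split_ifs at * <;> omega), p1, Nat.cast_succ]
    exact Raise.neg_plus (by omega) h2 _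
  · by_cases p2 : h y = m
    · rw [show a1 - a3 + a5 = a1 - a4 + a6 + 1 by (split_ifs at * <;> omega), p2]
      exact Raise.neg_minus_matched (by omega) h2 _
    · rw [show a1 - a4 + a6 = a1 - a3 + a5 by (split_ifs at * <;> omega)]
      exact Raise.neg_letter_inert (by omega) h2 p2 p1 _

/-- The column `t + c` with one letter removed and one barred letter, both at most `M`. -/
def gapColumn (h : ℕ → ℕ) (t d M c : ℕ) : List ℤ :=
  gapRange 1 (min (h (d + 2 * c + 1)) M) (h (t + c)) ++ [-((min (h (d + 2 * c)) M : ℕ) : ℤ)]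

theorem gapColumn_last (H : ColumnHeights k r h) {t d c M : ℕ} (hM : r ≤ M) :
    gapColumn h t d M c =
      gapRange 1 (h (d + 2 * c + 1)) (h (t + c)) ++ [-((h (d + 2 * c) : ℕ) : ℤ)] := by
  rw [gapColumn, min_eq_left ((H.le _).trans hM), min_eq_left ((H.le _).trans hM)]

theorem Raise.gapColumns_up (H : ColumnHeights k r h) (h1 : 2 ≤ m) (h2 : m < n) {t d : ℕ}
    (htd : t ≤ d) (htk : t ≤ k) :
    Raise X n m 0 (concatCols (k - t) (gapColumn h t d m))
      (concatCols (k - t) (gapColumn h t d (m + 1))) (countFrom h k m t - countFrom h k m d)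
      (∑ c ∈ Finset.range (k - t),
        ((if m < h (d + 2 * c + 1) then 1 else 0) + if m < h (d + 2 * c) then 1 else 0)) := by
  have := Raise.concat (X := X) (n := n) (i := m) (by omega) (k := k - t)
    (f := gapColumn h t d m) (g := gapColumn h t d (m + 1))
    (fun c => countFrom h k m (t + c) - countFrom h k m (d + 2 * c)) _
    (fun c _ => (Raise.gap_up (X := X) H h1 h2 (show t + c ≤ d + 2 * c by omega)).append (by omega)
      (Raise.neg_up H h1 h2 (show t + c ≤ d + 2 * c by omega)))
  rw [ColumnHeights.countFrom_of_le (x := t + (k - t)) (by omega), Nat.zero_sub] at this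
  exact this

theorem Raise.gapColumns_last (H : ColumnHeights k r h) (hn : 3 ≤ n) (hr : HeightBound X n r)
    {t d : ℕ} (htd : t ≤ d) (htk : t ≤ k) :
    Raise X n n 0 (concatCols (k - t) (gapColumn h t d n))
      (concatCols (k - t) (gapColumn h t d n)) (countFrom h k n t - countFrom h k n d) 0 := by
  have := Raise.concat (X := X) (n := n) (i := n) (by omega) (k := k - t)
    (f := gapColumn h t d n) (g := gapColumn h t d n)
    (fun c => countFrom h k n (t + c) - countFrom h k n (d + 2 * c)) (fun _ => 0)
    (fun c _ => by
      rw [gapColumn_last H hr.le]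
      exact (Raise.gap_last H hn hr (show t + c ≤ d + 2 * c by omega)).append (by omega) (s2 := 0)
        (Raise.neg_last H hn hr (show t + c ≤ d + 2 * c by omega)))
  rw [ColumnHeights.countFrom_of_le (x := t + (k - t)) (by omega), Nat.zero_sub] at this
  simpa using this

theorem Raise.gapColumns_down (H : ColumnHeights k r h) (h1 : 2 ≤ m) (h2 : m < n) (hr : r ≤ n)
    {t d : ℕ} (htd : t ≤ d) (htk : t ≤ k) :
    Raise X n m 0 (concatCols (k - t) (gapColumn h t d n))
      (concatCols (k - t) (gapColumn h t d n))
      (countFrom h k m t - countFrom h k m d + countFrom h k (m + 1) d) 0 := by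
  have := Raise.concat (X := X) (n := n) (i := m) (by omega) (k := k - t)
    (f := gapColumn h t d n) (g := gapColumn h t d n)
    (fun c => countFrom h k m (t + c) - countFrom h k m (d + 2 * c) +
      countFrom h k (m + 1) (d + 2 * c)) (fun _ => 0)
    (fun c _ => by
      rw [gapColumn_last H hr]
      exact (Raise.gap_down H h1 h2 (show t + c ≤ d + 2 * c by omega)).append (by omega) (s2 := 0)
        (Raise.neg_down H h1 h2 (show t + c ≤ d + 2 * c by omega)))
  rw [ColumnHeights.countFrom_of_le (x := t + (k - t)) (by omega),
    ColumnHeights.countFrom_of_le (m := m + 1) (x := d + 2 * (k - t)) (by omega), Nat.zero_sub] at this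
  simpa using this

/-! ### Full columns and columns without the letter `1` and one other letter -/

/-- The column `t + c` of a tableau which is full up to the index `d`, and from there on contains
`2, …, h` without one letter. -/
def plainColumn (h : ℕ → ℕ) (t d M c : ℕ) : List ℤ :=
  if t + c < d then letterRange 1 (h (t + c)) else gapRange 2 (min (h (t + c)) M) (h (t + c))

theorem Raise.plainColumns_up (H : ColumnHeights k r h) (h1 : 2 ≤ m) (h2 : m < n) {t d : ℕ}
    (htk : t ≤ k) :
    Raise X n m 0 (concatCols (k - t) (plainColumn h t d m))
      (concatCols (k - t) (plainColumn h t d (m + 1))) (countFrom h k m t - countFrom h k m d)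
      (∑ c ∈ Finset.range (k - t), if d ≤ t + c ∧ m < h (t + c) then 1 else 0) := by
  have := Raise.concat (X := X) (n := n) (i := m) (by omega) (k := k - t)
    (f := plainColumn h t d m) (g := plainColumn h t d (m + 1))
    (fun c => countFrom h k m (t + c) - countFrom h k m d)
    (fun c => if d ≤ t + c ∧ m < h (t + c) then 1 else 0)
    (fun c hc => by
      have e1 := H.countFrom_succ h1 (t + c)
      have h3 := H.two_le (t + c) (by omega)
      simp only [plainColumn]
      rw [← Nat.add_assoc t c 1]
      by_cases hd : t + c < d
      · have e2 := ColumnHeights.countFrom_antitone (h := h) (k := k) (m := m)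
          (show t + c + 1 ≤ d by omega)
        rw [if_pos hd, if_pos hd, if_neg (by omega)]
        by_cases hm : h (t + c) = m
        · rw [if_pos hm] at e1
          rw [e1, Nat.sub_add_comm e2, hm]
          exact Raise.range_plus (by omega) h2 (by omega) _
        · rw [if_neg hm] at e1
          rw [e1]
          exact Raise.range_inert (by omega) h2 (by omega) _
      · have e2 := ColumnHeights.countFrom_antitone (h := h) (k := k) (m := m)
          (show d ≤ t + c by omega)
        rw [if_neg hd, if_neg hd,
          show countFrom h k m (t + c + 1) - countFrom h k m d = 0 by omega,
          show countFrom h k m (t + c) - countFrom h k m d = 0 by omega]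
        by_cases hm : m < h (t + c)
        · rw [if_pos (by omega), min_eq_right (by omega), min_eq_right (by omega)]
          exact Raise.gap_minus (by omega) h2 (by omega) hm
        · rw [if_neg (by omega), min_eq_left (by omega), min_eq_left (by omega)]
          exact Raise.gap_inert (by omega) h2 (by omega) le_rfl (by omega) _)
  rw [ColumnHeights.countFrom_of_le (x := t + (k - t)) (by omega), Nat.zero_sub] at this
  exact this

theorem Raise.plainColumns_last (H : ColumnHeights k r h) (hn : 3 ≤ n) (hr : HeightBound X n r)
    {t d : ℕ} (htk : t ≤ k) :
    Raise X n n 0 (concatCols (k - t) (plainColumn h t d n))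
      (concatCols (k - t) (plainColumn h t d n)) (countFrom h k n t - countFrom h k n d) 0 := by
  have := Raise.concat (X := X) (n := n) (i := n) (by omega) (k := k - t)
    (f := plainColumn h t d n) (g := plainColumn h t d n)
    (fun c => countFrom h k n (t + c) - countFrom h k n d) (fun _ => 0)
    (fun c hc => by
      have e1 := H.countFrom_succ (show 2 ≤ n by omega) (t + c)
      have h3 := H.two_le (t + c) (by omega)
      have e5 := hr.mono (H.le (t + c))
      simp only [plainColumn]
      rw [← Nat.add_assoc t c 1]
      by_cases hd : t + c < d
      · have e2 := ColumnHeights.countFrom_antitone (h := h) (k := k) (m := n)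
          (show t + c + 1 ≤ d by omega)
        rw [if_pos hd]
        by_cases hm : h (t + c) = n
        · obtain rfl : X = .A := by
            cases X <;> simp only [HeightBound] at e5 <;> first | omega | rfl
          rw [if_pos hm] at e1
          rw [e1, Nat.sub_add_comm e2, hm]
          exact Raise.last_range_plus (by omega) le_rfl (by omega) _
        · rw [if_neg hm] at e1
          rw [e1]
          exact Raise.last_range_inert (by omega) le_rfl e5 (fun _ => by have := e5.le; omega) _
      · have e2 := ColumnHeights.countFrom_antitone (h := h) (k := k) (m := n)
          (show d ≤ t + c by omega)
        rw [if_neg hd, min_eq_left e5.le,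
          show countFrom h k n (t + c + 1) - countFrom h k n d = 0 by omega,
          show countFrom h k n (t + c) - countFrom h k n d = 0 by omega]
        exact Raise.last_gap_inert (by omega) (by omega) e5 (by omega) le_rfl (fun _ => by omega) _)
  rw [ColumnHeights.countFrom_of_le (x := t + (k - t)) (by omega), Nat.zero_sub] at this
  simpa using this

theorem Raise.plainColumns_down (H : ColumnHeights k r h) (h1 : 2 ≤ m) (h2 : m < n) (hr : r ≤ n)
    {t d : ℕ} (htd : t ≤ d) (htk : t ≤ k) :
    Raise X n m 0 (concatCols (k - t) (plainColumn h t d n))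
      (concatCols (k - t) (plainColumn h t d n))
      (countFrom h k m t - countFrom h k m d + countFrom h k (m + 1) d) 0 := by
  have := Raise.concat (X := X) (n := n) (i := m) (by omega) (k := k - t)
    (f := plainColumn h t d n) (g := plainColumn h t d n)
    (fun c => countFrom h k m (t + c) - countFrom h k m d +
      countFrom h k (m + 1) (max (t + c) d)) (fun _ => 0)
    (fun c hc => by
      have e1 := H.countFrom_succ h1 (t + c)
      have e0 := H.countFrom_succ (show 2 ≤ m + 1 by omega) (t + c)
      have h3 := H.two_le (t + c) (by omega)
      have h4 := H.le (t + c)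
      simp only [plainColumn]
      rw [← Nat.add_assoc t c 1]
      by_cases hd : t + c < d
      · have e2 := ColumnHeights.countFrom_antitone (h := h) (k := k) (m := m)
          (show t + c + 1 ≤ d by omega)
        rw [if_pos hd, max_eq_right (by omega), max_eq_right (by omega)]
        by_cases hm : h (t + c) = m
        · rw [if_pos hm] at e1
          rw [show countFrom h k m (t + c) - countFrom h k m d + countFrom h k (m + 1) d =
            countFrom h k m (t + c + 1) - countFrom h k m d + countFrom h k (m + 1) d + 1 by omega,
            hm]
          exact Raise.range_plus (by omega) h2 (by omega) _
        · rw [if_neg hm] at e1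
          rw [e1]
          exact Raise.range_inert (by omega) h2 (by omega) _
      · have e2 := ColumnHeights.countFrom_antitone (h := h) (k := k) (m := m)
          (show d ≤ t + c by omega)
        rw [if_neg hd, min_eq_left (by omega), max_eq_left (by omega), max_eq_left (by omega),
          show countFrom h k m (t + c + 1) - countFrom h k m d = 0 by omega,
          show countFrom h k m (t + c) - countFrom h k m d = 0 by omega, Nat.zero_add, Nat.zero_add]
        by_cases hm : h (t + c) = m + 1
        · rw [if_pos hm] at e0
          rw [e0]
          exact Raise.gap_plus (by omega) h2 (by omega) (by omega) _
        · rw [if_neg hm] at e0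
          rw [e0]
          exact Raise.gap_inert (by omega) h2 (by omega) le_rfl (by omega) _)
  rw [ColumnHeights.countFrom_of_le (x := t + (k - t)) (by omega),
    ColumnHeights.countFrom_of_le (x := max (t + (k - t)) d) (by omega), Nat.zero_sub, Nat.add_zero,
    Nat.add_zero, max_eq_right htd] at this
  simpa using this

theorem sum_gap_eq_sum_plain (H : ColumnHeights k r h) (hm : 1 ≤ m) {t d : ℕ} (htd : t ≤ d)
    (hdk : d ≤ k) :
    ∑ c ∈ Finset.range (k - t),
        ((if m < h (d + 2 * c + 1) then 1 else 0) + if m < h (d + 2 * c) then 1 else 0) =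
      ∑ c ∈ Finset.range (k - t), if d ≤ t + c ∧ m < h (t + c) then 1 else 0 := by
  set g : ℕ → ℕ := fun c => if m < h c then 1 else 0 with hg
  have hz : ∀ c, k ≤ c → g c = 0 := fun c hc => by
    simp only [hg]; rw [if_neg (by rw [H.one c hc]; omega)]
  have e1 : ∀ N, ∑ c ∈ Finset.range N, (g (d + 2 * c + 1) + g (d + 2 * c)) =
      ∑ y ∈ Finset.range (2 * N), g (d + y) := by
    intro N
    induction N with
    | zero => rfl
    | succ N ih =>
      rw [Finset.sum_range_succ, ih, show 2 * (N + 1) = 2 * N + 1 + 1 by ring,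
        Finset.sum_range_succ, Finset.sum_range_succ, ← Nat.add_assoc d]
      omega
  have e2 : ∑ y ∈ Finset.range (2 * (k - t)), g (d + y) = ∑ y ∈ Finset.range (k - d), g (d + y) := by
    rw [show 2 * (k - t) = (k - d) + (2 * (k - t) - (k - d)) by omega, Finset.sum_range_add]
    rw [Finset.sum_eq_zero (s := Finset.range (2 * (k - t) - (k - d))) fun c _ =>
      hz _ (by omega), Nat.add_zero]
  have e3 : ∑ c ∈ Finset.range (k - t), (if d ≤ t + c ∧ m < h (t + c) then 1 else 0) =
      ∑ y ∈ Finset.range (k - d), g (d + y) := by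
    rw [show k - t = (d - t) + (k - d) by omega, Finset.sum_range_add, Finset.sum_eq_zero,
      Nat.zero_add]
    · refine Finset.sum_congr rfl fun c _ => ?_
      simp only [hg]
      rw [show t + (d - t + c) = d + c by omega]
      simp
    · intro c hc
      rw [Finset.mem_range] at hc
      rw [if_neg (by omega)]
  rw [e3, ← e2, ← e1]

end Columns

/-! ### The `0`-string and its image under `σ` -/

/-- The tableau with columns `f 0, …, f (k-1)` from left to right. -/
def colTableau (k : ℕ) (f : ℕ → List ℤ) : Tableau := .ofColumns ((List.range k).map f).reverse

theorem colTableau_word (k : ℕ) (f : ℕ → List ℤ) : (colTableau k f).word = concatCols k f :=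
  (concatCols_eq_flatten k f).symm

theorem colTableau_eq (k : ℕ) (f : ℕ → List ℤ) :
    colTableau k f = ⟨(colTableau k f).heights, concatCols k f⟩ := by
  rw [← colTableau_word]

theorem colTableau_heights_congr {k : ℕ} {f g : ℕ → List ℤ}
    (h : ∀ c < k, (f c).length = (g c).length) :
    (colTableau k f).heights = (colTableau k g).heights := by
  simp only [colTableau, Tableau.ofColumns, List.map_reverse, List.map_map, List.reverse_inj]
  apply List.map_congr_left
  intro c hc
  exact h c (List.mem_range.1 hc)

/-- The columns of the image under `σ` of the `j`-th element of the `0`-string. -/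
def oneColumn (h : ℕ → ℕ) (j c : ℕ) : List ℤ :=
  gapRange 1 (if 2 * c + 1 < j then 2 else 1) (h c) ++ [if 2 * c < j then -2 else -1]

/-- The columns of the `j`-th element of the `0`-string. -/
def zeroColumn (h : ℕ → ℕ) (k j c : ℕ) : List ℤ :=
  if c < j - k then letterRange 3 (h c) ++ [-2, -1]
  else if c < k - j then letterRange 1 (h c) else letterRange 3 (h c)

/-- The columns of the `{2,…,n}`-highest element above `oneColumn h j`. -/
def oneColumnTop (h : ℕ → ℕ) (k j c : ℕ) : List ℤ :=
  if c < j - k then letterRange 1 (h c)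
  else gapRange 1 (h ((k - j) + (j - k) + 2 * (c - (j - k)) + 1)) (h c) ++
    [-((h ((k - j) + (j - k) + 2 * (c - (j - k))) : ℕ) : ℤ)]

/-- The columns of the `{2,…,n}`-highest element above `zeroColumn h k j`. -/
def zeroColumnTop (h : ℕ → ℕ) (k j c : ℕ) : List ℤ :=
  if c < j - k then letterRange 2 (h c) ++ [-1]
  else if c < k - j then letterRange 1 (h c) else letterRange 2 (h c - 1)

theorem length_gapRange_one {p i : ℕ} (hp : 1 ≤ p) (hpi : p ≤ i) :
    (gapRange 1 p i).length = i - 1 := by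
  simp [gapRange]; omega

section

variable {X : AffineType} {n k r j : ℕ} {h : ℕ → ℕ}

theorem concatCols_split {t : ℕ} (htk : t ≤ k) (f : ℕ → List ℤ) :
    concatCols k f = concatCols (k - t) (fun c => f (t + c)) ++ concatCols t f := by
  rw [← concatCols_add, show t + (k - t) = k by omega]

theorem oneColumn_concat (H : ColumnHeights k r h) (hj : j ≤ 2 * k) :
    concatCols k (oneColumn h j) =
      concatCols (k - (j - k)) (gapColumn h (j - k) ((k - j) + (j - k)) 2) ++
        concatCols (j - k) fun c => upColumn 1 [] (h c) 2 := by
  have hh : ∀ y, min (h y) 2 = if y < k then 2 else 1 := by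
    intro y
    split_ifs with hy
    · exact min_eq_right (H.two_le y hy)
    · rw [H.one y (by omega)]; rfl
  rw [concatCols_split (show j - k ≤ k by omega)]
  congr 1
  · apply concatCols_congr
    intro c hc
    simp only [oneColumn, gapColumn]
    rw [hh, hh]
    congr 2
    · by_cases h1 : 2 * (j - k + c) + 1 < j
      · rw [if_pos h1, if_pos (by omega)]
      · rw [if_neg h1, if_neg (by omega)]
    · by_cases h1 : 2 * (j - k + c) < j
      · rw [if_pos h1, if_pos (by omega)]; rfl
      · rw [if_neg h1, if_neg (by omega)]; rfl
  · apply concatCols_congr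
    intro c hc
    simp only [oneColumn, upColumn]
    rw [hh, if_pos (by omega), if_pos (by omega), if_pos (by omega)]
    simp

theorem zeroColumn_concat (H : ColumnHeights k r h) (hj : j ≤ 2 * k) :
    concatCols k (zeroColumn h k j) =
      concatCols (k - (j - k)) (plainColumn h (j - k) ((k - j) + (j - k)) 2) ++
        concatCols (j - k) fun c => upColumn 2 [-1] (h c) 2 := by
  have hg : ∀ c < k, gapRange 2 (min (h c) 2) (h c) = letterRange 3 (h c) := by
    intro c hc
    rw [min_eq_right (H.two_le c hc), gapRange, letterRange_of_lt (by omega), List.nil_append]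
  rw [concatCols_split (show j - k ≤ k by omega)]
  congr 1
  · apply concatCols_congr
    intro c hc
    simp only [zeroColumn, plainColumn]
    rw [if_neg (by omega), hg _ (by omega)]
    by_cases h1 : j - k + c < k - j
    · rw [if_pos h1, if_pos (by omega)]
    · rw [if_neg h1, if_neg (by omega)]
  · apply concatCols_congr
    intro c hc
    simp only [zeroColumn, upColumn]
    rw [if_pos hc, hg _ (by omega)]
    simp

theorem oneColumnTop_concat (H : ColumnHeights k r h) (hj : j ≤ 2 * k) (hr : r ≤ n) :
    concatCols k (oneColumnTop h k j) =
      concatCols (k - (j - k)) (gapColumn h (j - k) ((k - j) + (j - k)) n) ++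
        concatCols (j - k) fun c => letterRange 1 (h c) ++ [] := by
  rw [concatCols_split (show j - k ≤ k by omega)]
  congr 1
  · apply concatCols_congr
    intro c hc
    rw [gapColumn_last H hr, oneColumnTop, if_neg (by omega),
      show j - k + c - (j - k) = c by omega]
  · apply concatCols_congr
    intro c hc
    rw [oneColumnTop, if_pos hc, List.append_nil]

theorem zeroColumnTop_concat (H : ColumnHeights k r h) (hj : j ≤ 2 * k) (hr : r ≤ n) :
    concatCols k (zeroColumnTop h k j) =
      concatCols (k - (j - k)) (plainColumn h (j - k) ((k - j) + (j - k)) n) ++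
        concatCols (j - k) fun c => letterRange 2 (h c) ++ [-1] := by
  rw [concatCols_split (show j - k ≤ k by omega)]
  congr 1
  · apply concatCols_congr
    intro c hc
    rw [plainColumn, zeroColumnTop, if_neg (by omega), min_eq_left ((H.le _).trans hr), gapRange_self]
    by_cases h1 : j - k + c < k - j
    · rw [if_pos h1, if_pos (by omega)]
    · rw [if_neg h1, if_neg (by omega)]
  · apply concatCols_congr
    intro c hc
    rw [zeroColumnTop, if_pos hc]

theorem raise_zero_one (H : ColumnHeights k r h) (hn : 3 ≤ n) (hr : HeightBound X n r)
    (hj : j ≤ 2 * k) :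
    raisingWord X n (colTableau k (oneColumn h j)) =
        raisingWord X n (colTableau k (zeroColumn h k j)) ∧
      (tableauOps X n).eWord (raisingWord X n (colTableau k (oneColumn h j)))
        (colTableau k (oneColumn h j)) = some (colTableau k (oneColumnTop h k j)) ∧
      (tableauOps X n).eWord (raisingWord X n (colTableau k (zeroColumn h k j)))
        (colTableau k (zeroColumn h k j)) = some (colTableau k (zeroColumnTop h k j)) := by
  set t := j - k with ht
  set d := (k - j) + (j - k) with hd
  have htd : t ≤ d := by omega
  have htk : t ≤ k := by omega
  have hdk : d ≤ k := by omega
  have hcols : ∀ c < t, 2 ≤ h c ∧ HeightBound X n (h c) := fun c hc =>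
    ⟨H.two_le c (by omega), hr.mono (H.le c)⟩
  have hzero : ∀ m, 0 < t → countFrom h k m t - countFrom h k m d = 0 := by
    intro m h0
    rw [show t = d by omega, Nat.sub_self]
  have hdown : ∀ m, ∀ c < t, h c ≤ m →
      countFrom h k m t - countFrom h k m d + countFrom h k (m + 1) d = 0 := by
    intro m c hc hcm
    rw [hzero m (by omega), Nat.zero_add]
    have := H.anti (show c ≤ d by omega)
    exact H.countFrom_eq_zero (by omega)
  obtain ⟨pd, td⟩ := raisePath_sweep (X := X) (n := n) (a := 1) (t := t) (trail := []) (h := h) hn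
    (by simp) le_rfl (by omega) hcols (O := fun M => concatCols (k - t) (gapColumn h t d M))
    (fun m h1 h2 => ⟨_, Raise.gapColumns_up H h1 h2 htd htk, hzero m⟩)
    ⟨_, Raise.gapColumns_last H hn hr htd htk, hzero n⟩
    (fun m h1 h2 => ⟨_, Raise.gapColumns_down H h1 h2 hr.le htd htk, hdown m⟩)
  obtain ⟨pb, tb⟩ := raisePath_sweep (X := X) (n := n) (a := 2) (t := t) (trail := [-1]) (h := h) hn
    (by simp) (by omega) le_rfl hcols (O := fun M => concatCols (k - t) (plainColumn h t d M))
    (fun m h1 h2 => ⟨_, Raise.plainColumns_up H h1 h2 htk, hzero m⟩)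
    ⟨_, Raise.plainColumns_last H hn hr htk, hzero n⟩
    (fun m h1 h2 => ⟨_, Raise.plainColumns_down H h1 h2 hr.le htd htk, hdown m⟩)
  rw [← oneColumnTop_concat H hj hr.le] at pd td
  rw [← zeroColumnTop_concat H hj hr.le] at pb tb
  rw [← oneColumn_concat H hj] at pd
  rw [← zeroColumn_concat H hj] at pb
  have hp : ∀ c < k, (1 ≤ if 2 * c + 1 < j then 2 else 1) ∧ (if 2 * c + 1 < j then 2 else 1) ≤ h c := by
    intro c hc
    have := H.two_le c hc
    split_ifs <;> omega
  have hd1 : (colTableau k (oneColumnTop h k j)).heights = (colTableau k (oneColumn h j)).heights := by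
    apply colTableau_heights_congr
    intro c hc
    have := H.two_le c hc
    rw [oneColumnTop, oneColumn, List.length_append, length_gapRange_one (hp c hc).1 (hp c hc).2,
      List.length_singleton]
    by_cases h1 : c < j - k
    · rw [if_pos h1, length_letterRange]; omega
    · rw [if_neg h1, List.length_append, length_gapRange_one (H.one_le _) (H.anti (by omega))]
      simp
  have hb1 : (colTableau k (zeroColumnTop h k j)).heights =
      (colTableau k (zeroColumn h k j)).heights := by
    apply colTableau_heights_congr
    intro c hc
    have := H.two_le c hc
    rw [zeroColumnTop, zeroColumn]
    split_ifs <;> simp <;> omega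
  have rd := pd.raisingWord (by omega) td (colTableau k (oneColumn h j)).heights
  have rb := pb.raisingWord (by omega) tb (colTableau k (zeroColumn h k j)).heights
  rw [← colTableau_eq] at rd rb
  have ed := pd.eWord (colTableau k (oneColumn h j)).heights
  have eb := pb.eWord (colTableau k (zeroColumn h k j)).heights
  rw [← colTableau_eq, ← hd1, ← colTableau_eq, ← rd] at ed
  rw [← colTableau_eq, ← hb1, ← colTableau_eq, ← rb] at eb
  refine ⟨?_, ed, eb⟩
  rw [rd, rb, sweepList, sweepList]
  congr 3
  apply List.map_congr_left
  intro m hm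
  rw [List.mem_range'_1] at hm
  rw [sum_gap_eq_sum_plain H (by omega) htd hdk]

end

/-! ### The `±`-diagrams of the `{2,…,n}`-highest elements above the string -/

/-- The `±`-diagram of `oneColumnTop`. -/
def onePM (h : ℕ → ℕ) (k j : ℕ) : PMData k where
  inner c := if (c : ℕ) < j - k ∨ (c : ℕ) < k - j then h c - 1 else h c - 2
  mid c := if (c : ℕ) < j - k then h c else h c - 1
  outer c := h c

/-- The `±`-diagram of `zeroColumnTop`. -/
def zeroPM (h : ℕ → ℕ) (k j : ℕ) : PMData k where
  inner c := if (c : ℕ) < j - k ∨ (c : ℕ) < k - j then h c - 1 else h c - 2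
  mid c := if (c : ℕ) < j - k then h c - 1 else if (c : ℕ) < k - j then h c else h c - 2
  outer c := if (c : ℕ) < j - k ∨ (c : ℕ) < k - j then h c else h c - 2

theorem ofFn_eq_map_range' {α : Type*} (k : ℕ) (g : ℕ → α) :
    List.ofFn (fun c : Fin k => g c) = (List.range' 0 k).map g := by
  apply List.ext_getElem
  · simp
  · intro i h1 h2
    simp

theorem onePM_columns (h : ℕ → ℕ) (k j : ℕ) :
    (onePM h k j).columns = (List.range' 0 k).map fun c =>
      (if c < j - k ∨ c < k - j then h c - 1 else h c - 2,
        if c < j - k then h c else h c - 1, h c) := by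
  rw [← ofFn_eq_map_range']
  rfl

theorem zeroPM_columns (h : ℕ → ℕ) (k j : ℕ) :
    (zeroPM h k j).columns = (List.range' 0 k).map fun c =>
      (if c < j - k ∨ c < k - j then h c - 1 else h c - 2,
        if c < j - k then h c - 1 else if c < k - j then h c else h c - 2,
        if c < j - k ∨ c < k - j then h c else h c - 2) := by
  rw [← ofFn_eq_map_range']
  rfl

theorem fillColumns_map_range' {n a len : ℕ} {g : ℕ → ℕ × ℕ × ℕ} {F : ℕ → List ℤ}
    {ps : ℕ → List ℕ}
    (hstep : ∀ x, a ≤ x → x < a + len → ∀ cs, fillColumns n (g x :: cs) (ps x) =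
      F x :: fillColumns n cs (ps (x + 1))) :
    fillColumns n ((List.range' a len).map g) (ps a) = (List.range' a len).map F := by
  induction len generalizing a with
  | zero => rfl
  | succ len ih =>
    rw [List.range'_succ, List.map_cons, List.map_cons, hstep a le_rfl (by omega),
      ih fun x h1 h2 => hstep x (by omega) (by omega)]

theorem tail_range' (y k : ℕ) : (List.range' y (k - y)).tail = List.range' (y + 1) (k - (y + 1)) := by
  rcases Nat.lt_or_ge y k with hy | hy
  · rw [show k - y = (k - (y + 1)) + 1 by omega, List.range'_succ]; rfl
  · rw [show k - y = 0 by omega, show k - (y + 1) = 0 by omega]; rfl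

theorem range'_cons_of_lt {y k : ℕ} (hy : y < k) :
    List.range' y (k - y) = y :: List.range' (y + 1) (k - (y + 1)) := by
  rw [show k - y = (k - (y + 1)) + 1 by omega, List.range'_succ]

/-! Filling one column. -/

theorem fillColumns_plus {n i : ℕ} (hi : 1 ≤ i) {cs : List (ℕ × ℕ × ℕ)} {ps : List ℕ} {e : ℕ}
    (hps : i ≠ n → ps.head? = some i) (he : e = i - 1) :
    fillColumns n ((e, i, i) :: cs) ps =
      letterRange 1 i :: fillColumns n cs (if i = n then ps else ps.tail) := by
  subst he
  by_cases hin : i = n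
  · subst hin
    rw [fillColumns, if_pos ⟨by omega, rfl⟩, if_pos rfl]
  · rw [fillColumns, if_neg (by tauto), if_neg (by omega), if_neg (by omega), if_neg hin]
    obtain ⟨q, rfl⟩ : ∃ q, ps = i :: q := by
      have := hps hin
      cases ps with
      | nil => simp at this
      | cons a q => simp at this; exact ⟨q, by rw [this]⟩
    rw [columnString, letterRange_of_lt (a := i + 2) (by omega), List.append_nil]

theorem fillColumns_minus {n e m o : ℕ} (hm : m ≠ 0) (ho : o = m + 1) (hmn : m ≠ n)
    (cs : List (ℕ × ℕ × ℕ)) (ps : List ℕ) :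
    fillColumns n ((e, m, o) :: cs) ps =
      (columnString m ps.tail ++ [minusLetter ps]) :: fillColumns n cs ps.tail.tail := by
  rw [fillColumns, if_neg (by tauto), if_pos ho, if_neg hm]

section

variable {X : AffineType} {n k r j : ℕ} {h : ℕ → ℕ}

theorem columnString_heights (H : ColumnHeights k r h) {x y : ℕ} (hx : x < k) :
    columnString (h x - 1) ((List.range' y (k - y)).map fun c => h c - 1) =
      gapRange 1 (h y) (h x) := by
  have h2 := H.two_le x hx
  rcases Nat.lt_or_ge y k with hy | hy
  · have h3 := H.two_le y hy
    rw [range'_cons_of_lt hy, List.map_cons, columnString, gapRange,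
      show h y - 1 + 2 = h y + 1 by omega, show h x - 1 + 1 = h x by omega]
  · rw [show k - y = 0 by omega, List.range'_zero, List.map_nil, columnString, gapRange, H.one y hy,
      letterRange_of_lt (b := 1 - 1) (by omega), show h x - 1 + 1 = h x by omega]
    rfl

theorem minusLetter_heights (H : ColumnHeights k r h) (y : ℕ) :
    minusLetter ((List.range' y (k - y)).map fun c => h c - 1) = -((h y : ℕ) : ℤ) := by
  rcases Nat.lt_or_ge y k with hy | hy
  · have h3 := H.two_le y hy
    rw [range'_cons_of_lt hy, List.map_cons, minusLetter]
    omega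
  · rw [show k - y = 0 by omega, List.range'_zero, List.map_nil, minusLetter, H.one y hy]
    rfl

/-- The symbols `+` at the heights `h c` from the index `x` up to the index `t`. -/
def topPlus (h : ℕ → ℕ) (n t x : ℕ) : List ℕ :=
  ((List.range' x (t - x)).filter fun c => h c ≠ n).map h

theorem topPlus_of_le {t x : ℕ} (hx : t ≤ x) : topPlus h n t x = [] := by
  rw [topPlus, show t - x = 0 by omega]; rfl

theorem topPlus_of_lt {t x : ℕ} (hx : x < t) :
    topPlus h n t x = if h x = n then topPlus h n t (x + 1) else h x :: topPlus h n t (x + 1) := by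
  rw [topPlus, range'_cons_of_lt hx, List.filter_cons]
  by_cases hn : h x = n
  · simp [hn, topPlus]
  · simp [hn, topPlus]

theorem range'_split3 {t d : ℕ} (htd : t ≤ d) (hdk : d ≤ k) :
    List.range' 0 k = List.range' 0 t ++ (List.range' t (d - t) ++ List.range' d (k - d)) := by
  have e1 : List.range' t (d - t) ++ List.range' d (k - d) = List.range' t (k - t) := by
    have := List.range'_append_1 (s := t) (m := d - t) (n := k - d)
    rw [show t + (d - t) = d by omega, show d - t + (k - d) = k - t by omega] at this
    exact this
  have e2 := List.range'_append_1 (s := 0) (m := t) (n := k - t)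
  rw [Nat.zero_add, show t + (k - t) = k by omega] at e2
  rw [e1, e2]

theorem onePM_plusHeights (H : ColumnHeights k r h) (hr : r ≤ n) (hj : j ≤ 2 * k) :
    plusHeights n (onePM h k j).columns = topPlus h n (j - k) 0 ++
      (List.range' ((k - j) + (j - k)) (k - ((k - j) + (j - k)))).map fun c => h c - 1 := by
  rw [onePM_columns, range'_split3 (t := j - k) (d := (k - j) + (j - k)) (by omega) (by omega),
    plusHeights, List.map_append, List.map_append, List.filter_append, List.filter_append,
    List.map_append, List.map_append]
  congr 1
  · rw [List.filter_map, List.map_map, topPlus, Nat.sub_zero]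
    have : ∀ c ∈ List.range' 0 (j - k), c < j - k := by
      intro c hc; rw [List.mem_range'_1] at hc; omega
    rw [List.filter_congr (q := fun c => decide (h c ≠ n))]
    · apply List.map_congr_left
      intro c hc
      have := this c (List.mem_filter.1 hc).1
      simp [this]
    · intro c hc
      have h1 := this c hc
      have := H.two_le c (by omega)
      simp only [Function.comp, h1, true_or, if_true, decide_eq_decide]
      omega
  · rw [List.filter_eq_nil_iff.2, List.map_nil, List.nil_append, List.filter_eq_self.2, List.map_map]
    · apply List.map_congr_left
      intro c hc
      rw [List.mem_range'_1] at hc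
      simp only [Function.comp]
      rw [if_neg (by omega)]
    · intro p hp
      obtain ⟨c, hc, rfl⟩ := List.mem_map.1 hp
      rw [List.mem_range'_1] at hc
      have h1 := H.two_le c (by omega)
      have h2 := H.le c
      simp only [decide_eq_true_eq]
      rw [if_neg (by omega), if_neg (by omega)]
      omega
    · intro p hp
      obtain ⟨c, hc, rfl⟩ := List.mem_map.1 hp
      rw [List.mem_range'_1] at hc
      have h1 := H.two_le c (by omega)
      simp only [decide_eq_true_eq]
      rw [if_neg (by omega), if_pos (by omega)]
      omega

theorem Phi_onePM (H : ColumnHeights k r h) (hr : r ≤ n) (hj : j ≤ 2 * k) :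
    Phi n (onePM h k j) = colTableau k (oneColumnTop h k j) := by
  rw [Phi, colTableau, onePM_plusHeights H hr hj, onePM_columns, List.range_eq_range']
  congr 2
  set t := j - k with ht
  set d := (k - j) + (j - k) with hd
  have := fillColumns_map_range' (n := n) (a := 0) (len := k)
    (g := fun c => (if c < j - k ∨ c < k - j then h c - 1 else h c - 2,
        if c < j - k then h c else h c - 1, h c)) (F := oneColumnTop h k j)
    (ps := fun x => topPlus h n t x ++
      (List.range' (d + 2 * (x - t)) (k - (d + 2 * (x - t)))).map fun c => h c - 1) ?_
  · simpa using this
  · intro x _ hx cs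
    rw [Nat.zero_add] at hx
    have h2 := H.two_le x hx
    have h3 := H.le x
    by_cases hxt : x < t
    · rw [if_pos (by omega), if_pos (by omega), fillColumns_plus (by omega) _ rfl, oneColumnTop,
        if_pos (show x < j - k from hxt), topPlus_of_lt hxt, show x + 1 - t = x - t by omega]
      · split_ifs <;> rfl
      · intro hn
        rw [topPlus_of_lt hxt, if_neg hn]; rfl
    · rw [if_neg (by omega : ¬ x < j - k), topPlus_of_le (by omega), topPlus_of_le (by omega),
        List.nil_append, List.nil_append, fillColumns_minus (by omega) (by omega) (by omega),
        ← List.map_tail, ← List.map_tail, tail_range', tail_range', columnString_heights H hx,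
        minusLetter_heights H, oneColumnTop, if_neg (by omega),
        show d + 2 * (x + 1 - t) = d + 2 * (x - t) + 1 + 1 by omega]

theorem zeroPM_plusHeights (H : ColumnHeights k r h) (hj : j ≤ 2 * k) :
    plusHeights n (zeroPM h k j).columns = topPlus h n (k - j) 0 := by
  rw [zeroPM_columns, range'_split3 (t := k - j) (d := k) (by omega) (by omega),
    plusHeights, List.map_append, List.map_append, List.filter_append, List.filter_append,
    List.map_append, List.map_append, Nat.sub_self, List.range'_zero, List.map_nil, List.filter_nil,
    List.map_nil, List.append_nil]
  rw [← List.append_nil (topPlus h n (k - j) 0)]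
  congr 1
  · rw [List.filter_map, List.map_map, topPlus, Nat.sub_zero]
    have : ∀ c ∈ List.range' 0 (k - j), ¬ c < j - k ∧ c < k - j := by
      intro c hc; rw [List.mem_range'_1] at hc; omega
    rw [List.filter_congr (q := fun c => decide (h c ≠ n))]
    · apply List.map_congr_left
      intro c hc
      have := this c (List.mem_filter.1 hc).1
      simp [this]
    · intro c hc
      have h1 := this c hc
      have := H.two_le c (by omega)
      simp only [Function.comp, h1, or_true, if_true, if_false, decide_eq_decide]
      omega
  · rw [List.filter_eq_nil_iff.2, List.map_nil]
    intro p hp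
    obtain ⟨c, hc, rfl⟩ := List.mem_map.1 hp
    rw [List.mem_range'_1] at hc
    have h1 := H.two_le c (by omega)
    simp only [decide_eq_true_eq]
    split_ifs <;> omega

theorem Phi_zeroPM (H : ColumnHeights k r h) (hr : r ≤ n) (hj : j ≤ 2 * k) :
    Phi n (zeroPM h k j) = colTableau k (zeroColumnTop h k j) := by
  rw [Phi, colTableau, zeroPM_plusHeights H hj, zeroPM_columns, List.range_eq_range']
  congr 2
  refine fillColumns_map_range' (n := n) (a := 0) (len := k)
    (F := zeroColumnTop h k j) (ps := fun x => topPlus h n (k - j) x) ?_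
  intro x _ hx cs
  rw [Nat.zero_add] at hx
  have h2 := H.two_le x hx
  have h3 := H.le x
  by_cases hxt : x < j - k
  · rw [if_pos (by omega), if_pos hxt, if_pos (by omega),
      fillColumns_minus (by omega) (by omega) (by omega), topPlus_of_le (by omega),
      topPlus_of_le (by omega), zeroColumnTop, if_pos hxt, List.tail_nil, columnString, minusLetter,
      show h x - 1 + 1 = h x by omega]
    rfl
  · by_cases hxd : x < k - j
    · rw [if_pos (by omega), if_neg hxt, if_pos hxd, if_pos (by omega),
        fillColumns_plus (by omega) _ rfl, zeroColumnTop, if_neg hxt, if_pos hxd, topPlus_of_lt hxd]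
      · split_ifs <;> rfl
      · intro hn
        rw [topPlus_of_lt hxd, if_neg hn]; rfl
    · rw [if_neg (by omega), if_neg hxt, if_neg hxd, if_neg (by omega), topPlus_of_le (by omega),
        topPlus_of_le (by omega), zeroColumnTop, if_neg hxt, if_neg hxd, fillColumns,
        if_neg (by omega), if_neg (by omega)]
      by_cases h4 : h x = 2
      · rw [if_pos (by omega), h4]; rfl
      · rw [if_neg (by omega), columnString, show h x - 2 + 1 = h x - 1 by omega]; rfl

theorem isPMDiagram_onePM (H : ColumnHeights k r h) (hr : HeightBound X n r) (he : Even r) :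
    IsPMDiagram X n r (onePM h k j) := by
  have hre := Nat.even_iff.1 he
  have facts : ∀ c c' : Fin k, c ≤ c' → h c' ≤ h c ∧ (c : ℕ) ≤ c' ∧ h c % 2 = 0 ∧ h c' % 2 = 0 :=
    fun c c' hc => ⟨H.anti hc, hc, H.even c c.2, H.even c' c'.2⟩
  refine ⟨fun c c' hc => ?_, fun c c' hc => ?_, fun c c' hc => ?_, fun c => ?_, fun c => ?_,
    fun c => ?_, fun _ c => ?_⟩
  · have := facts c c' hc
    simp only [onePM]; split_ifs <;> omega
  · have := facts c c' hc
    simp only [onePM]; split_ifs <;> omega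
  · exact (facts c c' hc).1
  all_goals
    have h1 := H.two_le c c.2
    have h2 := H.even c c.2
    have h3 := H.le c
    have h4 := hr.le
    simp only [onePM]
    (try split_ifs) <;> omega

theorem isPMDiagram_zeroPM (H : ColumnHeights k r h) (hr : HeightBound X n r) (he : Even r) :
    IsPMDiagram X n r (zeroPM h k j) := by
  have hre := Nat.even_iff.1 he
  have facts : ∀ c c' : Fin k, c ≤ c' → h c' ≤ h c ∧ (c : ℕ) ≤ c' ∧ h c % 2 = 0 ∧ h c' % 2 = 0 :=
    fun c c' hc => ⟨H.anti hc, hc, H.even c c.2, H.even c' c'.2⟩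
  refine ⟨fun c c' hc => ?_, fun c c' hc => ?_, fun c c' hc => ?_, fun c => ?_, fun c => ?_,
    fun c => ?_, fun _ c => ?_⟩
  · have := facts c c' hc
    simp only [zeroPM]; split_ifs <;> omega
  · have := facts c c' hc
    simp only [zeroPM]; split_ifs <;> omega
  · have := facts c c' hc
    simp only [zeroPM]; split_ifs <;> omega
  all_goals
    have h1 := H.two_le c c.2
    have h2 := H.even c c.2
    have h3 := H.le c
    have h4 := hr.le
    simp only [zeroPM]
    (try split_ifs) <;> omega

/-! ### The involution on these diagrams -/

theorem PMData.position_lt {k : ℕ} (P : PMData k) (c : Fin k) :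
    P.position c < P.innerCount (P.inner c) := by
  apply Finset.card_lt_card
  refine ⟨fun c' hc' => ?_, fun hsub => ?_⟩
  · simp only [Finset.mem_filter, Finset.mem_univ, true_and] at hc' ⊢
    exact hc'.1
  · have := hsub (show c ∈ _ by simp)
    simp at this

theorem PMData.plusCount_eq_zero {k : ℕ} {P : PMData k} {i : ℕ}
    (hP : ∀ c, P.inner c = i → P.mid c ≠ i + 1) : P.plusCount i = 0 := by
  rw [PMData.plusCount, Finset.card_eq_zero, Finset.filter_eq_empty_iff]
  intro c _ hc
  exact hP c hc.1 hc.2.1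

theorem PMData.pairCount_eq_zero {k : ℕ} {P : PMData k} {i : ℕ}
    (hP : ∀ c, P.inner c = i → P.mid c ≠ i + 1) : P.pairCount i = 0 := by
  rw [PMData.pairCount, Finset.card_eq_zero, Finset.filter_eq_empty_iff]
  intro c _ hc
  exact hP c hc.1 hc.2.1

theorem PMData.plusCount_eq {k : ℕ} {P : PMData k} {i : ℕ}
    (hP : ∀ c, P.inner c = i → P.mid c = i + 1 ∧ P.outer c = i + 1) :
    P.plusCount i = P.innerCount i := by
  rw [PMData.plusCount, PMData.innerCount]
  congr 1
  ext c
  simpa using hP c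

theorem PMData.pairCount_eq {k : ℕ} {P : PMData k} {i : ℕ}
    (hP : ∀ c, P.inner c = i → P.mid c = i + 1 ∧ P.outer c = i + 2) :
    P.pairCount i = P.innerCount i := by
  rw [PMData.pairCount, PMData.innerCount]
  congr 1
  ext c
  simpa using hP c

theorem frakS_onePM (H : ColumnHeights k r h) (he : Even r) :
    frakS r (onePM h k j) = zeroPM h k j := by
  have hre := Nat.even_iff.1 he
  have facts : ∀ c : Fin k, 2 ≤ h c ∧ h c % 2 = 0 ∧ h c ≤ r :=
    fun c => ⟨H.two_le c c.2, H.even c c.2, H.le c⟩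
  have inner_eq : ∀ c : Fin k, (onePM h k j).inner c =
    if (c : ℕ) < j - k ∨ (c : ℕ) < k - j then h c - 1 else h c - 2 := fun _ => rfl
  have cases3 : ∀ c : Fin k, ((c : ℕ) < j - k ∧ (onePM h k j).inner c = h c - 1 ∧
        (onePM h k j).plusCount ((onePM h k j).inner c) =
          (onePM h k j).innerCount ((onePM h k j).inner c)) ∨
      (¬ (c : ℕ) < j - k ∧ (c : ℕ) < k - j ∧ (onePM h k j).inner c = h c - 1 ∧
        (onePM h k j).plusCount ((onePM h k j).inner c) = 0) ∨
      (¬ (c : ℕ) < j - k ∧ ¬ (c : ℕ) < k - j ∧ (onePM h k j).inner c = h c - 2 ∧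
        (onePM h k j).pairCount ((onePM h k j).inner c) =
          (onePM h k j).innerCount ((onePM h k j).inner c)) := by
    intro c
    have hc := facts c
    by_cases h1 : (c : ℕ) < j - k
    · refine Or.inl ⟨h1, by rw [inner_eq, if_pos (by omega)], PMData.plusCount_eq fun c' h2 => ?_⟩
      have hc' := facts c'
      rw [inner_eq, inner_eq, if_pos (Or.inl h1)] at h2
      rw [inner_eq, if_pos (Or.inl h1)]
      simp only [onePM]
      split_ifs at h2 ⊢ <;> omega
    · by_cases h2 : (c : ℕ) < k - j
      · refine Or.inr (Or.inl ⟨h1, h2, by rw [inner_eq, if_pos (by omega)],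
          PMData.plusCount_eq_zero fun c' h3 => ?_⟩)
        have hc' := facts c'
        rw [inner_eq, inner_eq, if_pos (Or.inr h2)] at h3
        rw [inner_eq, if_pos (Or.inr h2)]
        simp only [onePM]
        split_ifs at h3 ⊢ <;> omega
      · refine Or.inr (Or.inr ⟨h1, h2, by rw [inner_eq, if_neg (by omega)],
          PMData.pairCount_eq fun c' h3 => ?_⟩)
        have hc' := facts c'
        rw [inner_eq, inner_eq, if_neg (by omega : ¬ ((c : ℕ) < j - k ∨ (c : ℕ) < k - j))] at h3
        rw [inner_eq, if_neg (by omega : ¬ ((c : ℕ) < j - k ∨ (c : ℕ) < k - j))]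
        simp only [onePM]
        split_ifs at h3 ⊢ <;> omega
  ext c
  · rfl
  · have hc := facts c
    have hp := (onePM h k j).position_lt c
    simp only [frakS]
    simp only [zeroPM]
    rcases cases3 c with ⟨h1, h2, h3⟩ | ⟨h1, h1', h2, h3⟩ | ⟨h1, h1', h2, h3⟩ <;>
    · rw [h3]
      rw [h2] at hp ⊢
      split_ifs <;> omega
  · have hc := facts c
    have hp := (onePM h k j).position_lt c
    simp only [frakS]
    simp only [zeroPM]
    rcases cases3 c with ⟨h1, h2, h3⟩ | ⟨h1, h1', h2, h3⟩ | ⟨h1, h1', h2, h3⟩ <;>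
    · (try rw [h3])
      rw [h2] at hp ⊢
      split_ifs <;> omega

theorem frakS_zeroPM (H : ColumnHeights k r h) (he : Even r) :
    frakS r (zeroPM h k j) = onePM h k j := by
  have hre := Nat.even_iff.1 he
  have facts : ∀ c : Fin k, 2 ≤ h c ∧ h c % 2 = 0 ∧ h c ≤ r :=
    fun c => ⟨H.two_le c c.2, H.even c c.2, H.le c⟩
  have inner_eq : ∀ c : Fin k, (zeroPM h k j).inner c =
    if (c : ℕ) < j - k ∨ (c : ℕ) < k - j then h c - 1 else h c - 2 := fun _ => rfl
  have cases3 : ∀ c : Fin k, ((c : ℕ) < j - k ∧ (zeroPM h k j).inner c = h c - 1 ∧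
        (zeroPM h k j).plusCount ((zeroPM h k j).inner c) = 0) ∨
      (¬ (c : ℕ) < j - k ∧ (c : ℕ) < k - j ∧ (zeroPM h k j).inner c = h c - 1 ∧
        (zeroPM h k j).plusCount ((zeroPM h k j).inner c) =
          (zeroPM h k j).innerCount ((zeroPM h k j).inner c)) ∨
      (¬ (c : ℕ) < j - k ∧ ¬ (c : ℕ) < k - j ∧ (zeroPM h k j).inner c = h c - 2 ∧
        (zeroPM h k j).pairCount ((zeroPM h k j).inner c) = 0) := by
    intro c
    have hc := facts c
    by_cases h1 : (c : ℕ) < j - k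
    · refine Or.inl ⟨h1, by rw [inner_eq, if_pos (by omega)],
        PMData.plusCount_eq_zero fun c' h2 => ?_⟩
      have hc' := facts c'
      rw [inner_eq, inner_eq, if_pos (Or.inl h1)] at h2
      rw [inner_eq, if_pos (Or.inl h1)]
      simp only [zeroPM]
      split_ifs at h2 ⊢ <;> omega
    · by_cases h2 : (c : ℕ) < k - j
      · refine Or.inr (Or.inl ⟨h1, h2, by rw [inner_eq, if_pos (by omega)],
          PMData.plusCount_eq fun c' h3 => ?_⟩)
        have hc' := facts c'
        rw [inner_eq, inner_eq, if_pos (Or.inr h2)] at h3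
        rw [inner_eq, if_pos (Or.inr h2)]
        simp only [zeroPM]
        split_ifs at h3 ⊢ <;> omega
      · refine Or.inr (Or.inr ⟨h1, h2, by rw [inner_eq, if_neg (by omega)],
          PMData.pairCount_eq_zero fun c' h3 => ?_⟩)
        have hc' := facts c'
        rw [inner_eq, inner_eq, if_neg (by omega : ¬ ((c : ℕ) < j - k ∨ (c : ℕ) < k - j))] at h3
        rw [inner_eq, if_neg (by omega : ¬ ((c : ℕ) < j - k ∨ (c : ℕ) < k - j))]
        simp only [zeroPM]
        split_ifs at h3 ⊢ <;> omega
  ext c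
  · rfl
  · have hc := facts c
    have hp := (zeroPM h k j).position_lt c
    simp only [frakS]
    simp only [onePM]
    rcases cases3 c with ⟨h1, h2, h3⟩ | ⟨h1, h1', h2, h3⟩ | ⟨h1, h1', h2, h3⟩ <;>
    · rw [h3]
      rw [h2] at hp ⊢
      split_ifs <;> omega
  · have hc := facts c
    have hp := (zeroPM h k j).position_lt c
    simp only [frakS]
    simp only [onePM]
    rcases cases3 c with ⟨h1, h2, h3⟩ | ⟨h1, h1', h2, h3⟩ | ⟨h1, h1', h2, h3⟩ <;>
    · (try rw [h3])
      rw [h2] at hp ⊢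
      split_ifs <;> omega

end

/-! ### `Φ` is injective -/

theorem Tableau.ofColumns_injective : Function.Injective Tableau.ofColumns := by
  intro a b h
  exact List.eq_iff_flatten_eq.2 ⟨congrArg Tableau.word h, congrArg Tableau.heights h⟩

/-- The conditions on a single column of a `±`-diagram. -/
def ValidColumn (n : ℕ) (c : ℕ × ℕ × ℕ) : Prop :=
  c.1 ≤ c.2.1 ∧ c.2.1 ≤ c.1 + 1 ∧ c.2.1 ≤ c.2.2 ∧ c.2.2 ≤ c.2.1 + 1 ∧ c.2.2 ≤ n ∧
    (c.2.1 = n → c.2.1 = c.1 + 1)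

theorem plusHeights_cons (n : ℕ) (c : ℕ × ℕ × ℕ) (cs : List (ℕ × ℕ × ℕ)) :
    plusHeights n (c :: cs) =
      if c.2.1 = c.1 + 1 ∧ c.2.1 ≠ n then c.2.1 :: plusHeights n cs else plusHeights n cs := by
  unfold plusHeights
  rw [List.filter_cons]
  split_ifs with h1 h2 h2 <;> simp_all

theorem mem_plusHeights {n v : ℕ} {cs : List (ℕ × ℕ × ℕ)} (hv : v ∈ plusHeights n cs) :
    ∃ c ∈ cs, c.2.1 = v ∧ v = c.1 + 1 ∧ v ≠ n := by
  obtain ⟨c, hc, rfl⟩ := List.mem_map.1 hv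
  obtain ⟨h1, h2⟩ := List.mem_filter.1 hc
  simp only [decide_eq_true_eq] at h2
  exact ⟨c, h1, rfl, h2⟩

theorem length_columnString {m : ℕ} {ps : List ℕ} (h : ∀ v ∈ ps, 1 ≤ v ∧ v ≤ m) :
    (columnString m ps).length = m := by
  cases ps with
  | nil => simp [columnString]
  | cons v ps =>
    have := h v (by simp)
    simp [columnString]; omega

theorem columnString_pos {m : ℕ} {ps : List ℕ} {a : ℤ} (ha : a ∈ columnString m ps) : 0 ≤ a := by
  cases ps with
  | nil => rw [columnString, mem_letterRange] at ha; omega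
  | cons v ps => rw [columnString, List.mem_append, mem_letterRange, mem_letterRange] at ha; omega

theorem minusLetter_neg (ps : List ℕ) : minusLetter ps < 0 := by
  cases ps <;> simp [minusLetter]; omega

theorem head?_eq_of_columnString {m : ℕ} {ps ps' : List ℕ} (h : ∀ v ∈ ps, 1 ≤ v ∧ v ≤ m)
    (h' : ∀ v ∈ ps', 1 ≤ v ∧ v ≤ m) (he : columnString m ps = columnString m ps') :
    ps.head? = ps'.head? := by
  have key : ∀ a : ℤ, a ∈ columnString m ps ↔ a ∈ columnString m ps' := fun a => by rw [he]
  cases ps with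
  | nil =>
    cases ps' with
    | nil => rfl
    | cons v q =>
      have := h' v (by simp)
      have := key 1
      simp only [columnString, List.mem_append, mem_letterRange] at this
      omega
  | cons v q =>
    have h1 := h v (by simp)
    cases ps' with
    | nil =>
      have := key 1
      simp only [columnString, List.mem_append, mem_letterRange] at this
      omega
    | cons v' q' =>
      have h2 := h' v' (by simp)
      have e1 := key (v + 1)
      have e2 := key (v' + 1)
      simp only [columnString, List.mem_append, mem_letterRange] at e1 e2
      simp only [List.head?_cons, Option.some.injEq]
      omega

theorem head?_eq_of_minusLetter {ps ps' : List ℕ} (h : ∀ v ∈ ps, 1 ≤ v) (h' : ∀ v ∈ ps', 1 ≤ v)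
    (he : minusLetter ps = minusLetter ps') : ps.head? = ps'.head? := by
  cases ps with
  | nil =>
    cases ps' with
    | nil => rfl
    | cons v q => have := h' v (by simp); simp only [minusLetter] at he; omega
  | cons v q =>
    have := h v (by simp)
    cases ps' with
    | nil => simp only [minusLetter] at he; omega
    | cons v' q' =>
      simp only [minusLetter] at he
      simp only [List.head?_cons, Option.some.injEq]
      omega

theorem eq_of_head?_of_tail {α : Type*} {p q : List α} (h : p.head? = q.head?)
    (ht : p.tail = q.tail) : p = q := by
  cases p <;> cases q <;> simp_all

theorem suffix_tail {α : Type*} {p L : List α} (h : p <:+ L) : p.tail <:+ L :=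
  (List.tail_suffix p).trans h

theorem suffix_tail_of_cons {α : Type*} {p L : List α} {a : α} (h : p <:+ a :: L) : p.tail <:+ L := by
  rcases List.suffix_cons_iff.1 h with rfl | h
  · exact List.suffix_rfl
  · exact suffix_tail h

/-- The content of the first column and the remaining symbols `+`. -/
theorem fillColumns_cons_spec {n : ℕ} {c : ℕ × ℕ × ℕ} (hc : ValidColumn n c)
    {cs : List (ℕ × ℕ × ℕ)} {ps : List ℕ} (hps : ∀ v ∈ ps, 1 ≤ v ∧ v ≤ c.2.1)
    (hsuf : ps <:+ plusHeights n (c :: cs)) :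
    ∃ (F : List ℤ) (q : List ℕ), fillColumns n (c :: cs) ps = F :: fillColumns n cs q ∧
      q <:+ plusHeights n cs ∧ F.length = c.2.2 ∧ ((∃ a ∈ F, a < 0) ↔ c.2.2 = c.2.1 + 1) ∧
      ((c.2.1 = n ∧ q = ps) ∨
        (c.2.2 = c.2.1 + 1 ∧ c.2.1 = 0 ∧ F = [minusLetter ps] ∧ q = ps.tail) ∨
        (c.2.2 = c.2.1 + 1 ∧ c.2.1 ≠ 0 ∧ c.2.1 ≠ n ∧
          F = columnString c.2.1 ps.tail ++ [minusLetter ps] ∧ q = ps.tail.tail) ∨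
        (c.2.2 = c.2.1 ∧ c.2.1 = 0 ∧ q = ps) ∨
        (c.2.2 = c.2.1 ∧ c.2.1 ≠ 0 ∧ c.2.1 ≠ n ∧ F = columnString c.2.1 ps ∧ q = ps.tail)) := by
  obtain ⟨i, m, o⟩ := c
  obtain ⟨h1, h2, h3, h4, h5, h6⟩ := hc
  simp only at h1 h2 h3 h4 h5 h6 hps
  rw [plusHeights_cons] at hsuf
  simp only at hsuf
  have hsuf' : ps.tail <:+ plusHeights n cs := by
    split_ifs at hsuf
    · exact suffix_tail_of_cons hsuf
    · exact suffix_tail hsuf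
  by_cases hs : m = i + 1 ∧ m = n
  · rw [if_neg (by tauto)] at hsuf
    refine ⟨_, _, by rw [fillColumns, if_pos hs], hsuf, ?_, ?_, Or.inl ⟨hs.2, rfl⟩⟩
    · simp only [length_letterRange]; omega
    · simp only [mem_letterRange]
      constructor
      · rintro ⟨a, ha, ha'⟩; omega
      · intro h; omega
  · by_cases ho : o = m + 1
    · by_cases hm : m = 0
      · refine ⟨_, _, by rw [fillColumns, if_neg hs, if_pos ho, if_pos hm], hsuf', ?_, ?_,
          Or.inr (Or.inl ⟨ho, hm, rfl, rfl⟩)⟩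
        · simp; omega
        · simp only [List.mem_singleton, exists_eq_left, minusLetter_neg, ho]
      · have hps' : ∀ v ∈ ps.tail, 1 ≤ v ∧ v ≤ m := fun v hv => hps v (List.mem_of_mem_tail hv)
        refine ⟨_, _, by rw [fillColumns, if_neg hs, if_pos ho, if_neg hm], suffix_tail hsuf', ?_, ?_,
          Or.inr (Or.inr (Or.inl ⟨ho, hm, show m ≠ n by omega, rfl, rfl⟩))⟩
        · rw [List.length_append, length_columnString hps']; exact ho.symm
        · simp only [ho, iff_true]
          exact ⟨_, by simp, minusLetter_neg ps⟩
    · by_cases hm : m = 0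
      · rw [if_neg (by omega)] at hsuf
        refine ⟨_, _, by rw [fillColumns, if_neg hs, if_neg ho, if_pos hm], hsuf, ?_, ?_,
          Or.inr (Or.inr (Or.inr (Or.inl ⟨(show o = m by omega), hm, rfl⟩)))⟩
        · simp; omega
        · simp [ho]
      · refine ⟨_, _, by rw [fillColumns, if_neg hs, if_neg ho, if_neg hm], hsuf', ?_, ?_,
          Or.inr (Or.inr (Or.inr (Or.inr ⟨(show o = m by omega), hm, fun h => hs ⟨h6 h, h⟩, rfl, rfl⟩)))⟩
        · rw [length_columnString hps]; simp only; omega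
        · simp only [ho, iff_false, not_exists, not_and, not_lt]
          intro a ha
          exact columnString_pos ha

theorem fillColumns_injective {n : ℕ} {cs cs' : List (ℕ × ℕ × ℕ)} {ps ps' : List ℕ}
    (hv : ∀ c ∈ cs, ValidColumn n c) (hv' : ∀ c ∈ cs', ValidColumn n c)
    (hs : cs.Pairwise fun c c' => c'.2.1 ≤ c.2.1) (hs' : cs'.Pairwise fun c c' => c'.2.1 ≤ c.2.1)
    (hps : ps <:+ plusHeights n cs) (hps' : ps' <:+ plusHeights n cs')
    (he : fillColumns n cs ps = fillColumns n cs' ps') :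
    cs.map Prod.snd = cs'.map Prod.snd ∧ ps = ps' := by
  induction cs generalizing cs' ps ps' with
  | nil =>
    cases cs' with
    | nil =>
      rw [List.suffix_nil.1 hps, List.suffix_nil.1 hps']
      exact ⟨rfl, rfl⟩
    | cons c' cs' =>
      obtain ⟨i, m, o⟩ := c'
      simp only [fillColumns] at he
      split_ifs at he
  | cons c cs ih =>
    cases cs' with
    | nil =>
      obtain ⟨i, m, o⟩ := c
      simp only [fillColumns] at he
      split_ifs at he
    | cons c' cs' =>
      have bound : ∀ {c : ℕ × ℕ × ℕ} {cs : List (ℕ × ℕ × ℕ)} {ps : List ℕ},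
          ((c :: cs).Pairwise fun c c' => c'.2.1 ≤ c.2.1) → ps <:+ plusHeights n (c :: cs) →
          ∀ v ∈ ps, 1 ≤ v ∧ v ≤ c.2.1 := by
        intro c cs ps hs hps v hv
        obtain ⟨d, hd, h1, h2, _⟩ := mem_plusHeights (hps.subset hv)
        refine ⟨by omega, ?_⟩
        rcases List.mem_cons.1 hd with rfl | hd
        · omega
        · have := (List.pairwise_cons.1 hs).1 d hd; omega
      have b := bound hs hps
      have b' := bound hs' hps'
      obtain ⟨F, q, e1, e2, e3, e4, e5⟩ := fillColumns_cons_spec (hv c (by simp)) b hps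
      obtain ⟨F', q', e1', e2', e3', e4', e5'⟩ := fillColumns_cons_spec (hv' c' (by simp)) b' hps'
      rw [e1, e1'] at he
      obtain ⟨hF, hrest⟩ := List.cons.inj he
      subst hF
      obtain ⟨i1, i2⟩ := ih (fun d hd => hv d (by simp [hd])) (fun d hd => hv' d (by simp [hd]))
        (List.pairwise_cons.1 hs).2 (List.pairwise_cons.1 hs').2 e2 e2' hrest
      subst i2
      have v := hv c (by simp)
      have v' := hv' c' (by simp)
      obtain ⟨i, m, o⟩ := c
      obtain ⟨i', m', o'⟩ := c'
      simp only [ValidColumn] at *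
      obtain rfl : o = o' := by omega
      obtain rfl : m = m' := by
        rw [e4] at e4'; omega
      refine ⟨by simp [i1], ?_⟩
      have pos : ∀ v ∈ ps, 1 ≤ v := fun v hv => (b v hv).1
      have pos' : ∀ v ∈ ps', 1 ≤ v := fun v hv => (b' v hv).1
      have bt : ∀ v ∈ ps.tail, 1 ≤ v ∧ v ≤ m := fun v hv => b v (List.mem_of_mem_tail hv)
      have bt' : ∀ v ∈ ps'.tail, 1 ≤ v ∧ v ≤ m := fun v hv => b' v (List.mem_of_mem_tail hv)
      rcases e5 with ⟨x1, x2⟩ | ⟨x1, x2, x3, x4⟩ | ⟨x1, x2, x3, x4, x5⟩ | ⟨x1, x2, x3⟩ |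
          ⟨x1, x2, x3, x4, x5⟩ <;>
        rcases e5' with ⟨y1, y2⟩ | ⟨y1, y2, y3, y4⟩ | ⟨y1, y2, y3, y4, y5⟩ | ⟨y1, y2, y3⟩ |
          ⟨y1, y2, y3, y4, y5⟩ <;> first | (exfalso; omega) | skip
      · rw [← x2, ← y2]
      · rw [x3] at y3
        exact eq_of_head?_of_tail (head?_eq_of_minusLetter pos pos' (by simpa using y3)) (by rw [← x4, ← y4])
      · rw [x4] at y4
        obtain ⟨z1, z2⟩ := List.append_inj y4
          (by rw [length_columnString bt, length_columnString bt'])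
        refine eq_of_head?_of_tail (head?_eq_of_minusLetter pos pos' (by simpa using z2)) ?_
        exact eq_of_head?_of_tail (head?_eq_of_columnString bt bt' z1) (by rw [← x5, ← y5])
      · rw [← x3, ← y3]
      · rw [x4] at y4
        exact eq_of_head?_of_tail (head?_eq_of_columnString b b' y4) (by rw [← x5, ← y5])

theorem count_plusHeights_le (n m : ℕ) (cs : List (ℕ × ℕ × ℕ)) :
    (plusHeights n cs).count m ≤ (cs.map fun c => c.2.1).count m :=
  (List.filter_sublist.map _).count_le m

theorem count_plusHeights_eq {n m : ℕ} {cs : List (ℕ × ℕ × ℕ)}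
    (h : ∀ c ∈ cs, c.2.1 = m → c.2.1 = c.1 + 1 ∧ c.2.1 ≠ n) :
    (plusHeights n cs).count m = (cs.map fun c => c.2.1).count m := by
  induction cs with
  | nil => rfl
  | cons c cs ih =>
    have ih := ih fun d hd => h d (by simp [hd])
    have hc := h c (by simp)
    rw [plusHeights_cons, List.map_cons, List.count_cons]
    split_ifs with h1 h2
    · rw [List.count_cons, ih, if_pos h2]
    · rw [List.count_cons, ih, if_neg h2]
    · exact absurd (hc (by simpa using ‹(c.2.1 == m) = true›)) h1
    · rw [ih]; rfl

theorem eq_of_plusHeights {n : ℕ} {cs cs' : List (ℕ × ℕ × ℕ)}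
    (hv : ∀ c ∈ cs, ValidColumn n c) (hv' : ∀ c ∈ cs', ValidColumn n c)
    (hs : cs.Pairwise fun c c' => c'.1 ≤ c.1) (hs' : cs'.Pairwise fun c c' => c'.1 ≤ c.1)
    (hsnd : cs.map Prod.snd = cs'.map Prod.snd) (hp : plusHeights n cs = plusHeights n cs') :
    cs = cs' := by
  induction cs generalizing cs' with
  | nil => cases cs' with
    | nil => rfl
    | cons => simp at hsnd
  | cons c cs ih =>
    cases cs' with
    | nil => simp at hsnd
    | cons c' cs' =>
      rw [List.map_cons, List.map_cons] at hsnd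
      obtain ⟨hc, hsnd⟩ := List.cons.inj hsnd
      have hmid : (cs.map fun c => c.2.1) = cs'.map fun c => c.2.1 := by
        have := congrArg (List.map Prod.fst) hsnd
        simpa [Function.comp_def] using this
      have ih := ih (fun d hd => hv d (by simp [hd])) (fun d hd => hv' d (by simp [hd]))
        (List.pairwise_cons.1 hs).2 (List.pairwise_cons.1 hs').2 hsnd
      have v := hv c (by simp)
      have v' := hv' c' (by simp)
      have s := (List.pairwise_cons.1 hs).1
      have s' := (List.pairwise_cons.1 hs').1
      obtain ⟨i, m, o⟩ := c
      obtain ⟨i', m', o'⟩ := c'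
      obtain ⟨rfl, rfl⟩ := Prod.mk.inj hc
      rw [plusHeights_cons, plusHeights_cons] at hp
      simp only [ValidColumn] at v v' hp s s'
      have absurd_of : ∀ {L L' : List (ℕ × ℕ × ℕ)}, (L.map fun c => c.2.1) = (L'.map fun c => c.2.1) →
          (∀ c ∈ L', ValidColumn n c) → (∀ c ∈ L', c.1 + 1 ≤ m) → m ≠ n →
          plusHeights n L = m :: plusHeights n L' → False := by
        intro L L' h1 h2 h3 h4 h5
        have e1 := count_plusHeights_le n m L
        have e2 := count_plusHeights_eq (n := n) (m := m) (cs := L') fun c hc hcm => by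
          have := h2 c hc
          have := h3 c hc
          simp only [ValidColumn] at *
          exact ⟨by omega, by omega⟩
        rw [h5, List.count_cons_self, h1] at e1
        omega
      by_cases a1 : m = i + 1 ∧ m ≠ n <;> by_cases a2 : m = i' + 1 ∧ m ≠ n
      · rw [if_pos a1, if_pos a2] at hp
        rw [ih (List.cons.inj hp).2, show i = i' by omega]
      · rw [if_pos a1, if_neg a2] at hp
        refine (absurd_of hmid.symm (fun d hd => hv d (by simp [hd])) (fun d hd => ?_) a1.2
          hp.symm).elim
        have := s d hd; omega
      · rw [if_neg a1, if_pos a2] at hp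
        refine (absurd_of hmid (fun d hd => hv' d (by simp [hd])) (fun d hd => ?_) a2.2 hp).elim
        have := s' d hd; omega
      · rw [if_neg a1, if_neg a2] at hp
        rw [ih hp, show i = i' by omega]

theorem Phi_injective {X : AffineType} {n r k : ℕ} (hr : HeightBound X n r) {P P' : PMData k}
    (hP : IsPMDiagram X n r P) (hP' : IsPMDiagram X n r P') (he : Phi n P = Phi n P') : P = P' := by
  have valid : ∀ {P : PMData k}, IsPMDiagram X n r P → (∀ c ∈ P.columns, ValidColumn n c) ∧
      (P.columns.Pairwise fun c c' => c'.2.1 ≤ c.2.1) ∧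
      (P.columns.Pairwise fun c c' => c'.1 ≤ c.1) := by
    intro P hP
    obtain ⟨h1, h2, h3, h4, h5, h6, h7⟩ := hP
    refine ⟨fun c hc => ?_, ?_, ?_⟩
    · obtain ⟨j, rfl⟩ := (List.mem_ofFn' _ _).1 hc
      have a1 := h4 j
      have a2 := h5 j
      have a3 := (h6 j).1
      have a4 := hr.le
      refine ⟨by simp only; omega, by simp only; omega, by simp only; omega, by simp only; omega,
        by simp only; omega, fun h => ?_⟩
      simp only at h ⊢
      cases X with
      | A => have := h7 rfl j; omega
      | B => simp only [HeightBound] at hr; omega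
      | D => simp only [HeightBound] at hr; omega
    · rw [PMData.columns, List.pairwise_ofFn]
      intro i j hij
      exact h2 hij.le
    · rw [PMData.columns, List.pairwise_ofFn]
      intro i j hij
      exact h1 hij.le
  obtain ⟨v, m, i⟩ := valid hP
  obtain ⟨v', m', i'⟩ := valid hP'
  have hf := List.reverse_injective (Tableau.ofColumns_injective he)
  obtain ⟨hsnd, hps⟩ := fillColumns_injective v v' m m' List.suffix_rfl List.suffix_rfl hf
  have hcol := List.ofFn_injective (eq_of_plusHeights v v' i i' hsnd hps)
  ext j
  · exact congrArg Prod.fst (congrFun hcol j)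
  · exact congrArg (fun c => c.2.1) (congrFun hcol j)
  · exact congrArg (fun c => c.2.2) (congrFun hcol j)

theorem PhiInv_Phi {X : AffineType} {n r k : ℕ} (hr : HeightBound X n r) {P : PMData k}
    (hP : IsPMDiagram X n r P) : PhiInv X n r k (Phi n P) = some P := by
  have h : ∃ Q : PMData k, IsPMDiagram X n r Q ∧ Phi n Q = Phi n P := ⟨P, hP, rfl⟩
  rw [PhiInv, dif_pos h, Phi_injective hr h.choose_spec.1 hP h.choose_spec.2]

/-! ### `σ` on the string -/

section

variable {X : AffineType} {n k r j : ℕ} {h : ℕ → ℕ}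

theorem sigma_oneColumn (H : ColumnHeights k r h) (hn : 3 ≤ n) (hr : HeightBound X n r) (he : Even r)
    (hj : j ≤ 2 * k) :
    sigma X n r k (colTableau k (oneColumn h j)) = some (colTableau k (zeroColumn h k j)) := by
  obtain ⟨h1, h2, h3⟩ := raise_zero_one (X := X) H hn hr hj
  rw [sigma, h2, Option.bind_some, ← Phi_onePM H hr.le hj, PhiInv_Phi hr (isPMDiagram_onePM H hr he),
    Option.bind_some, frakS_onePM H he, Phi_zeroPM H hr.le hj, h1]
  exact fWord_reverse_of_eWord (by omega) h3

theorem sigma_zeroColumn (H : ColumnHeights k r h) (hn : 3 ≤ n) (hr : HeightBound X n r)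
    (he : Even r) (hj : j ≤ 2 * k) :
    sigma X n r k (colTableau k (zeroColumn h k j)) = some (colTableau k (oneColumn h j)) := by
  obtain ⟨h1, h2, h3⟩ := raise_zero_one (X := X) H hn hr hj
  rw [sigma, h3, Option.bind_some, ← Phi_zeroPM H hr.le hj,
    PhiInv_Phi hr (isPMDiagram_zeroPM H hr he), Option.bind_some, frakS_zeroPM H he,
    Phi_onePM H hr.le hj, ← h1]
  exact fWord_reverse_of_eWord (by omega) h2

end

/-! ### The `0`-string in the Kirillov–Reshetikhin crystal -/

section

variable {X : AffineType} {n k r j : ℕ} {h : ℕ → ℕ}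

theorem Raise.sig {X : AffineType} {n i s C' : ℕ} {w w' : List ℤ} (h : Raise X n i 0 w w' C' s) :
    wordSig X n i w = (s, C') := by
  have h1 := h.exp
  have h2 := h.carry
  ext <;> simp only <;> omega

theorem Raise.wordE_eq_some {X : AffineType} {n i C' : ℕ} {w w' : List ℤ}
    (h : Raise X n i 0 w w' C' 1) : wordE X n i w = some w' := by
  have := h.iter
  rw [iterOpt_succ] at this
  obtain ⟨v, hv, hv'⟩ := Option.bind_eq_some_iff.1 this
  rw [hv, ← hv']
  rfl

theorem wordSig_oneColumn (hn : 3 ≤ n) {c : ℕ} (hc : 2 ≤ h c) :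
    wordSig X n 1 (oneColumn h j c) = (2 - (j - 2 * c), min 2 (j - 2 * c)) := by
  have hr : (Raise X n 1 0 (letterRange 2 (h c)) ((1 : ℤ) :: letterRange 3 (h c)) 0 1) :=
    Raise.range_minus le_rfl (by omega) hc
  have hq : Raise X n 1 0 [-1] [-2] 0 1 := Raise.neg_minus le_rfl (by omega)
  have hq' : Raise X n 1 0 [-2] [-2] 1 0 := Raise.neg_plus le_rfl (by omega) 0
  have hp : Raise X n 1 0 (gapRange 1 2 (h c)) (gapRange 1 2 (h c)) 1 0 :=
    Raise.gap_plus le_rfl (by omega) le_rfl (Or.inr rfl) 0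
  have h1 : gapRange 1 1 (h c) = letterRange 2 (h c) := by
    rw [gapRange, letterRange_of_lt (by omega)]; rfl
  rw [oneColumn, wordSig_append]
  by_cases h2 : 2 * c < j
  · rw [if_pos h2, hq'.sig]
    by_cases h3 : 2 * c + 1 < j
    · rw [if_pos h3, hp.sig, min_eq_left (by omega)]
      ext <;> simp only <;> omega
    · rw [if_neg h3, h1, hr.sig, min_eq_right (by omega)]
      ext <;> simp only <;> omega
  · rw [if_neg h2, if_neg (by omega), h1, hr.sig, hq.sig, min_eq_right (by omega)]
    ext <;> simp only <;> omega

theorem wordE_oneColumn (hn : 3 ≤ n) {c : ℕ} (hc : 2 ≤ h c) (h1 : 2 * c ≤ j) (h2 : j < 2 * c + 2) :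
    wordE X n 1 (oneColumn h j c) = some (oneColumn h (j + 1) c) := by
  have hr : (Raise X n 1 0 (letterRange 2 (h c)) ((1 : ℤ) :: letterRange 3 (h c)) 0 1) :=
    Raise.range_minus le_rfl (by omega) hc
  have e1 : gapRange 1 1 (h c) = letterRange 2 (h c) := by
    rw [gapRange, letterRange_of_lt (by omega)]; rfl
  have hq : Raise X n 1 0 [-1] [-2] 0 1 := Raise.neg_minus le_rfl (by omega)
  have hq' : Raise X n 1 0 [-2] [-2] 1 0 := Raise.neg_plus le_rfl (by omega) 0
  have e2 : gapRange 1 2 (h c) = (1 : ℤ) :: letterRange 3 (h c) := by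
    rw [gapRange, letterRange_self]; rfl
  simp only [oneColumn]
  rw [wordE_append]
  by_cases h3 : j = 2 * c
  · rw [if_neg (by omega : ¬ 2 * c + 1 < j), if_neg (by omega : ¬ 2 * c < j),
      if_neg (by omega : ¬ 2 * c + 1 < j + 1), if_pos (by omega : 2 * c < j + 1), e1, hr.sig, hq.sig,
      if_neg (by simp), hq.wordE_eq_some]
    rfl
  · rw [if_neg (by omega : ¬ 2 * c + 1 < j), if_pos (by omega : 2 * c < j),
      if_pos (by omega : 2 * c + 1 < j + 1), if_pos (by omega : 2 * c < j + 1), e1, hr.sig, hq'.sig,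
      if_pos (by simp), hr.wordE_eq_some, e2]
    rfl

theorem wordSig_concat_oneColumn (hn : 3 ≤ n) (hh : ∀ c < k, 2 ≤ h c) :
    wordSig X n 1 (concatCols k (oneColumn h j)) = (2 * k - j, min (2 * k) j) := by
  induction k with
  | zero => simp [concatCols, wordSig]
  | succ k ih =>
    rw [concatCols, wordSig_append, ih fun c hc => hh c (by omega), wordSig_oneColumn hn (hh k (by omega))]
    ext <;> simp only <;> omega

theorem wordE_concat_oneColumn (hn : 3 ≤ n) (hh : ∀ c < k, 2 ≤ h c) (hj : j < 2 * k) :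
    wordE X n 1 (concatCols k (oneColumn h j)) = some (concatCols k (oneColumn h (j + 1))) := by
  induction k with
  | zero => omega
  | succ k ih =>
    have hh' : ∀ c < k, 2 ≤ h c := fun c hc => hh c (by omega)
    rw [concatCols, wordE_append, wordSig_concat_oneColumn hn hh', wordSig_oneColumn hn (hh k (by omega)),
      concatCols]
    by_cases hk : j < 2 * k
    · rw [if_neg (by simp only; omega), ih hh' hk, Option.map_some]
      simp only [oneColumn]
      rw [if_neg (by omega : ¬ 2 * k + 1 < j), if_neg (by omega : ¬ 2 * k < j),
      if_neg (by omega : ¬ 2 * k + 1 < j + 1), if_neg (by omega : ¬ 2 * k < j + 1)]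
    · rw [if_pos (by simp only; omega), wordE_oneColumn hn (hh k (by omega)) (by omega) (by omega),
        Option.map_some, concatCols_congr (f := oneColumn h j) (g := oneColumn h (j + 1))]
      intro c hc
      simp only [oneColumn]
      rw [if_pos (by omega : 2 * c + 1 < j), if_pos (by omega : 2 * c < j),
        if_pos (by omega : 2 * c + 1 < j + 1), if_pos (by omega : 2 * c < j + 1)]

theorem length_oneColumn {c : ℕ} (hc : 2 ≤ h c) : (oneColumn h j c).length = h c := by
  rw [oneColumn, List.length_append, length_gapRange_one (by split_ifs <;> omega)
    (by split_ifs <;> omega), List.length_singleton]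
  omega

theorem heights_oneColumn (hh : ∀ c < k, 2 ≤ h c) (j j' : ℕ) :
    (colTableau k (oneColumn h j)).heights = (colTableau k (oneColumn h j')).heights :=
  colTableau_heights_congr fun c hc => by
    rw [length_oneColumn (hh c hc), length_oneColumn (hh c hc)]

theorem e_one_oneColumn (hn : 3 ≤ n) (hh : ∀ c < k, 2 ≤ h c) (hj : j < 2 * k) :
    (tableauOps X n).e 1 (colTableau k (oneColumn h j)) =
      some (colTableau k (oneColumn h (j + 1))) := by
  simp only [tableauOps]
  rw [colTableau_word, wordE_concat_oneColumn hn hh hj, Option.map_some, heights_oneColumn hh j (j + 1),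
    ← colTableau_eq]

theorem f_one_oneColumn (hn : 3 ≤ n) (hh : ∀ c < k, 2 ≤ h c) (hj : j < 2 * k) :
    (tableauOps X n).f 1 (colTableau k (oneColumn h (j + 1))) =
      some (colTableau k (oneColumn h j)) := by
  simp only [tableauOps]
  rw [colTableau_word, (wordE_eq_some (by omega) (wordE_concat_oneColumn hn hh hj)).1, Option.map_some,
    heights_oneColumn hh (j + 1) j, ← colTableau_eq]

theorem f_one_oneColumn_zero (hn : 3 ≤ n) (hh : ∀ c < k, 2 ≤ h c) :
    (tableauOps X n).f 1 (colTableau k (oneColumn h 0)) = none := by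
  simp only [tableauOps]
  rw [colTableau_word, Option.map_eq_none_iff, wordF_eq_none, wordSig_concat_oneColumn hn hh]
  simp

theorem krOps_e_zero (H : ColumnHeights k r h) (hn : 3 ≤ n) (hr : HeightBound X n r) (he : Even r)
    (hj : j < 2 * k) :
    (krOps X n r k).e 0 (colTableau k (zeroColumn h k j)) =
      some (colTableau k (zeroColumn h k (j + 1))) := by
  simp only [krOps, if_true]
  rw [sigma_zeroColumn H hn hr he hj.le, Option.bind_some, e_one_oneColumn hn H.two_le hj,
    Option.bind_some, sigma_oneColumn H hn hr he hj]

theorem krOps_f_zero (H : ColumnHeights k r h) (hn : 3 ≤ n) (hr : HeightBound X n r) (he : Even r)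
    (hj : j < 2 * k) :
    (krOps X n r k).f 0 (colTableau k (zeroColumn h k (j + 1))) =
      some (colTableau k (zeroColumn h k j)) := by
  simp only [krOps, if_true]
  rw [sigma_zeroColumn H hn hr he hj, Option.bind_some, f_one_oneColumn hn H.two_le hj,
    Option.bind_some, sigma_oneColumn H hn hr he hj.le]

theorem krOps_f_zero_eq_none (H : ColumnHeights k r h) (hn : 3 ≤ n) (hr : HeightBound X n r)
    (he : Even r) : (krOps X n r k).f 0 (colTableau k (zeroColumn h k 0)) = none := by
  simp only [krOps, if_true]
  rw [sigma_zeroColumn H hn hr he (Nat.zero_le _), Option.bind_some, f_one_oneColumn_zero hn H.two_le,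
    Option.bind_none]

theorem phi_of_string {β : Type} {C : Ops β} {i : ℕ} {b : ℕ → β} (h0 : C.f i (b 0) = none) {N : ℕ}
    (h1 : ∀ j < N, C.f i (b (j + 1)) = some (b j)) {j : ℕ} (hj : j ≤ N) : C.phi i (b j) = j := by
  have key : ∀ m j, j ≤ N → (iterOpt (C.f i) m (b j) ≠ none ↔ m ≤ j) := by
    intro m
    induction m with
    | zero => intro j _; simp [iterOpt]
    | succ m ih =>
      intro j hj
      rw [iterOpt_succ]
      cases j with
      | zero => simp [h0]
      | succ j => rw [h1 j (by omega), Option.bind_some, ih j (by omega)]; omega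
  have : {m | iterOpt (C.f i) m (b j) ≠ none} = Set.Iic j := by
    ext m; exact key m j hj
  rw [Ops.phi, maxIter, this, csSup_Iic]

theorem krOps_phi_zero (H : ColumnHeights k r h) (hn : 3 ≤ n) (hr : HeightBound X n r) (he : Even r)
    (hj : j ≤ 2 * k) : (krOps X n r k).phi 0 (colTableau k (zeroColumn h k j)) = j :=
  phi_of_string (b := fun j => colTableau k (zeroColumn h k j)) (krOps_f_zero_eq_none H hn hr he)
    (fun _ hj => krOps_f_zero H hn hr he hj) hj

end

/-! ### One-row tableaux -/

/-- The position of a letter in the order of the reading word of a one-row tableau. -/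
def rowPos (n : ℕ) (a : ℤ) : ℤ := if a < 0 then -(n + 1) - a else if a = 0 then 0 else n + 1 - a

/-- The relation between a letter and the letters after it in the reading word of a one-row
tableau. -/
def RowRel (X : AffineType) (n : ℕ) (a b : ℤ) : Prop :=
  rowPos n a ≤ rowPos n b ∧ ¬ (a = 0 ∧ b = 0) ∧ ¬ (X = .D ∧ a = -n ∧ b = n)

/-- The reading words of one-row tableaux. -/
def IsRowWord (X : AffineType) (n : ℕ) (w : List ℤ) : Prop :=
  (∀ a ∈ w, a ∈ letters X n) ∧ w.Pairwise (RowRel X n)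

/-- The coordinates of one-row tableaux. -/
def IsRow (X : AffineType) (n : ℕ) (x : ℤ → ℕ) : Prop :=
  (∀ a, x a ≠ 0 → a ∈ letters X n) ∧ (X = .B → x 0 ≤ 1) ∧ (X = .D → x n = 0 ∨ x (-n) = 0)

section

variable {X : AffineType} {n i : ℕ}

theorem rowPos_injective {a b : ℤ} (ha : a ∈ letters X n) (hb : b ∈ letters X n)
    (h : rowPos n a = rowPos n b) : a = b := by
  simp only [letters, Set.mem_ofPred_eq] at ha hb
  simp only [rowPos] at h
  split_ifs at h <;> omega

theorem vecE_cases {a b : ℤ} (h : vecE X n i a = some b) :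
    (1 ≤ i ∧ i < n ∧ ((a = i + 1 ∧ b = i) ∨ (a = -i ∧ b = -(i + 1)))) ∨
      (i = n ∧ ((X = .B ∧ ((a = 0 ∧ b = n) ∨ (a = -n ∧ b = 0))) ∨ (X = .A ∧ a = -n ∧ b = n) ∨
        (X = .D ∧ ((a = -n ∧ b = n - 1) ∨ (a = -(n - 1) ∧ b = n))))) := by
  unfold vecE at h
  cases X <;> simp only at h <;> split_ifs at h <;> cases h <;> simp_all

theorem RowRel.of_vecE (hn : 3 ≤ n) {a b c : ℤ} (hc : c ∈ letters X n) (ha : a ∈ letters X n)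
    (h : RowRel X n c a) (hab : vecE X n i a = some b) : RowRel X n c b := by
  have := vecE_cases hab
  simp only [letters, Set.mem_ofPred_eq] at ha hc
  unfold RowRel rowPos at *
  cases X <;> simp only [reduceCtorEq, false_and, true_and, not_false_eq_true, and_true, or_false,
    false_or, imp_false] at * <;> split_ifs at * <;> omega

theorem rowPos_cases (n : ℕ) (a : ℤ) :
    (a < 0 ∧ rowPos n a = -(n + 1) - a) ∨ (a = 0 ∧ rowPos n a = 0) ∨
      (0 < a ∧ rowPos n a = n + 1 - a) := by
  unfold rowPos; split_ifs <;> omega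

theorem RowRel.of_signature (hn : 3 ≤ n) {a b c d : ℤ} (hc : c ∈ letters X n)
    (hd : d ∈ letters X n) (hac : RowRel X n a c) (had : RowRel X n a d)
    (hcd : RowRel X n c d ∨ c = d) (hab : vecE X n i a = some b)
    (hs : letterString (vecE X n i) c ≤ letterString (vecF X n i) a) : RowRel X n b d := by
  simp only [letters, Set.mem_ofPred_eq] at hc hd
  have pa := rowPos_cases n a
  have pb := rowPos_cases n b
  have pc := rowPos_cases n c
  have pd := rowPos_cases n d
  unfold RowRel at *
  rcases vecE_cases hab with ⟨h1, h2, h3⟩ | ⟨rfl, h3⟩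
  · rw [letterString_vecE_lt X h1 h2, letterString_vecF_lt X h1 h2, if_neg (by omega : ¬ (a = i ∨ _))] at hs
    have hc' : ¬ (c = i + 1 ∨ c = -i) := fun h => by rw [if_pos h] at hs; omega
    clear hs hab
    have hac' : a ≠ c := fun h => by omega
    have hpac : rowPos n a ≠ rowPos n c := by
      clear hcd had
      rcases h3 with ⟨rfl, rfl⟩ | ⟨rfl, rfl⟩ <;> omega
    have hpcd : rowPos n c ≤ rowPos n d := by
      rcases hcd with h | rfl
      · exact h.1
      · exact le_rfl
    have hpb : rowPos n b = rowPos n a + 1 := by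
      clear hcd had hac
      rcases h3 with ⟨rfl, rfl⟩ | ⟨rfl, rfl⟩ <;> omega
    refine ⟨by omega, by omega, fun ⟨hD, hb, hd'⟩ => ?_⟩
    have hcn : c = -n := by
      have := hac.1
      have : c ≠ 0 := fun h => by have := hc.2.2 h; rw [this] at hD; cases hD
      clear hcd had hac
      omega
    rcases hcd with h | h
    · exact h.2.2 ⟨hD, hcn, hd'⟩
    · omega
  · cases X
    · rw [letterString_vecE_D (by omega), letterString_vecF_D (by omega)] at hs
      simp only [reduceCtorEq, false_and, true_and, false_or, imp_false] at *
      have hc' : ¬ (c = -i ∨ c = -(i - 1)) := fun h => by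
        rw [if_pos h, if_neg (by omega)] at hs; omega
      clear hs hab
      rcases h3 with ⟨rfl, rfl⟩ | ⟨rfl, rfl⟩ <;> omega
    · rw [letterString_vecE_B (by omega), letterString_vecF_B (by omega)] at hs
      simp only [reduceCtorEq, false_and, true_and, not_false_eq_true, and_true, or_false] at *
      have hc' : ¬ (c = -i) := fun h => by
        rw [if_pos h] at hs; split_ifs at hs <;> omega
      rw [if_neg hc'] at hs
      clear hab
      rcases h3 with ⟨rfl, rfl⟩ | ⟨rfl, rfl⟩
      · omega
      · have hc'' : ¬ c = 0 := fun h => by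
          rw [if_pos h, if_neg (by omega), if_neg (by omega)] at hs; omega
        omega
    · rw [letterString_vecE_A (by omega), letterString_vecF_A (by omega)] at hs
      simp only [reduceCtorEq, false_and, true_and, not_false_eq_true, and_true, or_false,
        false_or, imp_false] at *
      have hc' : ¬ (c = -i) := fun h => by
        rw [if_pos h, if_neg (by omega)] at hs; omega
      clear hs hab
      rcases h3 with ⟨rfl, rfl⟩
      omega

theorem vecE_mem_letters (hn : 3 ≤ n) {a b : ℤ} (ha : a ∈ letters X n)
    (hab : vecE X n i a = some b) : b ∈ letters X n := by
  simp only [letters, Set.mem_ofPred_eq] at ha ⊢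
  rcases vecE_cases hab with ⟨h1, h2, h3⟩ | ⟨rfl, ⟨rfl, h3⟩ | ⟨rfl, h3⟩ | ⟨rfl, h3⟩⟩
  · exact ⟨by omega, by omega, fun h => by exfalso; omega⟩
  · exact ⟨by omega, by omega, fun h => rfl⟩
  · exact ⟨by omega, by omega, fun h => by exfalso; omega⟩
  · exact ⟨by omega, by omega, fun h => by exfalso; omega⟩

theorem mem_of_wordE {w w' : List ℤ} (h : wordE X n i w = some w') {b : ℤ} (hb : b ∈ w') :
    b ∈ w ∨ ∃ a ∈ w, vecE X n i a = some b := by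
  induction w generalizing w' with
  | nil => simp [wordE] at h
  | cons a w ih =>
    rw [wordE] at h
    split_ifs at h
    · obtain ⟨b', hb', rfl⟩ := Option.map_eq_some_iff.1 h
      rcases List.mem_cons.1 hb with rfl | hb
      · exact Or.inr ⟨a, by simp, hb'⟩
      · exact Or.inl (by simp [hb])
    · obtain ⟨v, hv, rfl⟩ := Option.map_eq_some_iff.1 h
      rcases List.mem_cons.1 hb with rfl | hb
      · exact Or.inl (by simp)
      · rcases ih hv hb with h | ⟨c, hc, hc'⟩
        · exact Or.inl (by simp [h])
        · exact Or.inr ⟨c, by simp [hc], hc'⟩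

theorem IsRowWord.of_wordE (hn : 3 ≤ n) {w w' : List ℤ} (hw : IsRowWord X n w)
    (h : wordE X n i w = some w') : IsRowWord X n w' := by
  induction w generalizing w' with
  | nil => simp [wordE] at h
  | cons a w ih =>
    obtain ⟨hl, hp⟩ := hw
    obtain ⟨hp1, hp2⟩ := List.pairwise_cons.1 hp
    have ha := hl a (by simp)
    have hlw : ∀ b ∈ w, b ∈ letters X n := fun b hb => hl b (by simp [hb])
    rw [wordE] at h
    split_ifs at h with hs
    · obtain ⟨b, hb, rfl⟩ := Option.map_eq_some_iff.1 h
      refine ⟨?_, List.pairwise_cons.2 ⟨?_, hp2⟩⟩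
      · intro d hd
        rcases List.mem_cons.1 hd with rfl | hd
        · exact vecE_mem_letters hn ha hb
        · exact hlw d hd
      · intro d hd
        cases w with
        | nil => simp at hd
        | cons c w =>
          refine RowRel.of_signature hn (hlw c (by simp)) (hlw d hd) (hp1 c (by simp)) (hp1 d hd)
            ?_ hb ?_
          · rcases List.mem_cons.1 hd with rfl | hd
            · exact Or.inr rfl
            · exact Or.inl ((List.pairwise_cons.1 hp2).1 d hd)
          · refine le_trans ?_ hs
            simp only [wordSig]
            omega
    · obtain ⟨v, hv, rfl⟩ := Option.map_eq_some_iff.1 h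
      obtain ⟨hv1, hv2⟩ := ih ⟨hlw, hp2⟩ hv
      refine ⟨?_, List.pairwise_cons.2 ⟨?_, hv2⟩⟩
      · intro d hd
        rcases List.mem_cons.1 hd with rfl | hd
        · exact ha
        · exact hv1 d hd
      · intro d hd
        rcases mem_of_wordE hv hd with hd | ⟨c, hc, hcd⟩
        · exact hp1 d hd
        · exact RowRel.of_vecE hn ha (hlw c hc) (hp1 c hc) hcd

/-- The letters in the order of the reading word of a one-row tableau. -/
def rowLetters (n : ℕ) : List ℤ :=
  ((List.range' 1 n).map fun i : ℕ => -(i : ℤ)) ++ [0] ++ (List.range' 1 n).reverse.map fun i : ℕ => (i : ℤ)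

theorem rowWord_eq (n : ℕ) (x : ℤ → ℕ) :
    rowWord n x = (rowLetters n).flatMap fun a => List.replicate (x a) a := by
  simp only [rowWord, rowLetters, List.pure_def, List.bind_eq_flatMap, List.flatMap_map,
    List.flatMap_append, List.flatMap_singleton, List.flatMap_assoc]

theorem mem_rowLetters {a : ℤ} : a ∈ rowLetters n ↔ -(n : ℤ) ≤ a ∧ a ≤ n := by
  simp only [rowLetters, List.mem_append, List.mem_map, List.mem_reverse, List.mem_range'_1,
    List.mem_singleton]
  constructor
  · rintro ((⟨j, hj, rfl⟩ | rfl) | ⟨j, hj, rfl⟩) <;> omega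
  · intro h
    rcases lt_trichotomy a 0 with h1 | h1 | h1
    · exact Or.inl (Or.inl ⟨(-a).toNat, by omega, by omega⟩)
    · exact Or.inl (Or.inr h1)
    · exact Or.inr ⟨a.toNat, by omega, by omega⟩

theorem pairwise_rowLetters (n : ℕ) :
    (rowLetters n).Pairwise fun a b => rowPos n a < rowPos n b := by
  have h1 : (List.range' 1 n).Pairwise (· < ·) := List.pairwise_lt_range'
  rw [rowLetters, List.pairwise_append, List.pairwise_append]
  refine ⟨⟨?_, List.pairwise_singleton _ _, ?_⟩, ?_, ?_⟩
  · refine List.pairwise_map.2 (h1.imp_of_mem fun {a b} ha hb hab => ?_)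
    rw [List.mem_range'_1] at ha hb
    simp only [rowPos]
    split_ifs <;> omega
  · simp only [List.mem_map, List.mem_range'_1, List.mem_singleton]
    rintro _ ⟨j, hj, rfl⟩ _ rfl
    simp only [rowPos]
    split_ifs <;> omega
  · refine List.pairwise_map.2 (List.pairwise_reverse.2 (h1.imp_of_mem fun {a b} ha hb hab => ?_))
    rw [List.mem_range'_1] at ha hb
    simp only [rowPos]
    split_ifs <;> omega
  · simp only [List.mem_append, List.mem_map, List.mem_reverse, List.mem_range'_1, List.mem_singleton]
    rintro _ (⟨j, hj, rfl⟩ | rfl) _ ⟨j', hj', rfl⟩ <;>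
    · simp only [rowPos]
      split_ifs <;> omega

theorem count_flatMap_replicate {L : List ℤ} (hL : L.Nodup) (x : ℤ → ℕ) (a : ℤ) :
    (L.flatMap fun b => List.replicate (x b) b).count a = if a ∈ L then x a else 0 := by
  induction L with
  | nil => rfl
  | cons b L ih =>
    obtain ⟨h1, h2⟩ := List.nodup_cons.1 hL
    rw [List.flatMap_cons, List.count_append, ih h2, List.count_replicate]
    by_cases hab : b = a
    · subst hab
      simp [h1]
    · simp [hab, Ne.symm hab]

theorem count_rowWord {x : ℤ → ℕ} (hx : ∀ a, x a ≠ 0 → a ∈ letters X n) (a : ℤ) :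
    (rowWord n x).count a = x a := by
  rw [rowWord_eq, count_flatMap_replicate ((pairwise_rowLetters n).imp fun h => by
    rintro rfl; exact lt_irrefl _ h)]
  split_ifs with h
  · rfl
  · by_contra h0
    obtain ⟨h1, h2, _⟩ := hx a (Ne.symm h0)
    exact h (mem_rowLetters.2 ⟨h1, h2⟩)

theorem IsRow.rowWord {x : ℤ → ℕ} (hx : IsRow X n x) : IsRowWord X n (rowWord n x) := by
  refine ⟨fun a ha => hx.1 a ?_, ?_⟩
  · rw [← count_rowWord hx.1 a]
    exact (List.count_pos_iff.2 ha).ne'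
  · rw [rowWord_eq, List.pairwise_flatMap]
    refine ⟨fun a ha => List.pairwise_replicate.2 ?_, (pairwise_rowLetters n).imp_of_mem ?_⟩
    · by_cases h0 : a = 0
      · left
        by_contra h1
        have hB : X = .B := (hx.1 a (by omega)).2.2 h0
        have := hx.2.1 hB
        subst h0
        omega
      · by_cases hn : n = 0
        · rw [mem_rowLetters] at ha
          omega
        · exact Or.inr ⟨le_rfl, by tauto, fun h => by omega⟩
    · intro a b _ _ hab c hc d hd
      obtain ⟨h1, rfl⟩ := List.mem_replicate.1 hc
      obtain ⟨h2, rfl⟩ := List.mem_replicate.1 hd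
      refine ⟨hab.le, ?_, ?_⟩
      · rintro ⟨rfl, rfl⟩
        exact lt_irrefl _ hab
      · rintro ⟨hD, rfl, rfl⟩
        rcases hx.2.2 hD with h | h <;> omega

theorem IsRowWord.isRow {w : List ℤ} (hw : IsRowWord X n w) (hn : 1 ≤ n) :
    IsRow X n fun a => w.count a := by
  refine ⟨fun a ha => hw.1 a (List.count_pos_iff.1 (Nat.pos_of_ne_zero ha)), fun _ => ?_, fun hD => ?_⟩
  · have h1 : (List.replicate (w.count 0) (0 : ℤ)).Pairwise (RowRel X n) :=
      hw.2.sublist (List.replicate_sublist_iff.2 le_rfl)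
    rcases List.pairwise_replicate.1 h1 with h | h
    · exact h
    · exact absurd ⟨rfl, rfl⟩ h.2.1
  · by_contra hc
    simp only [not_or] at hc
    have h1 : (n : ℤ) ∈ w := List.count_pos_iff.1 (Nat.pos_of_ne_zero hc.1)
    have h2 : -(n : ℤ) ∈ w := List.count_pos_iff.1 (Nat.pos_of_ne_zero hc.2)
    have h3 : RowRel X n (-(n : ℤ)) n ∨ RowRel X n n (-(n : ℤ)) := by
      have key : ∀ {w : List ℤ} {a b : ℤ}, w.Pairwise (RowRel X n) → a ∈ w → b ∈ w → a ≠ b →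
          RowRel X n a b ∨ RowRel X n b a := by
        intro w a b hw ha hb hab
        induction w with
        | nil => simp at ha
        | cons c w ih =>
          obtain ⟨p1, p2⟩ := List.pairwise_cons.1 hw
          rcases List.mem_cons.1 ha with ha' | ha'
          · rcases List.mem_cons.1 hb with hb' | hb'
            · exact absurd (ha'.trans hb'.symm) hab
            · exact Or.inl (ha' ▸ p1 b hb')
          · rcases List.mem_cons.1 hb with hb' | hb'
            · exact Or.inr (hb' ▸ p1 a ha')
            · exact ih p2 ha' hb'
      exact key hw.2 h2 h1 (by omega)
    rcases h3 with h | h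
    · exact h.2.2 ⟨hD, rfl, rfl⟩
    · have := h.1
      simp only [rowPos] at this
      split_ifs at this <;> omega

theorem IsRowWord.rowWord_count {w : List ℤ} (hw : IsRowWord X n w) (hn : 1 ≤ n) :
    KRcrystals.rowWord n (fun a => w.count a) = w := by
  have h1 := (hw.isRow hn).rowWord
  have hperm : (KRcrystals.rowWord n (fun a => w.count a)).Perm w :=
    List.perm_iff_count.2 fun a => count_rowWord (hw.isRow hn).1 a
  exact hperm.eq_of_pairwise (le := RowRel X n)
    (fun a b ha hb hab hba => rowPos_injective (h1.1 a ha) (hw.1 b hb) (le_antisymm hab.1 hba.1))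
    h1.2 hw.2

/-! ### The tensor product as a word -/

theorem rowOps_e (hn : 3 ≤ n) (hi : i ≠ 0) {x : ℤ → ℕ} (hx : IsRow X n x) {w : List ℤ}
    (h : wordE X n i (rowWord n x) = some w) :
    ∃ y, (rowOps X n).e i x = some y ∧ IsRow X n y ∧ rowWord n y = w := by
  have hw := hx.rowWord.of_wordE hn h
  refine ⟨fun a => w.count a, ?_, hw.isRow (by omega), hw.rowWord_count (by omega)⟩
  simp only [rowOps, if_neg hi, h, Option.map_some]

theorem rowOps_eps (hn : 3 ≤ n) (hi : i ≠ 0) {x : ℤ → ℕ} (hx : IsRow X n x) :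
    (rowOps X n).eps i x = (wordSig X n i (rowWord n x)).1 := by
  refine maxIter_eq _ (IsRow X n) (fun x => (wordSig X n i (rowWord n x)).1) ?_ ?_ hx
  · intro x _ h
    simp only [rowOps, if_neg hi, wordE_eq_none.2 h, Option.map_none]
  · intro x hx h
    obtain ⟨w, hw⟩ := Option.ne_none_iff_exists'.1 (mt wordE_eq_none.1 h)
    obtain ⟨y, h1, h2, h3⟩ := rowOps_e hn hi hx hw
    refine ⟨y, h1, h2, ?_⟩
    rw [h3]
    exact (wordE_eq_some (by omega) hw).2.1

theorem krOps_phi {r k : ℕ} (hn : 3 ≤ n) (hi : i ≠ 0) (T : Tableau) :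
    (krOps X n r k).phi i T = (wordSig X n i T.word).2 := by
  refine maxIter_eq _ (fun _ => True) (fun T : Tableau => (wordSig X n i T.word).2) ?_ ?_ trivial
  · intro T _ h
    simp only [krOps, if_neg hi, tableauOps, wordF_eq_none.2 h, Option.map_none]
  · intro T _ h
    obtain ⟨w, hw⟩ := Option.ne_none_iff_exists'.1 (mt wordF_eq_none.1 h)
    refine ⟨⟨T.heights, w⟩, ?_, trivial, ?_⟩
    · simp only [krOps, if_neg hi, tableauOps, hw, Option.map_some]
    · exact (wordE_eq_some (by omega) (wordF_eq_some (by omega) hw)).2.2.1.symm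

theorem tensor_e {r k : ℕ} (hn : 3 ≤ n) (hi : i ≠ 0) (T : Tableau) {x : ℤ → ℕ} (hx : IsRow X n x)
    {w : List ℤ} (h : wordE X n i (T.word ++ rowWord n x) = some w) :
    ∃ T' y, ((krOps X n r k).tensor (rowOps X n)).e i (T, x) = some (T', y) ∧ IsRow X n y ∧
      T'.heights = T.heights ∧ T'.word.length = T.word.length ∧ T'.word ++ rowWord n y = w := by
  simp only [Ops.tensor]
  rw [rowOps_eps hn hi hx, krOps_phi hn hi]
  rw [wordE_append] at h
  split_ifs at h ⊢ with hs
  · obtain ⟨v, hv, rfl⟩ := Option.map_eq_some_iff.1 h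
    refine ⟨⟨T.heights, v⟩, x, ?_, hx, rfl, (wordE_eq_some (by omega) hv).2.2.2, rfl⟩
    simp only [krOps, if_neg hi, tableauOps, hv, Option.map_some]
  · obtain ⟨v, hv, rfl⟩ := Option.map_eq_some_iff.1 h
    obtain ⟨y, h1, h2, h3⟩ := rowOps_e hn hi hx hv
    exact ⟨T, y, by rw [h1, Option.map_some], h2, rfl, rfl, by rw [h3]⟩

theorem wordSig_of_tensor_e_eq_none {r k : ℕ} (hn : 3 ≤ n) (hi : i ≠ 0) (T : Tableau) {x : ℤ → ℕ}
    (hx : IsRow X n x) (h : ((krOps X n r k).tensor (rowOps X n)).e i (T, x) = none) :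
    (wordSig X n i (T.word ++ rowWord n x)).1 = 0 := by
  by_contra hc
  obtain ⟨w, hw⟩ := Option.ne_none_iff_exists'.1 (mt wordE_eq_none.1 hc)
  obtain ⟨T', y, h1, _⟩ := tensor_e (r := r) (k := k) hn hi T hx hw
  rw [h] at h1
  cases h1

theorem iterOpt_tensor_e {r k s : ℕ} (hn : 3 ≤ n) (hi : i ≠ 0) {T : Tableau} {x : ℤ → ℕ}
    (hx : IsRow X n x) {w : List ℤ} (h : iterOpt (wordE X n i) s (T.word ++ rowWord n x) = some w) :
    ∃ T' y, iterOpt (((krOps X n r k).tensor (rowOps X n)).e i) s (T, x) = some (T', y) ∧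
      IsRow X n y ∧ T'.heights = T.heights ∧ T'.word.length = T.word.length ∧
      T'.word ++ rowWord n y = w := by
  induction s generalizing T x with
  | zero =>
    exact ⟨T, x, rfl, hx, rfl, rfl, by simpa [iterOpt] using h⟩
  | succ s ih =>
    rw [iterOpt_succ] at h
    obtain ⟨v, hv, hv'⟩ := Option.bind_eq_some_iff.1 h
    obtain ⟨T', y, h1, h2, h3, h4, rfl⟩ := tensor_e (r := r) (k := k) hn hi T hx hv
    obtain ⟨T'', z, i1, i2, i3, i4, i5⟩ := ih h2 hv'
    exact ⟨T'', z, by rw [iterOpt_succ, h1, Option.bind_some, i1], i2, i3.trans h3, i4.trans h4, i5⟩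

theorem RaisePath.tensor {r k : ℕ} (hn : 3 ≤ n) {L : List (ℕ × ℕ)} (hL : ∀ p ∈ L, p.1 ≠ 0)
    {T : Tableau} {x : ℤ → ℕ} (hx : IsRow X n x) {w : List ℤ}
    (h : RaisePath X n L (T.word ++ rowWord n x) w) :
    ∃ T' y, ((krOps X n r k).tensor (rowOps X n)).eWord (pathWord L) (T, x) = some (T', y) ∧
      IsRow X n y ∧ T'.heights = T.heights ∧ T'.word.length = T.word.length ∧
      T'.word ++ rowWord n y = w := by
  induction L generalizing T x with
  | nil => exact ⟨T, x, rfl, hx, rfl, rfl, h⟩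
  | cons p L ih =>
    obtain ⟨v, C, h1, h2⟩ := h
    obtain ⟨T', y, j1, j2, j3, j4, rfl⟩ := iterOpt_tensor_e (r := r) (k := k) hn (hL p (by simp)) hx h1.iter
    obtain ⟨T'', z, i1, i2, i3, i4, i5⟩ := ih (fun q hq => hL q (by simp [hq])) j2 h2
    refine ⟨T'', z, ?_, i2, i3.trans j3, i4.trans j4, i5⟩
    have : pathWord (p :: L) = List.replicate p.2 p.1 ++ pathWord L := by simp [pathWord]
    rw [this, Ops.eWord_append, Ops.eWord_replicate, j1, Option.bind_some, i1]

/-- A path from one element of the tensor product to another one. -/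
theorem RaisePath.tensor_eq {r k : ℕ} (hn : 3 ≤ n) {L : List (ℕ × ℕ)} (hL : ∀ p ∈ L, p.1 ≠ 0)
    {T T' : Tableau} {x y : ℤ → ℕ} (hx : IsRow X n x) (hy : IsRow X n y)
    (hT : T'.heights = T.heights) (hT' : T'.word.length = T.word.length)
    (h : RaisePath X n L (T.word ++ rowWord n x) (T'.word ++ rowWord n y)) :
    ((krOps X n r k).tensor (rowOps X n)).eWord (pathWord L) (T, x) = some (T', y) := by
  obtain ⟨U, z, h1, h2, h3, h4, h5⟩ := RaisePath.tensor (r := r) (k := k) hn hL hx h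
  obtain ⟨e1, e2⟩ := List.append_inj h5 (by rw [h4, hT'])
  rw [h1]
  congr 2
  · exact Tableau.ext (h3.trans hT.symm) e1
  · funext a
    rw [← count_rowWord h2.1 a, e2, count_rowWord hy.1 a]

end

/-! ### Raising one-row tableaux -/

section

variable {X : AffineType} {n i m : ℕ}

theorem Raise.replicate_plus (hn : 3 ≤ n) {v : ℤ} (h : ∀ C, Raise X n i C [v] [v] (C + 1) 0)
    (a C : ℕ) : Raise X n i C (List.replicate a v) (List.replicate a v) (C + a) 0 := by
  induction a generalizing C with
  | zero => exact Raise.nil C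
  | succ a ih =>
    have := (h C).append (by omega) (ih (C + 1))
    rwa [show C + 1 + a = C + (a + 1) by omega] at this

theorem Raise.replicate_minus_matched (hn : 3 ≤ n) {v : ℤ}
    (h : ∀ C, Raise X n i (C + 1) [v] [v] C 0) (a C : ℕ) :
    Raise X n i (C + a) (List.replicate a v) (List.replicate a v) C 0 := by
  induction a generalizing C with
  | zero => exact Raise.nil C
  | succ a ih => exact (h (C + a)).append (by omega) (ih C)

theorem Raise.replicate_minus (hn : 3 ≤ n) {v u : ℤ} {s : ℕ} (h : Raise X n i 0 [v] [u] 0 s) (a : ℕ) :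
    Raise X n i 0 (List.replicate a v) (List.replicate a u) 0 (a * s) := by
  induction a with
  | zero => rw [Nat.zero_mul]; exact Raise.nil 0
  | succ a ih =>
    have := h.append (by omega) ih
    rwa [Nat.add_comm s, ← Nat.succ_mul] at this

theorem wordSig_fst_eq_zero {w : List ℤ} (h : ∀ v ∈ w, letterString (vecE X n i) v = 0) :
    (wordSig X n i w).1 = 0 := by
  induction w with
  | nil => rfl
  | cons a w ih =>
    simp only [wordSig]
    rw [ih fun v hv => h v (by simp [hv]), h a (by simp), Nat.zero_sub]

theorem rowLetters_split (h1 : 1 ≤ m) (h2 : m < n) : ∃ L1 L2 L3 : List ℤ,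
    rowLetters n = L1 ++ ([-(m : ℤ)] ++ ([-((m : ℤ) + 1)] ++ (L2 ++ ([(m : ℤ) + 1] ++ ([(m : ℤ)] ++ L3))))) ∧
      ∀ L ∈ [L1, L2, L3], ∀ a ∈ L, a ≠ m ∧ a ≠ m + 1 ∧ a ≠ -m ∧ a ≠ -(m + 1) := by
  have e : List.range' 1 n = List.range' 1 (m - 1) ++ m :: (m + 1) :: List.range' (m + 2) (n - m - 1) := by
    have h3 := List.range'_append_1 (s := 1) (m := m - 1) (n := n - m - 1 + 1 + 1)
    rw [show m - 1 + (n - m - 1 + 1 + 1) = n by omega, show 1 + (m - 1) = m by omega] at h3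
    rw [← h3, List.range'_succ, List.range'_succ]
  refine ⟨(List.range' 1 (m - 1)).map fun i : ℕ => -(i : ℤ),
    ((List.range' (m + 2) (n - m - 1)).map fun i : ℕ => -(i : ℤ)) ++ [0] ++
      ((List.range' (m + 2) (n - m - 1)).map fun i : ℕ => (i : ℤ)).reverse,
    ((List.range' 1 (m - 1)).map fun i : ℕ => (i : ℤ)).reverse, ?_, ?_⟩
  · rw [rowLetters, e]
    simp
  · simp only [List.mem_cons, List.not_mem_nil, or_false, forall_eq_or_imp, forall_eq, List.mem_append,
      List.mem_map, List.mem_reverse, List.mem_range'_1]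
    refine ⟨?_, ?_, ?_⟩
    · rintro _ ⟨j, hj, rfl⟩; omega
    · rintro _ ((⟨j, hj, rfl⟩ | rfl) | ⟨j, hj, rfl⟩) <;> omega
    · rintro _ ⟨j, hj, rfl⟩; omega

/-- The maximal power of `e_m`, `m < n`, on a one-row tableau. -/
theorem Raise.row (hn : 3 ≤ n) (h1 : 1 ≤ m) (h2 : m < n) {x y : ℤ → ℕ}
    (hy : ∀ a : ℤ, a ≠ m → a ≠ m + 1 → a ≠ -m → a ≠ -(m + 1) → y a = x a) (e1 : y (-m) = 0)
    (e2 : y (-(m + 1)) = x (-m) + x (-(m + 1))) (e3 : y (m + 1) = min (x (m + 1)) (x (-(m + 1))))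
    (e4 : y m = x m + (x (m + 1) - x (-(m + 1)))) :
    ∃ C, Raise X n m 0 (rowWord n x) (rowWord n y) C (x (-m) + (x (m + 1) - x (-(m + 1)))) := by
  obtain ⟨L1, L2, L3, e, hL⟩ := rowLetters_split h1 h2
  have inert : ∀ L ∈ [L1, L2, L3], ∀ C, Raise X n m C (L.flatMap fun a => List.replicate (x a) a)
      (L.flatMap fun a => List.replicate (y a) a) C 0 := by
    intro L hLm C
    have : (L.flatMap fun a => List.replicate (y a) a) = L.flatMap fun a => List.replicate (x a) a := by
      apply List.flatMap_congr
      intro a ha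
      obtain ⟨p1, p2, p3, p4⟩ := hL L hLm a ha
      rw [hy a p1 p2 p3 p4]
    rw [this]
    apply Raise.letters_inert h1 h2
    intro v hv
    obtain ⟨a, ha, hva⟩ := List.mem_flatMap.1 hv
    obtain ⟨_, rfl⟩ := List.mem_replicate.1 hva
    exact hL L hLm _ ha
  rw [rowWord_eq, rowWord_eq, e]
  simp only [List.flatMap_append, List.flatMap_singleton]
  rw [e1, e2, e3, e4]
  set a := x (-m)
  set b := x (-(m + 1))
  set c := x (m + 1)
  set d := x m
  have r1 : Raise X n m 0 (List.replicate a (-(m : ℤ))) (List.replicate a (-((m : ℤ) + 1))) 0 a := by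
    have := Raise.replicate_minus (X := X) hn (Raise.neg_minus h1 h2) a
    rwa [Nat.mul_one] at this
  have r2 := Raise.replicate_plus (X := X) hn (Raise.neg_plus h1 h2) b 0
  have r3 : Raise X n m (0 + b) (List.replicate c ((m : ℤ) + 1))
      (List.replicate (min c b) ((m : ℤ) + 1) ++ List.replicate (c - b) (m : ℤ)) (b - c) (c - b) := by
    rcases Nat.le_total c b with h | h
    · have := Raise.replicate_minus_matched (X := X) hn (Raise.letter_minus_matched h1 h2) c (b - c)
      rw [min_eq_left h, Nat.sub_eq_zero_of_le h, List.replicate_zero, List.append_nil]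
      rwa [show b - c + c = 0 + b by omega] at this
    · have p1 := Raise.replicate_minus_matched (X := X) hn (Raise.letter_minus_matched h1 h2) b 0
      have p2 := Raise.replicate_minus (X := X) hn (Raise.letter_minus h1 h2) (c - b)
      have p3 := p1.append (by omega) p2
      rw [← List.replicate_add, show b + (c - b) = c by omega, Nat.zero_add (_ * 1), Nat.mul_one] at p3
      rwa [min_eq_right h, Nat.sub_eq_zero_of_le h]
  have r4 := Raise.replicate_plus (X := X) hn (Raise.letter_plus h1 h2) d (b - c)
  have key := (inert L1 (by simp) 0).append (by omega) (r1.append (by omega) (r2.append (by omega)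
    ((inert L2 (by simp) _).append (by omega) (r3.append (by omega) (r4.append (by omega)
      (inert L3 (by simp) _))))))
  refine ⟨b - c + d, ?_⟩
  convert key using 1
  · rw [Nat.add_comm d (c - b)]
    simp only [List.replicate_zero, List.nil_append, List.replicate_add, List.append_assoc]
  · omega

/-- The maximal power of `e_n` on a one-row tableau without the letter `0`. -/
theorem Raise.row_last (hn : 3 ≤ n) {x y : ℤ → ℕ} (h0 : x 0 = 0)
    (hD : X = .D → x n = 0 ∧ x (-(n - 1)) = 0 ∧ x (n - 1) = 0)
    (hy : ∀ a : ℤ, a ≠ turnTop X n → a ≠ -n → y a = x a) (e1 : y (-n) = 0)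
    (e2 : y (turnTop X n) = x (turnTop X n) + x (-n)) :
    ∃ C, Raise X n n 0 (rowWord n x) (rowWord n y) C (x (-n) * turnExp X) := by
  have e : List.range' 1 n = List.range' 1 (n - 2) ++ [n - 1, n] := by
    have h3 := List.range'_append_1 (s := 1) (m := n - 2) (n := 2)
    rw [show n - 2 + 2 = n by omega, show 1 + (n - 2) = n - 1 by omega] at h3
    rw [← h3]
    congr 1
    simp only [List.range'_succ, List.range'_zero]
    rw [show n - 1 + 1 = n by omega]
  have hc : ((n - 1 : ℕ) : ℤ) = n - 1 := by omega
  obtain ⟨L1, L3, eL, h1, h3⟩ : ∃ L1 L3 : List ℤ,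
      rowLetters n = L1 ++ ([-(n : ℤ)] ++ ([0] ++ ([(n : ℤ)] ++ ([(n : ℤ) - 1] ++ L3)))) ∧
      (∀ a ∈ L1, -n < a ∧ a < 0) ∧ (∀ a ∈ L3, a < n - 1 ∧ 0 < a) := by
    refine ⟨((List.range' 1 (n - 2)).map fun i : ℕ => -(i : ℤ)) ++ [-((n : ℤ) - 1)],
      ((List.range' 1 (n - 2)).map fun i : ℕ => (i : ℤ)).reverse, ?_, ?_, ?_⟩
    · rw [rowLetters, e]
      simp [hc]
    · simp only [List.mem_append, List.mem_map, List.mem_range'_1, List.mem_singleton]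
      rintro _ (⟨j, hj, rfl⟩ | rfl) <;> omega
    · simp only [List.mem_map, List.mem_reverse, List.mem_range'_1]
      rintro _ ⟨j, hj, rfl⟩; omega
  have inert : ∀ L : List ℤ, (∀ a ∈ L, y a = x a ∧ (x a ≠ 0 → a ≠ 0 ∧ a ≠ n ∧ a ≠ -n ∧
      (X = .D → a ≠ n - 1 ∧ a ≠ -(n - 1)))) → ∀ C,
      Raise X n n C (L.flatMap fun a => List.replicate (x a) a)
        (L.flatMap fun a => List.replicate (y a) a) C 0 := by
    intro L hL C
    have : (L.flatMap fun a => List.replicate (y a) a) = L.flatMap fun a => List.replicate (x a) a := by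
      apply List.flatMap_congr
      intro a ha
      rw [(hL a ha).1]
    rw [this]
    apply Raise.last_letters_inert (by omega)
    intro v hv
    obtain ⟨a, ha, hva⟩ := List.mem_flatMap.1 hv
    obtain ⟨h0, rfl⟩ := List.mem_replicate.1 hva
    exact (hL _ ha).2 h0
  have ht : (n : ℤ) - 1 ≤ turnTop X n := by cases X <;> simp only [turnTop] <;> omega
  have i1 := inert L1 (fun a ha => by
    have := h1 a ha
    refine ⟨hy a (by omega) (by omega), fun hx0 => ⟨by omega, by omega, by omega, fun hX => ?_⟩⟩
    refine ⟨by omega, ?_⟩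
    rintro rfl
    exact hx0 (hD hX).2.1) 0
  have i3 := inert L3 (fun a ha => by
    have := h3 a ha
    exact ⟨hy a (by omega) (by omega), fun hx0 => ⟨by omega, by omega, by omega,
      fun hX => ⟨by omega, by omega⟩⟩⟩)
  have r := Raise.replicate_minus hn (Raise.last_neg X (by omega : 2 ≤ n)) (x (-n))
  rw [rowWord_eq, rowWord_eq, eL]
  simp only [List.flatMap_append, List.flatMap_singleton]
  rw [e1, hy 0 (by omega) (by omega), h0]
  simp only [List.replicate_zero, List.nil_append]
  by_cases hX : X = .D
  · obtain ⟨d1, d2, d3⟩ := hD hX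
    subst hX
    simp only [turnTop] at r e2 hy
    rw [hc] at r e2 hy
    rw [hy n (by omega) (by omega), d1, d3, e2, d3]
    have := i1.append (by omega) (r.append (by omega) (i3 0))
    exact ⟨0, by simpa using this⟩
  · have hT : turnTop X n = n := by cases X <;> simp_all [turnTop]
    rw [hT] at r e2 hy
    obtain ⟨C, p⟩ : ∃ C, Raise X n n 0 (List.replicate (x n) (n : ℤ)) (List.replicate (x n) (n : ℤ)) C 0 :=
      ⟨_, Raise.of_sig (le_of_eq (wordSig_fst_eq_zero fun v hv => by
        rw [(List.mem_replicate.1 hv).2]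
        cases X with
        | A => rw [letterString_vecE_A (by omega), if_neg (by omega)]
        | B => rw [letterString_vecE_B (by omega), if_neg (by omega), if_neg (by omega)]
        | D => exact absurd rfl hX))⟩
    have i4 := inert [(n : ℤ) - 1] (fun a ha => by
      rw [List.mem_singleton] at ha
      exact ⟨hy a (by omega) (by omega), fun hx0 => ⟨by omega, by omega, by omega,
        fun hX' => absurd hX' hX⟩⟩) C
    have := i1.append (by omega) (r.append (by omega) (p.append (by omega) (i4.append (by omega)
      (i3 C))))
    refine ⟨C, ?_⟩
    rw [e2, Nat.add_comm (x n)]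
    simpa only [List.flatMap_singleton, List.replicate_add, List.append_assoc, Nat.zero_add,
      Nat.add_zero] using this

end

/-! ### The stages of the sweep on the one-row tableau -/

/-- The conditions on a one-row tableau implied by the highest weight condition. -/
structure LowRow (n r : ℕ) (x : ℤ → ℕ) : Prop where
  zero : x 0 = 0
  bar_odd : ∀ j : ℕ, j % 2 = 1 → x (-(j : ℤ)) = 0
  bar_gt : ∀ j : ℕ, r < j → x (-(j : ℤ)) = 0
  gt : ∀ j : ℕ, r + 1 < j → x j = 0
  gt_rank : ∀ j : ℕ, n < j → x j = 0
  pair : ∀ j : ℕ, 2 ≤ j → j % 2 = 0 → x j ≤ x (-(j : ℤ))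

/-- The row before the node `M` is used on the way up. -/
def upRow (x : ℤ → ℕ) (M : ℕ) (a : ℤ) : ℕ :=
  if a < 0 then if -a < M then 0 else if -a = M then evenBarSum x M else x a
  else if 2 ≤ a ∧ a % 2 = 0 ∧ a < M then x a + x (a + 1)
  else if 3 ≤ a ∧ a % 2 = 1 ∧ a ≤ M then 0 else x a

/-- The number of letters `j` and `j + 1` for even `j`. -/
def pairSum (x : ℤ → ℕ) (j : ℕ) : ℕ := if j % 2 = 0 then x j + x (j + 1) else 0

/-- The row after the node `M` has been used on the way down. -/
def downRow (x : ℤ → ℕ) (n r M : ℕ) (a : ℤ) : ℕ :=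
  if a ≤ 0 then 0 else if a = 1 then x 1 else if a < M then pairSum x a.toNat
  else if a = M then evenBarSum x r + ∑ i ∈ Finset.Icc M n, pairSum x i else 0

section

variable {X : AffineType} {n r m : ℕ} {x : ℤ → ℕ}

theorem evenBarSum_succ (x : ℤ → ℕ) {m : ℕ} (hm : 1 ≤ m) :
    evenBarSum x (m + 1) = evenBarSum x m + if m % 2 = 1 then x (-((m : ℤ) + 1)) else 0 := by
  have : Finset.Icc 2 (m + 1) = insert (m + 1) (Finset.Icc 2 m) := by
    ext j; simp; omega
  rw [evenBarSum, this, Finset.filter_insert]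
  by_cases h : m % 2 = 1
  · rw [if_pos (by rw [Nat.even_iff]; omega), if_pos h, Finset.sum_insert (by simp), evenBarSum]
    push_cast
    omega
  · rw [if_neg (by rw [Nat.even_iff]; omega), if_neg h, evenBarSum, Nat.add_zero]

theorem LowRow.evenBarSum_eq (h : LowRow n r x) (hm : r ≤ m) :
    evenBarSum x m = evenBarSum x r := by
  unfold evenBarSum
  symm
  apply Finset.sum_subset
  · intro j hj
    simp only [Finset.mem_filter, Finset.mem_Icc] at hj ⊢
    exact ⟨⟨hj.1.1, by omega⟩, hj.2⟩
  · intro j hj hj'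
    simp only [Finset.mem_filter, Finset.mem_Icc, not_and] at hj hj'
    exact h.bar_gt j (by by_contra hc; exact hj' ⟨hj.1.1, by omega⟩ hj.2)

theorem upRow_two (h : LowRow n r x) : upRow x 2 = x := by
  have h1 := h.bar_odd 1 (by norm_num)
  have h2 := evenBarSum_succ x (m := 1) le_rfl
  have h3 : evenBarSum x 1 = 0 := rfl
  funext a
  unfold upRow
  split_ifs with c1 c2 c3 c4 c5
  · obtain rfl : a = -1 := by omega
    exact h1.symm
  · obtain rfl : a = -2 := by omega
    rw [h2, h3, Nat.zero_add]; rfl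
  · rfl
  · omega
  · omega
  · rfl

theorem Raise.upRow (hn : 3 ≤ n) (h : LowRow n r x) (h1 : 2 ≤ m) (h2 : m < n) :
    ∃ C, Raise X n m 0 (rowWord n (upRow x m)) (rowWord n (KRcrystals.upRow x (m + 1))) C
      (evenBarSum x m + if m % 2 = 0 then x (m + 1) else 0) := by
  have a1 : KRcrystals.upRow x m (-m) = evenBarSum x m := by
    unfold KRcrystals.upRow; rw [if_pos (by omega), if_neg (by omega), if_pos (by omega)]
  have a2 : KRcrystals.upRow x m (-(m + 1)) = x (-(m + 1)) := by
    unfold KRcrystals.upRow; rw [if_pos (by omega), if_neg (by omega), if_neg (by omega)]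
  have a3 : KRcrystals.upRow x m (m + 1) = x (m + 1) := by
    unfold KRcrystals.upRow; rw [if_neg (by omega), if_neg (by omega), if_neg (by omega)]
  have a4 : KRcrystals.upRow x m m = if m % 2 = 0 then x m else 0 := by
    unfold KRcrystals.upRow; rw [if_neg (by omega), if_neg (by omega)]
    by_cases hm : m % 2 = 0
    · rw [if_neg (by omega), if_pos hm]
    · rw [if_pos (by omega), if_neg hm]
  have b1 : KRcrystals.upRow x (m + 1) (-m) = 0 := by
    unfold KRcrystals.upRow; rw [if_pos (by omega), if_pos (by omega)]
  have b2 : KRcrystals.upRow x (m + 1) (-(m + 1)) = evenBarSum x (m + 1) := by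
    unfold KRcrystals.upRow; rw [if_pos (by omega), if_neg (by omega), if_pos (by omega)]
  have b3 : KRcrystals.upRow x (m + 1) (m + 1) = if m % 2 = 0 then 0 else x (m + 1) := by
    unfold KRcrystals.upRow; rw [if_neg (by omega), if_neg (by omega)]
    by_cases hm : m % 2 = 0
    · rw [if_pos (by omega), if_pos hm]
    · rw [if_neg (by omega), if_neg hm]
  have b4 : KRcrystals.upRow x (m + 1) m = if m % 2 = 0 then x m + x (m + 1) else 0 := by
    unfold KRcrystals.upRow; rw [if_neg (by omega)]
    by_cases hm : m % 2 = 0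
    · rw [if_pos (by omega), if_pos hm]
    · rw [if_neg (by omega), if_pos (by omega), if_neg hm]
  have c1 := h.bar_odd (m + 1)
  have c2 := h.pair (m + 1) (by omega)
  push_cast at c1 c2
  have c3 := evenBarSum_succ x (m := m) (by omega)
  have key := Raise.row (X := X) (x := KRcrystals.upRow x m) (y := KRcrystals.upRow x (m + 1)) hn
    (by omega) h2 ?_ b1 ?_ ?_ ?_
  · rw [a1, a2, a3] at key
    convert key using 3
    split_ifs with hm
    · rw [c1 (by omega)]; rfl
    · have := c2 (by omega); omega
  · intro a p1 p2 p3 p4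
    unfold KRcrystals.upRow
    push_cast
    split_ifs <;> first | rfl | omega
  · rw [a1, a2, b2, c3]
    split_ifs with hm
    · rfl
    · rw [c1 (by omega)]
  · rw [a2, a3, b3]
    split_ifs with hm
    · rw [c1 (by omega)]; simp
    · rw [min_eq_left (c2 (by omega))]
  · rw [a2, a3, a4, b4]
    split_ifs with hm
    · rw [c1 (by omega)]; rfl
    · have := c2 (by omega); omega

theorem LowRow.pairSum_eq_zero (h : LowRow n r x) (hr : Even r) (hm : r + 1 ≤ m) : pairSum x m = 0 := by
  rw [Nat.even_iff] at hr
  unfold pairSum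
  split_ifs with hp
  · have h1 := h.gt m (by omega)
    have h2 := h.gt (m + 1) (by omega)
    push_cast at h2
    omega
  · rfl

theorem Raise.lastRow (hn : 3 ≤ n) (hr : HeightBound X n r) (he : Even r) (h : LowRow n r x) :
    ∃ C, Raise X n n 0 (rowWord n (KRcrystals.upRow x n)) (rowWord n (downRow x n r (turnTop X n))) C
      (evenBarSum x r * turnExp X) := by
  have a1 : KRcrystals.upRow x n (-n) = evenBarSum x r := by
    unfold KRcrystals.upRow; rw [if_pos (by omega), if_neg (by omega), if_pos (by omega)]
    exact h.evenBarSum_eq hr.le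
  have hev := Nat.even_iff.1 he
  have hD : X = .D → KRcrystals.upRow x n n = 0 ∧ KRcrystals.upRow x n (-(n - 1)) = 0 ∧
      KRcrystals.upRow x n (n - 1) = 0 := by
    rintro rfl
    simp only [HeightBound] at hr
    have h1 := h.gt n (by omega)
    refine ⟨?_, ?_, ?_⟩
    · unfold KRcrystals.upRow
      split_ifs <;> first | rfl | omega
    · unfold KRcrystals.upRow
      rw [if_pos (by omega), if_pos (by omega)]
    · unfold KRcrystals.upRow
      rw [if_neg (by omega)]
      split_ifs with c1 c2
      · have := h.gt (n - 1) (by omega)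
        rw [show ((n - 1 : ℕ) : ℤ) = n - 1 by omega] at this
        rw [this, show (n : ℤ) - 1 + 1 = n by omega, h1]
      · rfl
      · omega
  have hT : 2 ≤ turnTop X n ∧ turnTop X n ≤ n := by cases X <;> simp only [turnTop] <;> omega
  rw [← a1]
  refine Raise.row_last hn ?_ hD ?_ ?_ ?_
  · unfold KRcrystals.upRow
    rw [if_neg (by omega), if_neg (by omega), if_neg (by omega), h.zero]
  · intro a p1 p2
    rcases lt_or_ge a 0 with ha | ha
    · unfold KRcrystals.upRow downRow
      rw [if_pos (by omega), if_pos ha]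
      split_ifs with c1 c2
      · rfl
      · omega
      · have := h.bar_gt (-a).toNat (by have := hr.le; omega)
        rw [show (((-a).toNat : ℕ) : ℤ) = -a by omega, neg_neg] at this
        exact this.symm
    · obtain ⟨j, rfl⟩ : ∃ j : ℕ, a = j := ⟨a.toNat, by omega⟩
      rcases Nat.lt_or_ge (turnTop X n) j with hj | hj
      · have e1 : downRow x n r (turnTop X n) j = 0 := by
          unfold downRow
          rw [if_neg (by omega), if_neg (by omega), if_neg (by omega), if_neg (by omega)]
        rw [e1]
        by_cases hjn : n < j
        · unfold KRcrystals.upRow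
          rw [if_neg (by omega), if_neg (by omega), if_neg (by omega), h.gt_rank j hjn]
        · have hX : X = .D := by
            cases X <;> simp only [turnTop] at hj <;> first | rfl | omega
          obtain rfl : j = n := by subst hX; simp only [turnTop] at hj; omega
          exact (hD hX).1.symm
      · unfold KRcrystals.upRow downRow
        rw [if_neg (by omega : ¬ (j : ℤ) < 0)]
        rcases (by omega : j = 0 ∨ j = 1 ∨ 2 ≤ j) with rfl | rfl | h2
        · rw [if_pos (by simp), if_neg (by simp), if_neg (by simp)]
          exact h.zero.symm
        · simp
        · rw [if_neg (by omega), if_neg (by omega), if_pos (by omega)]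
          simp only [pairSum, Int.toNat_natCast]
          by_cases hp : j % 2 = 0
          · rw [if_pos hp, if_pos (by omega)]
          · rw [if_neg hp, if_neg (by omega), if_pos (by omega)]
  · unfold downRow
    rw [if_pos (by omega)]
  · have e1 : downRow x n r (turnTop X n) (turnTop X n) =
        evenBarSum x r + ∑ i ∈ Finset.Icc (turnTop X n) n, pairSum x i := by
      unfold downRow
      rw [if_neg (by omega), if_neg (by omega), if_neg (by omega), if_pos rfl]
    rw [e1, a1, Nat.add_comm]
    congr 1
    by_cases hX : X = .D
    · have d := hD hX
      subst hX
      simp only [turnTop, HeightBound] at hr ⊢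
      rw [show ((n - 1 : ℕ) : ℤ) = n - 1 by omega, d.2.2]
      apply Finset.sum_eq_zero
      intro i hi
      rw [Finset.mem_Icc] at hi
      exact h.pairSum_eq_zero he (by omega)
    · have hT : turnTop X n = n := by cases X <;> simp_all [turnTop]
      rw [hT, Finset.Icc_self, Finset.sum_singleton]
      unfold pairSum KRcrystals.upRow
      have := h.gt_rank (n + 1) (by omega)
      push_cast at this
      rw [if_neg (by omega : ¬ (n : ℤ) < 0), if_neg (by omega : ¬ (2 ≤ (n : ℤ) ∧ _))]
      by_cases hp : n % 2 = 0
      · rw [if_pos hp, if_neg (by omega), this, Nat.add_zero]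
      · rw [if_neg hp, if_pos (by omega)]

theorem Raise.downRow (hn : 3 ≤ n) (h1 : 2 ≤ m) (h2 : m < n) :
    ∃ C, Raise X n m 0 (rowWord n (downRow x n r (m + 1))) (rowWord n (KRcrystals.downRow x n r m)) C
      (evenBarSum x r + ∑ i ∈ Finset.Icc (m + 1) n, pairSum x i) := by
  have a0 : ∀ M, ∀ a : ℤ, a < 0 → KRcrystals.downRow x n r M a = 0 := by
    intro M a ha
    unfold KRcrystals.downRow; rw [if_pos (by omega)]
  have a1 : KRcrystals.downRow x n r (m + 1) (m + 1) =
      evenBarSum x r + ∑ i ∈ Finset.Icc (m + 1) n, pairSum x i := by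
    unfold KRcrystals.downRow
    rw [if_neg (by omega), if_neg (by omega), if_neg (by omega), if_pos (by omega)]
  have a2 : KRcrystals.downRow x n r (m + 1) m = pairSum x m := by
    unfold KRcrystals.downRow
    rw [if_neg (by omega), if_neg (by omega), if_pos (by omega), Int.toNat_natCast]
  have b1 : KRcrystals.downRow x n r m (m + 1) = 0 := by
    unfold KRcrystals.downRow
    rw [if_neg (by omega), if_neg (by omega), if_neg (by omega), if_neg (by omega)]
  have b2 : KRcrystals.downRow x n r m m =
      evenBarSum x r + ∑ i ∈ Finset.Icc m n, pairSum x i := by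
    unfold KRcrystals.downRow
    rw [if_neg (by omega), if_neg (by omega), if_neg (by omega), if_pos rfl]
  have hs : ∑ i ∈ Finset.Icc m n, pairSum x i =
      pairSum x m + ∑ i ∈ Finset.Icc (m + 1) n, pairSum x i := by
    have : Finset.Icc m n = insert m (Finset.Icc (m + 1) n) := by
      ext j; simp; omega
    rw [this, Finset.sum_insert (by simp)]
  have n1 := a0 (m + 1) (-m) (by omega)
  have n2 := a0 (m + 1) (-(m + 1)) (by omega)
  have key := Raise.row (X := X) (x := KRcrystals.downRow x n r (m + 1))
    (y := KRcrystals.downRow x n r m) hn (by omega) h2 ?_ (a0 _ _ (by omega)) ?_ ?_ ?_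
  · rw [n1, n2, a1, Nat.zero_add, Nat.sub_zero] at key
    exact key
  · intro a p1 p2 p3 p4
    unfold KRcrystals.downRow
    push_cast
    split_ifs <;> first | rfl | omega
  · rw [n1, n2, a0 _ _ (by omega)]
  · rw [b1, n2, Nat.min_zero]
  · rw [b2, a1, a2, n2, hs]
    omega

end

/-! ### Sweeps as words -/

/-- The nodes `2, …, n` and back to `2`, without `n - 1` in the descending part in type `D`. -/
def turnSweep (X : AffineType) (n : ℕ) (U V : ℕ → ℕ) : List (ℕ × ℕ) :=
  ((List.range' 2 (n - 1)).map fun m => (m, U m)) ++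
    (List.range' 2 (turnTop X n - 2)).reverse.map fun m => (m, V m)

section

variable {X : AffineType} {n r k l : ℕ}

theorem turnTop_le (X : AffineType) (n : ℕ) : turnTop X n ≤ n := by
  cases X <;> simp [turnTop]

theorem two_le_turnTop (X : AffineType) (hn : 3 ≤ n) : 2 ≤ turnTop X n := by
  cases X <;> simp only [turnTop] <;> omega

theorem HeightBound.le_turnTop (h : HeightBound X n r) : r ≤ turnTop X n := by
  cases X <;> simp only [turnTop, HeightBound] at * <;> omega

theorem pathWord_turnSweep (hn : 3 ≤ n) (U V : ℕ → ℕ) :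
    pathWord (turnSweep X n U V) = wordUp 2 n U ++ wordDown (turnTop X n - 1) 2 V := by
  have := two_le_turnTop X hn
  rw [turnSweep, pathWord_append, wordUp, wordDown, pathWord, pathWord, List.flatMap_map,
    List.flatMap_map, show n + 1 - 2 = n - 1 by omega,
    show turnTop X n - 1 + 1 - 2 = turnTop X n - 2 by omega]

theorem wordUp_congr {a b : ℕ} {s t : ℕ → ℕ} (h : ∀ i, a ≤ i → i ≤ b → s i = t i) :
    wordUp a b s = wordUp a b t := by
  unfold wordUp
  apply List.flatMap_congr
  intro i hi
  rw [List.mem_range'_1] at hi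
  rw [h i (by omega) (by omega)]

theorem wordDown_congr {a b : ℕ} {s t : ℕ → ℕ} (h : ∀ i, a ≤ i → i ≤ b → s i = t i) :
    wordDown b a s = wordDown b a t := by
  unfold wordDown
  apply List.flatMap_congr
  intro i hi
  rw [List.mem_reverse, List.mem_range'_1] at hi
  rw [h i (by omega) (by omega)]

theorem wordUp_append {a b c : ℕ} (s : ℕ → ℕ) (hb : 1 ≤ b) (h1 : a ≤ b) (h2 : b ≤ c + 1) :
    wordUp a (b - 1) s ++ wordUp b c s = wordUp a c s := by
  unfold wordUp
  rw [← List.flatMap_append]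
  congr 1
  have := List.range'_append_1 (s := a) (m := b - 1 + 1 - a) (n := c + 1 - b)
  rw [show a + (b - 1 + 1 - a) = b by omega,
    show b - 1 + 1 - a + (c + 1 - b) = c + 1 - a by omega] at this
  exact this

theorem wordDown_append {a b c : ℕ} (s : ℕ → ℕ) (hb : 1 ≤ b) (h1 : a ≤ b) (h2 : b ≤ c + 1) :
    wordDown c b s ++ wordDown (b - 1) a s = wordDown c a s := by
  unfold wordDown
  rw [← List.flatMap_append, ← List.reverse_append]
  congr 2
  have := List.range'_append_1 (s := a) (m := b - 1 + 1 - a) (n := c + 1 - b)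
  rw [show a + (b - 1 + 1 - a) = b by omega,
    show b - 1 + 1 - a + (c + 1 - b) = c + 1 - a by omega] at this
  exact this

theorem wordTurn_eq (X : AffineType) (n a b t : ℕ) :
    wordTurn X n a b t = wordUp a n (fun i => if i = n then t * turnExp X else t) ++
      wordDown (turnTop X n - 1) b (fun _ => t) := by
  cases X
  · simp [wordTurn, turnExp, turnTop, Nat.sub_sub]
  · simp [wordTurn, turnExp, turnTop, Nat.mul_comm]
  · simp [wordTurn, turnExp, turnTop]

/-- Raising a tableau, all of whose columns go around the turn, followed by a one-row tableau. -/
theorem raisePath_turnSweep {a : ℕ} {trail : List ℤ} {h : ℕ → ℕ} (hn : 3 ≤ n)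
    (htr : ∀ v ∈ trail, v = -1) (ha1 : 1 ≤ a) (ha : a ≤ 2)
    (hh : ∀ c < k, 2 ≤ h c ∧ HeightBound X n (h c)) {R R' : ℕ → List ℤ} {U V : ℕ → ℕ}
    (hup : ∀ m, 2 ≤ m → m < n → ∃ C s, Raise X n m 0 (R m) (R (m + 1)) C s ∧
      U m = (∑ c ∈ Finset.range k, (1 + if m < h c then 1 else 0)) + s)
    (hlast : ∃ C s, Raise X n n 0 (R n) (R' (turnTop X n)) C s ∧ U n = k * turnExp X + s)
    (hdown : ∀ m, 2 ≤ m → m < turnTop X n → ∃ C s, Raise X n m 0 (R' (m + 1)) (R' m) C s ∧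
      V m = (∑ c ∈ Finset.range k, if h c ≤ m then 1 else 0) + s) :
    RaisePath X n (turnSweep X n U V) ((concatCols k fun c => upColumn a trail (h c) 2) ++ R 2)
      ((concatCols k fun c => letterRange a (h c) ++ trail) ++ R' 2) := by
  have hT := two_le_turnTop X hn
  have hTn := turnTop_le X n
  have e : List.range' 2 (n - 1) = List.range' 2 (n - 2) ++ [n] := by
    rw [show n - 1 = n - 2 + 1 by omega, List.range'_1_concat, show 2 + (n - 2) = n by omega]
  rw [turnSweep, e, List.map_append]
  refine RaisePath.append (RaisePath.append (w' := (concatCols k fun c => upColumn a trail (h c) n) ++ R n)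
    ?_ (w'' := (concatCols k fun c => downColumn a trail (h c) (turnTop X n)) ++ R' (turnTop X n)) ?_) ?_
  · have := RaisePath.up (X := X) (n := n) (a := 2) (len := n - 2)
      (W := fun M => (concatCols k fun c => upColumn a trail (h c) M) ++ R M) (s := U) ?_
    · rwa [show 2 + (n - 2) = n by omega] at this
    · intro m h1 h2
      obtain ⟨C, s, h3, h4⟩ := hup m h1 (by omega)
      rw [h4]
      exact ⟨C, (Raise.upBlock hn htr ha h1 (by omega) h k).append (by omega) h3⟩
  · obtain ⟨C, s, h3, h4⟩ := hlast
    rw [List.map_singleton, h4]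
    exact RaisePath.single ((Raise.turnBlock hn htr ha1 hh).append (by omega) h3)
  · have := RaisePath.down (X := X) (n := n) (a := 2) (len := turnTop X n - 2)
      (W := fun M => (concatCols k fun c => downColumn a trail (h c) M) ++ R' M) (s := V) ?_
    · rw [show 2 + (turnTop X n - 2) = turnTop X n by omega] at this
      convert this using 2
      apply concatCols_congr
      intro c hc
      have := (hh c hc).1
      rw [downColumn_of_le (by omega) (by omega) this]
    · intro m h1 h2
      obtain ⟨C, s, h3, h4⟩ := hdown m h1 (by omega)
      rw [h4]
      exact ⟨C, (Raise.downBlock hn htr ha h1 (by omega) (fun c hc => (hh c hc).1)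
        (fun _ _ _ => rfl)).append (by omega) h3⟩

theorem RaisePath.length {L : List (ℕ × ℕ)} (hn : 3 ≤ n) {w w' : List ℤ} (h : RaisePath X n L w w') :
    w'.length = w.length := by
  induction L generalizing w with
  | nil => obtain rfl : w = w' := h; rfl
  | cons p L ih =>
    obtain ⟨v, C, h1, h2⟩ := h
    rw [ih h2, iterOpt_wordE_length (by omega) h1.iter]

theorem length_concatCols {f g : ℕ → List ℤ} (h : ∀ c < k, (f c).length = (g c).length) :
    (concatCols k f).length = (concatCols k g).length := by
  induction k with
  | zero => rfl
  | succ k ih =>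
    rw [concatCols, concatCols, List.length_append, List.length_append, h k (by omega),
      ih fun c hc => h c (by omega)]

theorem length_rowWord (n : ℕ) (x : ℤ → ℕ) :
    (rowWord n x).length = ∑ a ∈ Finset.Icc (-(n : ℤ)) n, x a := by
  have hnd : (rowLetters n).Nodup := (pairwise_rowLetters n).imp fun h => by
    rintro rfl; exact lt_irrefl _ h
  have : Finset.Icc (-(n : ℤ)) n = (rowLetters n).toFinset := by
    ext a; simp [mem_rowLetters]
  rw [this, List.sum_toFinset _ hnd, rowWord_eq, List.length_flatMap]
  simp

end

/-! ### The heights of the columns -/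

section

variable {n r k l : ℕ} {μ : ℕ → ℕ}

/-- The positive heights of the columns of the weight `μ` from right to left. -/
def tallHeights (r : ℕ) (μ : ℕ → ℕ) : List ℕ :=
  (List.range' 1 r).flatMap fun i => List.replicate (μ i) i

/-- The heights of the columns of the weight `μ̄` from left to right. -/
def barHeight (r k : ℕ) (μ : ℕ → ℕ) (c : ℕ) : ℕ :=
  if k ≤ c then 1 else (tallHeights r μ).reverse.getD c 2

theorem sum_map_tallHeights (r : ℕ) (μ g : ℕ → ℕ) :
    ((tallHeights r μ).map g).sum = ∑ i ∈ Finset.range r, μ (i + 1) * g (i + 1) := by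
  induction r with
  | zero => rfl
  | succ r ih =>
    rw [tallHeights] at ih ⊢
    rw [List.range'_1_concat, List.flatMap_append, List.map_append, List.sum_append, ih,
      Finset.sum_range_succ, Nat.add_comm 1 r]
    simp

theorem length_tallHeights (hμ : IsKRWeight r k μ) : (tallHeights r μ).length + μ 0 = k := by
  have := sum_map_tallHeights r μ fun _ => 1
  rw [← hμ.1, Finset.sum_range_succ']
  simpa using this

theorem mem_tallHeights (hμ : IsKRWeight r k μ) (he : Even r) {v : ℕ} (hv : v ∈ tallHeights r μ) :
    2 ≤ v ∧ v ≤ r ∧ v % 2 = 0 := by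
  obtain ⟨i, hi, hv⟩ := List.mem_flatMap.1 hv
  obtain ⟨h0, rfl⟩ := List.mem_replicate.1 hv
  have := hμ.2 _ h0
  rw [Nat.even_iff] at he
  rw [List.mem_range'_1] at hi
  omega

theorem pairwise_tallHeights (r : ℕ) (μ : ℕ → ℕ) : (tallHeights r μ).Pairwise (· ≤ ·) := by
  rw [tallHeights, List.pairwise_flatMap]
  refine ⟨fun a _ => List.pairwise_replicate.2 (Or.inr le_rfl), ?_⟩
  refine List.Pairwise.imp (R := (· < ·)) ?_ List.pairwise_lt_range'
  intro a b hab c hc d hd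
  obtain ⟨_, rfl⟩ := List.mem_replicate.1 hc
  obtain ⟨_, rfl⟩ := List.mem_replicate.1 hd
  exact hab.le

theorem map_barHeight (hμ : IsKRWeight r k μ) :
    (List.range k).map (barHeight r k μ) = (tallHeights r μ).reverse ++ List.replicate (μ 0) 2 := by
  have hl := length_tallHeights hμ
  apply List.ext_getElem
  · simp; omega
  · intro c h1 h2
    simp only [List.length_map, List.length_range] at h1
    rw [List.getElem_map, List.getElem_range, barHeight, if_neg (by omega), List.getD_eq_getElem?_getD]
    by_cases hc : c < (tallHeights r μ).length
    · rw [List.getElem_append_left (by simpa using hc), List.getElem?_eq_getElem (by simpa using hc)]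
      rfl
    · rw [List.getElem_append_right (by simpa using hc), List.getElem?_eq_none (by simpa using hc)]
      simp

theorem barHeight_of_ge (hμ : IsKRWeight r k μ) {c : ℕ} (h1 : k - μ 0 ≤ c) (h2 : c < k) :
    barHeight r k μ c = 2 := by
  have hl := length_tallHeights hμ
  rw [barHeight, if_neg (by omega), List.getD_eq_default _ _ (by simp; omega)]

theorem columnHeights_barHeight (hμ : IsKRWeight r k μ) (he : Even r) (hr : 1 ≤ r) :
    ColumnHeights k r (barHeight r k μ) := by
  have hev := Nat.even_iff.1 he
  have hval : ∀ c < k, 2 ≤ barHeight r k μ c ∧ barHeight r k μ c ≤ r ∧ barHeight r k μ c % 2 = 0 := by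
    intro c hc
    have : barHeight r k μ c ∈ (List.range k).map (barHeight r k μ) :=
      List.mem_map_of_mem (List.mem_range.2 hc)
    rw [map_barHeight hμ, List.mem_append, List.mem_reverse, List.mem_replicate] at this
    rcases this with h | ⟨_, h⟩
    · exact mem_tallHeights hμ he h
    · rw [h]; omega
  have hp : ((List.range k).map (barHeight r k μ)).Pairwise (· ≥ ·) := by
    rw [map_barHeight hμ, List.pairwise_append]
    refine ⟨List.pairwise_reverse.2 (pairwise_tallHeights r μ),
      List.pairwise_replicate.2 (Or.inr le_rfl), ?_⟩
    intro a ha b hb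
    rw [(List.mem_replicate.1 hb).2]
    exact (mem_tallHeights hμ he (List.mem_reverse.1 ha)).1
  have hone : ∀ c, k ≤ c → barHeight r k μ c = 1 := fun c hc => if_pos hc
  refine ⟨?_, fun c hc => (hval c hc).2.2, fun c hc => (hval c hc).1, ?_, hone⟩
  · intro c d hcd
    rcases Nat.lt_or_ge d k with hd | hd
    · rcases Nat.eq_or_lt_of_le hcd with rfl | hlt
      · exact le_rfl
      · have := List.pairwise_iff_getElem.1 hp c d (by simp; omega) (by simp; omega) hlt
        simpa using this
    · rw [hone d hd]
      rcases Nat.lt_or_ge c k with hc | hc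
      · have := (hval c hc).1; omega
      · rw [hone c hc]
  · intro c
    rcases Nat.lt_or_ge c k with hc | hc
    · exact (hval c hc).2.1
    · rw [hone c hc]; exact hr

theorem highestTableau_columns (r : ℕ) (μ : ℕ → ℕ) :
    ((List.range (r + 1)).flatMap fun i => List.replicate (μ i) (letterRange 1 i)) =
      List.replicate (μ 0) [] ++ (tallHeights r μ).map (letterRange 1) := by
  rw [List.range_eq_range', List.range'_succ, List.flatMap_cons, tallHeights, List.map_flatMap]
  simp only [List.map_replicate]
  rfl

theorem highestTableau_eq (hμ : IsKRWeight r k μ) :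
    highestTableau r μ = colTableau k (zeroColumn (barHeight r k μ) k (μ 0)) := by
  have hl := length_tallHeights hμ
  rw [highestTableau, highestTableau_columns, colTableau]
  congr 1
  rw [← List.reverse_eq_iff, List.reverse_append, List.reverse_replicate]
  symm
  apply List.ext_getElem
  · simp; omega
  · intro c h1 h2
    simp only [List.length_map, List.length_range] at h1
    rw [List.getElem_map, List.getElem_range, zeroColumn, if_neg (by omega)]
    by_cases hc : c < (tallHeights r μ).length
    · rw [List.getElem_append_left (by simpa using hc), if_pos (by omega), barHeight,
        if_neg (by omega), List.getD_eq_getElem _ _ (by simpa using hc)]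
      simp
    · rw [List.getElem_append_right (by simpa using hc), if_neg (by omega),
        barHeight_of_ge hμ (by omega) h1, letterRange_of_lt (by omega)]
      simp

theorem tallHeights_muBar (hμ : IsKRWeight r k μ) (he : Even r) (hr : 1 ≤ r) :
    tallHeights r (muBar μ) = List.replicate (μ 0) 2 ++ tallHeights r μ := by
  have hev := Nat.even_iff.1 he
  have h1 : μ 1 = 0 := by
    by_contra h
    have := (hμ.2 1 h).2
    omega
  obtain ⟨q, rfl⟩ : ∃ q, r = q + 1 + 1 := ⟨r - 2, by omega⟩
  simp only [tallHeights, List.range'_succ, List.flatMap_cons]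
  have h3 : ((List.range' (1 + 1 + 1) q).flatMap fun i => List.replicate (muBar μ i) i) =
      (List.range' (1 + 1 + 1) q).flatMap fun i => List.replicate (μ i) i := by
    apply List.flatMap_congr
    intro i hi
    rw [List.mem_range'_1] at hi
    rw [muBar, if_neg (by omega), if_neg (by omega)]
  rw [h3]
  simp [muBar, h1, Nat.add_comm (μ 2)]
  rw [List.replicate_add, List.append_assoc]

theorem highestTableau_muBar_eq (hμ : IsKRWeight r k μ) (he : Even r) (hr : 1 ≤ r) :
    highestTableau r (muBar μ) = colTableau k fun c => letterRange 1 (barHeight r k μ c) := by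
  have h1 : (List.range k).map (fun c => letterRange 1 (barHeight r k μ c)) =
      ((List.range k).map (barHeight r k μ)).map (letterRange 1) := by simp
  rw [highestTableau, highestTableau_columns, colTableau, h1, map_barHeight hμ,
    tallHeights_muBar hμ he hr]
  simp [muBar]

theorem isKRWeight_muBar (hμ : IsKRWeight r k μ) (he : Even r) (hr : 1 ≤ r) :
    IsKRWeight r k (muBar μ) := by
  have hev := Nat.even_iff.1 he
  constructor
  · have h1 : ∀ i, muBar μ i + (if i = 0 then μ 0 else 0) = μ i + if i = 2 then μ 0 else 0 := by
      intro i
      unfold muBar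
      split_ifs <;> subst_vars <;> omega
    have h2 := Finset.sum_congr (rfl : Finset.range (r + 1) = _) fun i _ => h1 i
    rw [Finset.sum_add_distrib, Finset.sum_add_distrib, Finset.sum_ite_eq', Finset.sum_ite_eq',
      if_pos (by simp), if_pos (by simp; omega), hμ.1] at h2
    omega
  · intro i hi
    unfold muBar at hi
    split_ifs at hi with h0 h2
    · exact absurd rfl hi
    · omega
    · exact hμ.2 i hi

theorem evenSum_eq (hμ : IsKRWeight r k μ) (he : Even r) (a b : ℕ) :
    evenSum μ a b = ∑ i ∈ Finset.Icc a b, μ i := by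
  refine Finset.sum_filter_of_ne fun i _ h => ?_
  have := (hμ.2 i h).2
  rw [Nat.even_iff] at he ⊢
  omega

theorem evenSum_zero_eq (hμ : IsKRWeight r k μ) (he : Even r) (m : ℕ) :
    evenSum μ 0 m = ∑ i ∈ Finset.range (r + 1), if i ≤ m then μ i else 0 := by
  rw [evenSum_eq hμ he, ← Finset.sum_filter]
  symm
  apply Finset.sum_subset
  · intro i hi
    simp only [Finset.mem_filter, Finset.mem_range, Finset.mem_Icc] at hi ⊢
    omega
  · intro i hi hi'
    simp only [Finset.mem_filter, Finset.mem_range, Finset.mem_Icc] at hi hi'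
    by_contra h
    have := (hμ.2 i h).1
    omega

theorem evenSum_add_evenSum (hμ : IsKRWeight r k μ) (he : Even r) (m : ℕ) :
    evenSum μ 0 m + evenSum μ (m + 1) r = k := by
  have h : evenSum μ (m + 1) r = ∑ i ∈ Finset.range (r + 1), if i ≤ m then 0 else μ i := by
    rw [evenSum_eq hμ he]
    have : Finset.Icc (m + 1) r = (Finset.range (r + 1)).filter fun i => ¬ i ≤ m := by
      ext i
      simp only [Finset.mem_filter, Finset.mem_range, Finset.mem_Icc]
      omega
    rw [this, Finset.sum_filter]
    apply Finset.sum_congr rfl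
    intro i _
    split_ifs <;> rfl
  rw [evenSum_zero_eq hμ he, h, ← Finset.sum_add_distrib, ← hμ.1]
  apply Finset.sum_congr rfl
  intro i _
  split_ifs <;> simp

theorem sum_barHeight_le (hμ : IsKRWeight r k μ) (he : Even r) {m : ℕ} (hm : 2 ≤ m) :
    (∑ c ∈ Finset.range k, if barHeight r k μ c ≤ m then 1 else 0) = evenSum μ 0 m := by
  have h1 : (∑ c ∈ Finset.range k, if barHeight r k μ c ≤ m then 1 else 0) =
      (((List.range k).map (barHeight r k μ)).map fun v => if v ≤ m then 1 else 0).sum := by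
    rw [List.map_map, ← List.toFinset_range, List.sum_toFinset _ List.nodup_range]
    rfl
  rw [h1, map_barHeight hμ, List.map_append, List.sum_append, List.map_reverse, List.sum_reverse,
    sum_map_tallHeights, evenSum_zero_eq hμ he, Finset.sum_range_succ']
  simp [hm]

theorem sum_barHeight_gt (hμ : IsKRWeight r k μ) (he : Even r) {m : ℕ} (hm : 2 ≤ m) :
    (∑ c ∈ Finset.range k, (1 + if m < barHeight r k μ c then 1 else 0)) + evenSum μ 0 m = 2 * k := by
  rw [← sum_barHeight_le hμ he hm, ← Finset.sum_add_distrib]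
  have : ∀ c, (1 + if m < barHeight r k μ c then 1 else 0) + (if barHeight r k μ c ≤ m then 1 else 0)
      = 2 := by
    intro c; split_ifs <;> omega
  simp only [this]
  simp [Nat.mul_comm]

theorem evenSum_zero_le (hμ : IsKRWeight r k μ) (he : Even r) (m : ℕ) : evenSum μ 0 m ≤ k := by
  have := evenSum_add_evenSum hμ he m
  omega

theorem evenSum_succ_of_odd {m : ℕ} (hm : m % 2 = 1) : evenSum μ 0 m = evenSum μ 0 (m - 1) := by
  unfold evenSum
  congr 1
  ext i
  simp only [Finset.mem_filter, Finset.mem_Icc, Nat.even_iff]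
  omega

theorem evenSum_of_odd {m b : ℕ} (hm : m % 2 = 1) : evenSum μ m b = evenSum μ (m + 1) b := by
  unfold evenSum
  congr 1
  ext i
  simp only [Finset.mem_filter, Finset.mem_Icc, Nat.even_iff]
  omega

end

/-! ### The exponents of the word -/

/-- The row obtained from `x` by applying `e_0` to letters `1`. -/
def shiftRow (x : ℤ → ℕ) (s : ℕ) (a : ℤ) : ℕ :=
  if a = 1 then x 1 - s else if a = -2 then x (-2) + s else x a

section

variable {X : AffineType} {n r k l : ℕ} {μ : ℕ → ℕ} {x : ℤ → ℕ}

theorem LowRow.shiftRow (h : LowRow n r x) (hr : 2 ≤ r) (hn : 3 ≤ n) (s : ℕ) :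
    LowRow n r (shiftRow x s) := by
  refine ⟨?_, ?_, ?_, ?_, ?_, ?_⟩
  · rw [KRcrystals.shiftRow, if_neg (by omega), if_neg (by omega), h.zero]
  · intro j hj
    rw [KRcrystals.shiftRow, if_neg (by omega), if_neg (by omega), h.bar_odd j hj]
  · intro j hj
    rw [KRcrystals.shiftRow, if_neg (by omega), if_neg (by omega), h.bar_gt j hj]
  · intro j hj
    rw [KRcrystals.shiftRow, if_neg (by omega), if_neg (by omega), h.gt j hj]
  · intro j hj
    rw [KRcrystals.shiftRow, if_neg (by omega), if_neg (by omega), h.gt_rank j hj]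
  · intro j hj hj'
    have := h.pair j hj hj'
    rw [KRcrystals.shiftRow, if_neg (by omega), if_neg (by omega), KRcrystals.shiftRow,
      if_neg (by omega)]
    split_ifs with h2
    · obtain rfl : j = 2 := by omega
      exact this.trans (Nat.le_add_right _ _)
    · exact this

theorem evenBarSum_shiftRow (s : ℕ) {m : ℕ} (hm : 2 ≤ m) :
    evenBarSum (shiftRow x s) m = evenBarSum x m + s := by
  induction m, hm using Nat.le_induction with
  | base =>
    have h3 : ∀ y, evenBarSum y 1 = 0 := fun y => rfl
    rw [evenBarSum_succ _ le_rfl, evenBarSum_succ _ le_rfl, h3, h3]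
    simp [shiftRow]
  | succ m hm ih =>
    rw [evenBarSum_succ _ (by omega), evenBarSum_succ _ (by omega), ih]
    have h1 : shiftRow x s (-((m : ℤ) + 1)) = x (-((m : ℤ) + 1)) := by
      rw [shiftRow, if_neg (by omega), if_neg (by omega)]
    rw [h1]
    omega

theorem evenBarSum_of_odd {m : ℕ} (hm : 3 ≤ m) (ho : m % 2 = 1) :
    evenBarSum x m = evenBarSum x (m - 1) := by
  obtain ⟨p, rfl⟩ : ∃ p, m = p + 1 := ⟨m - 1, by omega⟩
  rw [evenBarSum_succ _ (by omega), if_neg (by omega)]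
  simp

theorem pairSum_shiftRow (s : ℕ) {m : ℕ} (hm : 2 ≤ m) : pairSum (shiftRow x s) m = pairSum x m := by
  have h1 : shiftRow x s m = x m := by
    rw [shiftRow, if_neg (by omega), if_neg (by omega)]
  have h2 : shiftRow x s (m + 1) = x (m + 1) := by
    rw [shiftRow, if_neg (by omega), if_neg (by omega)]
  rw [pairSum, pairSum, h1, h2]

/-- Sums of pairs as sums of coordinates. -/
theorem sum_pairSum (h : LowRow n r x) (he : Even r) (hrn : r ≤ n) {m : ℕ} (hm : m < r) :
    ∑ i ∈ Finset.Icc (m + 1) n, pairSum x i =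
      ∑ j ∈ Finset.Icc (2 * (m / 2) + 2) (r + 1), x (j : ℤ) := by
  have hev := Nat.even_iff.1 he
  have key : ∀ p d : ℕ, ∑ i ∈ Finset.Ico (2 * p) (2 * (p + d)), pairSum x i =
      ∑ i ∈ Finset.Ico (2 * p) (2 * (p + d)), x (i : ℤ) := by
    intro p d
    induction d with
    | zero => simp
    | succ d ih =>
      rw [show 2 * (p + (d + 1)) = 2 * (p + d) + 1 + 1 by ring,
        Finset.sum_Ico_succ_top (by omega), Finset.sum_Ico_succ_top (by omega), ih,
        Finset.sum_Ico_succ_top (by omega), Finset.sum_Ico_succ_top (by omega)]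
      simp only [pairSum]
      rw [if_pos (by omega), if_neg (by omega)]
      push_cast
      omega
  have e1 : ∑ i ∈ Finset.Icc (m + 1) n, pairSum x i =
      ∑ i ∈ Finset.Ico (2 * (m / 2) + 2) (r + 2), pairSum x i := by
    have f1 : ∑ i ∈ Finset.Icc (m + 1) (n + 1), pairSum x i = ∑ i ∈ Finset.Icc (m + 1) n, pairSum x i := by
      symm
      apply Finset.sum_subset
      · exact Finset.Icc_subset_Icc le_rfl (by omega)
      · intro i hi hi'
        rw [Finset.mem_Icc] at hi hi'
        exact h.pairSum_eq_zero he (by omega)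
    rw [← f1]
    symm
    apply Finset.sum_subset
    · intro i hi
      rw [Finset.mem_Icc]
      rw [Finset.mem_Ico] at hi
      omega
    · intro i hi hi'
      rw [Finset.mem_Icc] at hi
      rw [Finset.mem_Ico] at hi'
      by_cases hir : r + 1 ≤ i
      · exact h.pairSum_eq_zero he hir
      · rw [pairSum, if_neg (by omega)]
  rw [e1]
  have := key (m / 2 + 1) (r / 2 - m / 2)
  rw [show 2 * (m / 2 + 1) = 2 * (m / 2) + 2 by ring,
    show 2 * (m / 2 + 1 + (r / 2 - m / 2)) = r + 2 by omega] at this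
  rw [this]
  apply Finset.sum_congr _ fun _ _ => rfl
  ext i
  rw [Finset.mem_Ico, Finset.mem_Icc]
  omega

theorem pathWord_sweep {b d t : ℕ} {s v : ℕ → ℕ} (hn : 3 ≤ n) (h1 : 2 ≤ b) (h2 : b ≤ n + 1)
    (h3 : 2 ≤ d) (h4 : d ≤ turnTop X n) :
    pathWord (turnSweep X n (fun i => if i < b then s i else if i = n then t * turnExp X else t)
        (fun i => if i < d then v i else t)) =
      wordUp 2 (b - 1) s ++ wordTurn X n b d t ++ wordDown (d - 1) 2 v := by
  rw [pathWord_turnSweep hn, wordTurn_eq, ← wordUp_append _ (by omega) h1 h2,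
    ← wordDown_append (c := turnTop X n - 1) _ (by omega) h3 (by omega)]
  simp only [List.append_assoc]
  congr 1
  · exact wordUp_congr fun i _ _ => if_pos (by omega)
  congr 1
  · exact wordUp_congr fun i _ _ => if_neg (by omega)
  congr 1
  · exact wordDown_congr fun i _ _ => if_neg (by omega)
  · exact wordDown_congr fun i _ _ => if_pos (by omega)

theorem turnSweep_ne_zero {U V : ℕ → ℕ} : ∀ p ∈ turnSweep X n U V, p.1 ≠ 0 := by
  intro p hp
  simp only [turnSweep, List.mem_append, List.mem_map, List.mem_reverse, List.mem_range'_1] at hp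
  rcases hp with ⟨i, hi, rfl⟩ | ⟨i, hi, rfl⟩ <;> simp only <;> omega

theorem barHeight_bounds (hμ : IsKRWeight r k μ) (he : Even r) (hr : 2 ≤ r) (hb : HeightBound X n r) :
    ∀ c < k, 2 ≤ barHeight r k μ c ∧ HeightBound X n (barHeight r k μ c) := by
  have H := columnHeights_barHeight hμ he (by omega)
  exact fun c hc => ⟨H.two_le c hc, hb.mono (H.le c)⟩

theorem sExp_eq (hμ : IsKRWeight r k μ) (he : Even r) {m : ℕ} (h1 : 2 ≤ m) :
    sExp k μ x m = (∑ c ∈ Finset.range k, (1 + if m < barHeight r k μ c then 1 else 0)) +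
      (evenBarSum x m + cExp μ x + if m % 2 = 0 then x (m + 1) else 0) := by
  have h3 := sum_barHeight_gt hμ he h1
  have h4 := evenSum_zero_le hμ he m
  rw [sExp]
  by_cases hm : m % 2 = 0
  · rw [if_pos (Nat.even_iff.2 hm), if_pos hm, sEven]
    omega
  · have h5 : evenSum μ 0 m = evenSum μ 0 (m - 1) := evenSum_succ_of_odd (by omega)
    have h6 := evenBarSum_of_odd (x := x) (m := m) (by omega) (by omega)
    rw [if_neg (by rwa [Nat.even_iff]), if_neg hm, sEven,
      show ((m - 1 : ℕ) : ℤ) + 1 = m by omega]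
    omega

theorem alphaExp_eq (hμ : IsKRWeight r k μ) (he : Even r) (hr : 2 ≤ r) {m : ℕ} (h1 : r ≤ m) :
    alphaExp r k μ x = (∑ c ∈ Finset.range k, (1 + if m < barHeight r k μ c then 1 else 0)) +
      (evenBarSum x r + cExp μ x) ∧
    alphaExp r k μ x = (∑ c ∈ Finset.range k, if barHeight r k μ c ≤ m then 1 else 0) +
      (evenBarSum x r + cExp μ x) := by
  have h2 := sum_barHeight_le hμ he (show 2 ≤ m by omega)
  have h3 := sum_barHeight_gt hμ he (show 2 ≤ m by omega)
  have h4 := evenSum_add_evenSum hμ he m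
  have h5 : evenSum μ (m + 1) r = 0 := by
    rw [evenSum, Finset.Icc_eq_empty (by omega)]; rfl
  rw [alphaExp]
  omega

theorem sBar_eq (hμ : IsKRWeight r k μ) (he : Even r) (hb : HeightBound X n r)
    (hx : LowRow n r x) {m : ℕ} (h1 : 2 ≤ m) (h2 : m < r) :
    sBar r k μ x m = (∑ c ∈ Finset.range k, if barHeight r k μ c ≤ m then 1 else 0) +
      (evenBarSum x r + cExp μ x + ∑ i ∈ Finset.Icc (m + 1) n, pairSum x i) := by
  have h3 := sum_barHeight_le hμ he h1
  have h4 := evenSum_add_evenSum hμ he m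
  have h5 : evenSum μ (m + 1) r = evenSum μ (2 * (m / 2) + 2) r := by
    rcases Nat.mod_two_eq_zero_or_one m with h | h
    · rw [evenSum_of_odd (by omega)]; congr 1; omega
    · congr 1; omega
  rw [sBar, alphaExp, sum_pairSum hx he hb.le h2, h3]
  omega

/-- The path of the first half of the word. -/
theorem raisePath_first (hμ : IsKRWeight r k μ) (he : Even r) (hr : 2 ≤ r) (hb : HeightBound X n r) (hn : 3 ≤ n)
    (hx : LowRow n r x) : ∃ L : List (ℕ × ℕ), (∀ p ∈ L, p.1 ≠ 0) ∧
    pathWord L = wordB31 r k μ x X n ∧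
    RaisePath X n L ((concatCols k fun c => letterRange 3 (barHeight r k μ c) ++ [-2, -1]) ++
        rowWord n (shiftRow x (cExp μ x)))
      ((concatCols k fun c => letterRange 2 (barHeight r k μ c) ++ [-1]) ++
        rowWord n (downRow (shiftRow x (cExp μ x)) n r 2)) := by
  have hh := barHeight_bounds hμ he hr hb
  have hT := hb.le_turnTop
  have hy := hx.shiftRow hr hn (cExp μ x)
  refine ⟨_, turnSweep_ne_zero, pathWord_sweep (s := sExp k μ x) (v := sBar r k μ x)
    (t := alphaExp r k μ x) (b := r + 1) (d := r) hn (by omega) (by have := hb.le; omega) hr hT, ?_⟩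
  have := raisePath_turnSweep (X := X) (n := n) (k := k) (a := 2) (trail := [-1])
    (h := barHeight r k μ) (R := fun m => rowWord n (upRow (shiftRow x (cExp μ x)) m))
    (R' := fun m => rowWord n (downRow (shiftRow x (cExp μ x)) n r m))
    (U := fun i => if i < r + 1 then sExp k μ x i else
      if i = n then alphaExp r k μ x * turnExp X else alphaExp r k μ x)
    (V := fun i => if i < r then sBar r k μ x i else alphaExp r k μ x)
    hn (by simp) (by omega) le_rfl hh ?_ ?_ ?_
  · rw [upRow_two hy] at this
    convert this using 2
    apply concatCols_congr
    intro c hc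
    have := (hh c hc).1
    rw [upColumn, min_eq_right this, gapRange, letterRange_of_lt (a := 2) (by norm_num)]
    simp
  · intro m h1 h2
    obtain ⟨C, h⟩ := Raise.upRow (X := X) hn hy h1 h2
    refine ⟨C, _, h, ?_⟩
    rw [evenBarSum_shiftRow _ h1]
    have hs : shiftRow x (cExp μ x) (m + 1) = x (m + 1) := by
      rw [shiftRow, if_neg (by omega), if_neg (by omega)]
    rw [hs]
    by_cases hm : m < r + 1
    · rw [if_pos hm, sExp_eq hμ he h1]
    · have hz := hx.gt (m + 1) (by omega)
      push_cast at hz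
      rw [if_neg hm, if_neg (by omega), hz, ite_self, hx.evenBarSum_eq (by omega)]
      exact (alphaExp_eq hμ he hr (by omega)).1
  · obtain ⟨C, h⟩ := Raise.lastRow (X := X) hn hb he hy
    refine ⟨C, _, h, ?_⟩
    rw [evenBarSum_shiftRow _ hr, ← Nat.add_mul]
    have ha : alphaExp r k μ x = k + (evenBarSum x r + cExp μ x) := by rw [alphaExp]; omega
    by_cases hm : n < r + 1
    · obtain rfl : n = r := by have := hb.le; omega
      obtain rfl : X = .A := by
        cases X <;> simp only [HeightBound] at hb <;> first | rfl | omega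
      have h1 := sExp_eq (x := x) hμ he hr
      have h2 := (alphaExp_eq (x := x) hμ he hr le_rfl).1
      have h3 := hx.gt_rank (n + 1) (by omega)
      push_cast at h3
      rw [h3, ite_self] at h1
      rw [if_pos hm, h1, Nat.add_zero, ← h2, ha]
      simp [turnExp]
    · rw [if_neg hm, if_pos rfl, ha]
  · intro m h1 h2
    obtain ⟨C, h⟩ := Raise.downRow (X := X) (x := shiftRow x (cExp μ x)) (r := r) hn h1
      (lt_of_lt_of_le h2 (turnTop_le X n))
    refine ⟨C, _, h, ?_⟩
    rw [evenBarSum_shiftRow _ hr, Finset.sum_congr rfl fun i hi =>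
      pairSum_shiftRow (x := x) (cExp μ x) (m := i) (by rw [Finset.mem_Icc] at hi; omega)]
    by_cases hm : m < r
    · rw [if_pos hm, sBar_eq hμ he hb hx h1 hm]
    · rw [if_neg hm, Finset.sum_eq_zero fun i hi =>
        hx.pairSum_eq_zero he (by rw [Finset.mem_Icc] at hi; omega)]
      exact (alphaExp_eq hμ he hr (by omega)).2

theorem mem_rowWord {v : ℤ} (h : v ∈ rowWord n x) : x v ≠ 0 := by
  rw [rowWord_eq] at h
  obtain ⟨a, _, hv⟩ := List.mem_flatMap.1 h
  obtain ⟨h0, rfl⟩ := List.mem_replicate.1 hv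
  exact h0

/-- The path of the second half of the word. -/
theorem raisePath_second (hμ : IsKRWeight r k μ) (he : Even r) (hr : 2 ≤ r) (hb : HeightBound X n r)
    (hn : 3 ≤ n) {z : ℤ → ℕ} (hz : ∀ a : ℤ, a ≠ 1 → a ≠ 2 → z a = 0) (hz1 : z 1 + cExp μ x = x 1)
    (hl : z 1 + z 2 = l) (hx1 : x 1 ≤ l) : ∃ L : List (ℕ × ℕ), (∀ p ∈ L, p.1 ≠ 0) ∧
    pathWord L = wordB32 r k l μ x X n ∧
    RaisePath X n L ((concatCols k fun c => letterRange 2 (barHeight r k μ c) ++ [-1]) ++ rowWord n z)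
      ((concatCols k fun c => letterRange 1 (barHeight r k μ c)) ++ rowWord n (Pi.single 1 l)) := by
  have hh := barHeight_bounds hμ he hr hb
  have hT := hb.le_turnTop
  have hone : ∀ v ∈ rowWord n (Pi.single 1 l), v = 1 := by
    intro v hv
    by_contra h
    exact mem_rowWord hv (Pi.single_eq_of_ne h _)
  have e1 : wordB32 r k l μ x X n = List.replicate (sBarBar k l μ x 1) 1 ++
      (wordUp 2 (r - 1) (sBarBar k l μ x) ++ wordTurn X n r r k ++
        wordDown (r - 1) 2 (sBarBarBar r k μ)) := by
    rw [wordB32, ← wordUp_append (b := 2) _ (by omega) (by omega) (by omega),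
      ← wordDown_append (b := 2) (a := 1) _ (by omega) (by omega) (by omega)]
    simp [wordUp, wordDown, sBarBarBar]
  have first : ∃ C, Raise X n 1 0
      ((concatCols k fun c => letterRange 2 (barHeight r k μ c) ++ [-1]) ++ rowWord n z)
      ((concatCols k fun c => upColumn 1 [] (barHeight r k μ c) 2) ++ rowWord n (Pi.single 1 l)) C
      (sBarBar k l μ x 1) := by
    have p1 := Raise.concat_zero (X := X) (n := n) (i := 1) (by omega) (k := k)
      (f := fun c => letterRange 2 (barHeight r k μ c) ++ [-1])
      (g := fun c => upColumn 1 [] (barHeight r k μ c) 2) (fun _ => 2) 0 (fun c hc => by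
        have h2 := (hh c hc).1
        have q1 : Raise X n 1 0 (letterRange 2 (barHeight r k μ c))
            ((1 : ℤ) :: letterRange 3 (barHeight r k μ c)) 0 1 :=
          Raise.range_minus le_rfl (by omega) h2
        have q2 : Raise X n 1 0 [-1] [-2] 0 1 := Raise.neg_minus le_rfl (by omega)
        have e2 : upColumn 1 [] (barHeight r k μ c) 2 =
            (1 : ℤ) :: letterRange 3 (barHeight r k μ c) ++ [-2] := by
          rw [upColumn, min_eq_right h2, gapRange, letterRange_self]
          simp
        rw [e2]
        exact q1.append (by omega) q2)
    obtain ⟨C, p2⟩ := Raise.row (X := X) (m := 1) (x := z) (y := Pi.single 1 l) hn le_rfl (by omega)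
      (fun a h1 h2 _ _ => by
        rw [hz a (by simpa using h1) (by simpa using h2), Pi.single_eq_of_ne (by simpa using h1)])
      (Pi.single_eq_of_ne (by norm_num) _)
      (by rw [hz _ (by norm_num) (by norm_num), hz _ (by norm_num) (by norm_num)]
          exact Pi.single_eq_of_ne (by norm_num) _)
      (by rw [hz (-(((1 : ℕ) : ℤ) + 1)) (by norm_num) (by norm_num), Nat.min_zero]
          exact Pi.single_eq_of_ne (by norm_num) _)
      (by rw [hz (-(((1 : ℕ) : ℤ) + 1)) (by norm_num) (by norm_num)]
          simpa using hl.symm)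
    rw [hz _ (by norm_num) (by norm_num), hz (-(((1 : ℕ) : ℤ) + 1)) (by norm_num) (by norm_num)] at p2
    refine ⟨C, ?_⟩
    have p3 := p1.append (by omega) p2
    convert p3 using 1
    simp only [sBarBar, if_true, Finset.sum_const, Finset.card_range, smul_eq_mul, Nat.cast_one,
      Nat.sub_zero]
    rw [show (1 : ℤ) + 1 = 2 by norm_num]
    omega
  obtain ⟨C, first⟩ := first
  have second := raisePath_turnSweep (X := X) (n := n) (k := k) (a := 1) (trail := [])
    (h := barHeight r k μ) (R := fun _ => rowWord n (Pi.single 1 l))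
    (R' := fun _ => rowWord n (Pi.single 1 l))
    (U := fun i => if i < r then sBarBar k l μ x i else if i = n then k * turnExp X else k)
    (V := fun i => if i < r then sBarBarBar r k μ i else k)
    hn (by simp) le_rfl (by omega) hh ?_ ?_ ?_
  · refine ⟨(1, sBarBar k l μ x 1) :: turnSweep X n (fun i => if i < r then sBarBar k l μ x i else
        if i = n then k * turnExp X else k) (fun i => if i < r then sBarBarBar r k μ i else k),
      ?_, ?_, ⟨_, C, first, ?_⟩⟩
    · intro p hp
      rcases List.mem_cons.1 hp with rfl | hp
      · exact one_ne_zero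
      · exact turnSweep_ne_zero p hp
    · rw [e1, ← pathWord_sweep hn hr (by have := hb.le; omega) hr hT]
      rfl
    · simpa using second
  · intro m h1 h2
    refine ⟨0, 0, Raise.letters_inert (by omega) h2 (fun v hv => ?_) 0, ?_⟩
    · rw [hone v hv]; omega
    · have h3 := sum_barHeight_gt hμ he h1
      have h4 := evenSum_add_evenSum hμ he m
      by_cases hm : m < r
      · rw [if_pos hm, sBarBar, if_neg (by omega)]
        have : evenSum μ 0 m = evenSum μ 0 (2 * (m / 2)) := by
          rcases Nat.mod_two_eq_zero_or_one m with h | h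
          · congr 1; omega
          · rw [evenSum_succ_of_odd h]; congr 1; omega
        omega
      · have h5 : evenSum μ (m + 1) r = 0 := by
          rw [evenSum, Finset.Icc_eq_empty (by omega)]; rfl
        rw [if_neg hm, if_neg (by omega)]
        omega
  · refine ⟨0, 0, Raise.last_letters_inert (by omega) (fun v hv => ?_) 0, ?_⟩
    · rw [hone v hv]
      refine ⟨by omega, by omega, by omega, fun hX => ?_⟩
      subst hX
      simp only [HeightBound] at hb
      omega
    · rw [if_neg (by have := hb.le; omega), if_pos rfl, Nat.add_zero]
  · intro m h1 h2
    have h2' := lt_of_lt_of_le h2 (turnTop_le X n)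
    refine ⟨0, 0, Raise.letters_inert (by omega) h2' (fun v hv => ?_) 0, ?_⟩
    · rw [hone v hv]; omega
    · have h3 := sum_barHeight_le hμ he h1
      have h4 := evenSum_add_evenSum hμ he m
      by_cases hm : m < r
      · rw [if_pos hm, sBarBarBar, if_neg (by omega)]
        have : evenSum μ (m + 1) r = evenSum μ (2 * ((m + 2) / 2)) r := by
          rcases Nat.mod_two_eq_zero_or_one m with h | h
          · rw [evenSum_of_odd (by omega)]; congr 1; omega
          · congr 1; omega
        omega
      · have h5 : evenSum μ (m + 1) r = 0 := by
          rw [evenSum, Finset.Icc_eq_empty (by omega)]; rfl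
        rw [if_neg hm]
        omega

end

/-! ### Highest weight elements of the tensor product -/

section

variable {X : AffineType} {n r k l : ℕ} {μ : ℕ → ℕ} {x : ℤ → ℕ}

theorem AdmissibleRank.heightBound (h : AdmissibleRank X n r) : HeightBound X n r ∧ 3 ≤ n ∧ 1 ≤ r := by
  cases X <;> simp only [AdmissibleRank, HeightBound] at * <;> omega

theorem isRow_of_mem (hx : x ∈ rowCrystal X n l) : IsRow X n x := ⟨hx.1, hx.2.2⟩

theorem Raise.flatten (hn : 3 ≤ n) {i : ℕ} {cols : List (List ℤ)}
    (h : ∀ w ∈ cols, Raise X n i 0 w w 0 0) : Raise X n i 0 cols.flatten cols.flatten 0 0 := by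
  induction cols with
  | nil => exact Raise.nil 0
  | cons w cols ih =>
    rw [List.flatten_cons]
    exact (h w (by simp)).append (by omega) (s1 := 0) (s2 := 0) (ih fun v hv => h v (by simp [hv]))

theorem wordSig_highestTableau (hn : 3 ≤ n) (hb : HeightBound X n r) (hμ : IsKRWeight r k μ) (he : Even r)
    {i : ℕ} (h1 : 1 ≤ i) (h2 : i ≤ n) (hi : i % 2 = 1 ∨ r < i) :
    wordSig X n i (highestTableau r μ).word = (0, 0) := by
  rw [highestTableau, highestTableau_columns]
  refine (Raise.flatten hn fun w hw => ?_).sig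
  rw [List.mem_append, List.mem_replicate, List.mem_map] at hw
  rcases hw with ⟨_, rfl⟩ | ⟨v, hv, rfl⟩
  · exact Raise.nil 0
  · have hv := mem_tallHeights hμ he hv
    rcases Nat.lt_or_ge i n with h3 | h3
    · exact Raise.range_inert h1 h3 (by omega) 0
    · obtain rfl : i = n := by omega
      exact Raise.last_range_inert (by omega) le_rfl (hb.mono hv.2.1)
        (fun _ => by have := hb.le; omega) 0

theorem eq_zero_of_wordSig_rowWord (hn : 3 ≤ n) (hx : IsRow X n x)
    (h : (wordSig X n n (rowWord n x)).1 = 0) {a : ℤ} (ha : a = -n ∨ (X = .B ∧ a = 0)) : x a = 0 := by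
  by_contra hxa
  have hmem : a ∈ rowWord n x := by
    rw [← List.count_pos_iff, count_rowWord hx.1]
    omega
  obtain ⟨u, v, huv⟩ := List.append_of_mem hmem
  obtain ⟨hl, hp⟩ := hx.rowWord
  rw [huv] at hl hp h
  have hu : ∀ b ∈ u, RowRel X n b a := fun b hb => (List.pairwise_append.1 hp).2.2 b hb a (by simp)
  have hneg : ∀ b ∈ u, -(n : ℤ) ≤ b ∧ b < 0 := by
    intro b hb
    have h1 := hl b (by simp [hb])
    obtain ⟨h2, h3, _⟩ := hu b hb
    have p1 := rowPos_cases n a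
    have p2 := rowPos_cases n b
    have h4 := h1.2.1
    refine ⟨h1.1, ?_⟩
    rcases ha with rfl | ⟨_, rfl⟩ <;> omega
  have hφ : (wordSig X n n u).2 = 0 := by
    clear huv hl hp h hu
    induction u with
    | nil => rfl
    | cons b u ih =>
      simp only [wordSig]
      rw [ih fun c hc => hneg c (by simp [hc])]
      have hb := hneg b (by simp)
      have : letterString (vecF X n n) b = 0 := by
        cases X
        · rw [letterString_vecF_D (by omega), if_neg (by omega)]
        · rw [letterString_vecF_B (by omega), if_neg (by omega), if_neg (by omega)]
        · rw [letterString_vecF_A (by omega), if_neg (by omega)]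
      rw [this, Nat.zero_sub]
  have hE : letterString (vecE X n n) a ≠ 0 := by
    rcases ha with rfl | ⟨rfl, rfl⟩
    · cases X
      · rw [letterString_vecE_D (by omega), if_pos (Or.inl rfl)]; omega
      · rw [letterString_vecE_B (by omega), if_pos rfl]; omega
      · rw [letterString_vecE_A (by omega), if_pos rfl]; omega
    · rw [letterString_vecE_B (by omega), if_neg (by omega), if_pos rfl]; omega
  rw [wordSig_append, hφ] at h
  simp only [wordSig] at h
  omega

/-- The exponent of the maximal power of `e_m` on a one-row tableau. -/
theorem wordSig_rowWord (hn : 3 ≤ n) {m : ℕ} (h1 : 1 ≤ m) (h2 : m < n) (x : ℤ → ℕ) :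
    (wordSig X n m (rowWord n x)).1 = x (-m) + (x (m + 1) - x (-(m + 1))) := by
  obtain ⟨C, h⟩ := Raise.row (X := X) (x := x) (y := fun a => if a = -m then 0 else
    if a = -(m + 1) then x (-m) + x (-(m + 1)) else if a = m + 1 then min (x (m + 1)) (x (-(m + 1)))
    else if a = m then x m + (x (m + 1) - x (-(m + 1))) else x a) hn h1 h2
    (fun a p1 p2 p3 p4 => by simp only [p1, p2, p3, p4, if_false]) (if_pos rfl)
    (by rw [if_neg (by omega), if_pos rfl])
    (by rw [if_neg (by omega), if_neg (by omega), if_pos rfl])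
    (by rw [if_neg (by omega), if_neg (by omega), if_neg (by omega), if_pos rfl])
  rw [h.sig]

theorem lowRow_of_highest (hn : 3 ≤ n) (hb : HeightBound X n r) (hμ : IsKRWeight r k μ) (he : Even r)
    (hx : IsRow X n x)
    (hhigh : ∀ i, 1 ≤ i → i ≤ n →
      ((krOps X n r k).tensor (rowOps X n)).e i (highestTableau r μ, x) = none) : LowRow n r x := by
  have hev := Nat.even_iff.1 he
  have hsig : ∀ i, 1 ≤ i → i ≤ n → i % 2 = 1 ∨ r < i → (wordSig X n i (rowWord n x)).1 = 0 := by
    intro i h1 h2 h3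
    have := wordSig_of_tensor_e_eq_none hn (by omega) _ hx (hhigh i h1 h2)
    rw [wordSig_append, wordSig_highestTableau hn hb hμ he h1 h2 h3] at this
    simpa using this
  have hout : ∀ a : ℤ, a < -n ∨ n < a → x a = 0 := by
    intro a ha
    by_contra h0
    obtain ⟨h1, h2, _⟩ := hx.1 a h0
    omega
  have hbar : ∀ j : ℕ, 1 ≤ j → j % 2 = 1 ∨ r < j → x (-(j : ℤ)) = 0 := by
    intro j h1 h2
    rcases Nat.lt_trichotomy j n with h3 | rfl | h3
    · have := hsig j h1 h3.le h2
      rw [wordSig_rowWord hn h1 h3] at this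
      omega
    · exact eq_zero_of_wordSig_rowWord hn hx (hsig j h1 le_rfl h2) (Or.inl rfl)
    · exact hout _ (by omega)
  have hpair : ∀ j : ℕ, 2 ≤ j → (j - 1) % 2 = 1 ∨ r < j - 1 → x j ≤ x (-(j : ℤ)) := by
    intro j h1 h2
    rcases Nat.lt_or_ge n j with h3 | h3
    · rw [hout j (by omega)]; exact Nat.zero_le _
    · obtain ⟨m, rfl⟩ : ∃ m, j = m + 1 := ⟨j - 1, by omega⟩
      have := hsig m (by omega) (by omega) (by simpa using h2)
      rw [wordSig_rowWord hn (by omega) (by omega)] at this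
      push_cast
      omega
  refine ⟨?_, fun j hj => hbar j (by omega) (Or.inl hj), fun j hj => hbar j (by omega) (Or.inr hj),
    ?_, fun j hj => hout j (by omega), fun j h1 h2 => hpair j h1 (Or.inl (by omega))⟩
  · by_contra h0
    have hB := (hx.1 0 h0).2.2 rfl
    subst hB
    simp only [HeightBound] at hb
    exact h0 (eq_zero_of_wordSig_rowWord hn hx (hsig n (by omega) le_rfl (Or.inr (by omega)))
      (Or.inr ⟨rfl, rfl⟩))
  · intro j hj
    have h1 := hpair j (by omega) (Or.inr (by omega))
    rw [hbar j (by omega) (Or.inr (by omega))] at h1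
    omega

/-! ### The action of `e_0` -/

theorem rowOps_e_zero (h : x 2 ≤ x (-2)) (h1 : x 1 ≠ 0) :
    (rowOps X n).e 0 x = some (shiftRow x 1) := by
  simp only [rowOps, if_true]
  rw [if_neg (by omega), if_pos (by omega)]
  congr 1
  funext a
  simp only [shiftRow, Function.update_apply]
  split_ifs <;> first | rfl | omega

theorem rowOps_eps_zero (h : x 2 ≤ x (-2)) : (rowOps X n).eps 0 x = x 1 := by
  refine maxIter_eq _ (fun x : ℤ → ℕ => x 2 ≤ x (-2)) (fun x => x 1) ?_ ?_ h
  · intro x h h1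
    simp only [rowOps, if_true]
    rw [if_neg (by omega), if_neg (by omega)]
  · intro x h h1
    refine ⟨_, rowOps_e_zero h h1, ?_, ?_⟩
    · simp [shiftRow]; omega
    · simp [shiftRow]; omega

theorem shiftRow_shiftRow (x : ℤ → ℕ) (s t : ℕ) : shiftRow (shiftRow x s) t = shiftRow x (s + t) := by
  funext a
  by_cases h1 : a = 1
  · subst h1
    simp [shiftRow, Nat.sub_sub]
  · by_cases h2 : a = -2
    · subst h2
      simp [shiftRow, Nat.add_assoc]
    · simp [shiftRow, h1, h2]

theorem shiftRow_zero (x : ℤ → ℕ) : shiftRow x 0 = x := by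
  funext a
  simp only [shiftRow]
  split_ifs with h1 h2 <;> simp_all

theorem sum_shiftRow (hn : 3 ≤ n) {s : ℕ} (hs : s ≤ x 1) :
    ∑ a ∈ Finset.Icc (-(n : ℤ)) n, shiftRow x s a = ∑ a ∈ Finset.Icc (-(n : ℤ)) n, x a := by
  have h1 : ∀ a, shiftRow x s a + (if a = 1 then s else 0) = x a + if a = -2 then s else 0 := by
    intro a
    unfold shiftRow
    split_ifs <;> subst_vars <;> omega
  have h2 := Finset.sum_congr (rfl : Finset.Icc (-(n : ℤ)) n = _) fun a _ => h1 a
  rw [Finset.sum_add_distrib, Finset.sum_add_distrib, Finset.sum_ite_eq', Finset.sum_ite_eq',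
    if_pos (by rw [Finset.mem_Icc]; omega), if_pos (by rw [Finset.mem_Icc]; omega)] at h2
  omega

theorem IsRow.shiftRow (hn : 3 ≤ n) (hx : IsRow X n x) (s : ℕ) : IsRow X n (shiftRow x s) := by
  refine ⟨?_, ?_, ?_⟩
  · intro a ha
    by_cases h1 : a = 1
    · exact ⟨by omega, by omega, fun h => by omega⟩
    · by_cases h2 : a = -2
      · exact ⟨by omega, by omega, fun h => by omega⟩
      · rw [KRcrystals.shiftRow, if_neg h1, if_neg h2] at ha
        exact hx.1 a ha
  · rw [KRcrystals.shiftRow, if_neg (by omega), if_neg (by omega)]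
    exact hx.2.1
  · rw [KRcrystals.shiftRow, if_neg (by omega), if_neg (by omega), KRcrystals.shiftRow,
      if_neg (by omega), if_neg (by omega)]
    exact hx.2.2

/-- The power of `e_0` in the tensor product. -/
theorem iterOpt_tensor_e_zero {h : ℕ → ℕ} (H : ColumnHeights k r h) (hn : 3 ≤ n) (hr : HeightBound X n r)
    (he : Even r) {m : ℕ} (hm : m ≤ 2 * k) (hx : x 2 ≤ x (-2)) :
    iterOpt (((krOps X n r k).tensor (rowOps X n)).e 0) (2 * k - m + (x 1 - m))
        (colTableau k (zeroColumn h k m), x) =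
      some (colTableau k (zeroColumn h k (2 * k)), KRcrystals.shiftRow x (x 1 - m)) := by
  generalize hc : x 1 - m = c
  induction c generalizing x with
  | zero =>
    rw [shiftRow_zero, Nat.add_zero]
    obtain ⟨d, hd⟩ : ∃ d, 2 * k - m = d := ⟨_, rfl⟩
    rw [hd]
    have hxm : x 1 ≤ m := by omega
    clear hc
    induction d generalizing m with
    | zero => obtain rfl : m = 2 * k := by omega
              rfl
    | succ d ih =>
      rw [iterOpt_succ]
      simp only [Ops.tensor] at ih ⊢
      rw [rowOps_eps_zero hx, krOps_phi_zero H hn hr he hm, if_pos hxm,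
        krOps_e_zero H hn hr he (by omega), Option.map_some, Option.bind_some]
      exact ih (by omega) (by omega) (by omega)
  | succ c ih =>
    rw [← Nat.add_assoc, iterOpt_succ]
    have e1 : ((krOps X n r k).tensor (rowOps X n)).e 0 (colTableau k (zeroColumn h k m), x) =
        some (colTableau k (zeroColumn h k m), KRcrystals.shiftRow x 1) := by
      simp only [Ops.tensor]
      rw [rowOps_eps_zero hx, krOps_phi_zero H hn hr he hm, if_neg (by omega),
        rowOps_e_zero hx (by omega), Option.map_some]
    rw [e1, Option.bind_some, ih (x := KRcrystals.shiftRow x 1) (by simp [KRcrystals.shiftRow]; omega)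
      (by simp [KRcrystals.shiftRow]; omega), shiftRow_shiftRow, Nat.add_comm 1]

end

end KRcrystals

theorem proposition6p4 (X : AffineType) (n r k l : ℕ) (hr : AdmissibleRank X n r) (heven : Even r)
    (hk : 1 ≤ k) (hl : 1 ≤ l)
    (μ : ℕ → ℕ) (hμ : IsKRWeight r k μ) (x : ℤ → ℕ) (hx : x ∈ rowCrystal X n l)
    (hhigh : ∀ i, 1 ≤ i → i ≤ n →
      ((krOps X n r k).tensor (rowOps X n)).e i (highestTableau r μ, x) = none) :
    (iterOpt (((krOps X n r k).tensor (rowOps X n)).e 0) (2 * k - μ 0 + cExp μ x)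
        (highestTableau r μ, x)).bind
      (((krOps X n r k).tensor (rowOps X n)).eWord (wordB3 r k l μ x X n)) =
      some (highestTableau r (muBar μ), Pi.single 1 l) ∧
    highestTableau r (muBar μ) ∈ krCrystal X n r k ∧ (Pi.single 1 l : ℤ → ℕ) ∈ rowCrystal X n l := by
  obtain ⟨hb, hn, hr1⟩ := hr.heightBound
  have hr2 : 2 ≤ r := by
    have := Nat.even_iff.1 heven
    omega
  have hrow := isRow_of_mem hx
  have hlow := lowRow_of_highest hn hb hμ heven hrow hhigh
  have H := columnHeights_barHeight hμ heven hr1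
  have hμ0 : μ 0 ≤ k := by
    have := length_tallHeights hμ
    omega
  have hpair : x 2 ≤ x (-2) := hlow.pair 2 le_rfl rfl
  have hx1 : x 1 ≤ l := by
    rw [← hx.2.1]
    exact Finset.single_le_sum (f := x) (fun _ _ => Nat.zero_le _) (Finset.mem_Icc.2 (by omega))
  have hsingle : (Pi.single 1 l : ℤ → ℕ) ∈ rowCrystal X n l := by
    have h0 : ∀ a : ℤ, a ≠ 1 → (Pi.single 1 l : ℤ → ℕ) a = 0 := fun a ha => Pi.single_eq_of_ne ha _
    refine ⟨fun a ha => ?_, ?_, fun _ => by rw [h0 0 (by omega)]; omega,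
      fun _ => Or.inl (h0 n (by omega))⟩
    · obtain rfl : a = 1 := by
        by_contra h
        exact ha (h0 a h)
      exact ⟨by omega, by omega, fun h => by omega⟩
    · rw [Finset.sum_eq_single (1 : ℤ) (fun a _ ha => h0 a ha) fun h => absurd (Finset.mem_Icc.2
        (by omega)) h]
      exact Pi.single_eq_same _ _
  refine ⟨?_, ⟨muBar μ, isKRWeight_muBar hμ heven hr1, Relation.ReflTransGen.refl⟩, hsingle⟩
  have hc : cExp μ x ≤ x 1 := Nat.sub_le _ _
  rw [highestTableau_eq hμ, cExp, iterOpt_tensor_e_zero H hn hb heven (by omega) hpair,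
    Option.bind_some, ← cExp, highestTableau_muBar_eq hμ heven hr1]
  obtain ⟨L1, n1, w1, p1⟩ := raisePath_first (X := X) hμ heven hr2 hb hn hlow
  set z := downRow (shiftRow x (cExp μ x)) n r 2 with hz
  have z1 : z 1 = x 1 - cExp μ x := by simp [hz, downRow, shiftRow]
  have z0 : ∀ a : ℤ, a ≠ 1 → a ≠ 2 → z a = 0 := by
    intro a h1 h2
    simp only [hz, downRow]
    split_ifs <;> first | rfl | (exfalso; omega)
  have hlen : (concatCols k fun c => letterRange 2 (barHeight r k μ c) ++ [-1]).length =
      (concatCols k fun c => letterRange 3 (barHeight r k μ c) ++ [-2, -1]).length :=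
    length_concatCols fun c hc => by
      have := H.two_le c hc
      simp
      omega
  have hz2 : z 1 + z 2 = l := by
    have h1 := p1.length hn
    rw [List.length_append, List.length_append, hlen, length_rowWord, length_rowWord,
      sum_shiftRow hn hc, hx.2.1] at h1
    have h2 : ∑ a ∈ Finset.Icc (-(n : ℤ)) n, z a = ∑ a ∈ ({1, 2} : Finset ℤ), z a := by
      symm
      apply Finset.sum_subset
      · intro a ha
        simp only [Finset.mem_insert, Finset.mem_singleton] at ha
        rw [Finset.mem_Icc]
        omega
      · intro a _ ha
        simp only [Finset.mem_insert, Finset.mem_singleton, not_or] at ha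
        exact z0 a ha.1 ha.2
    rw [h2, Finset.sum_pair (by norm_num)] at h1
    omega
  obtain ⟨L2, n2, w2, p2⟩ := raisePath_second (x := x) hμ heven hr2 hb hn z0 (by omega) hz2 hx1
  have e0 : (colTableau k (zeroColumn (barHeight r k μ) k (2 * k))).word =
      concatCols k fun c => letterRange 3 (barHeight r k μ c) ++ [-2, -1] := by
    rw [colTableau_word]
    apply concatCols_congr
    intro c hc
    rw [zeroColumn, if_pos (by omega)]
  rw [wordB3, ← w1, ← w2, ← pathWord_append]
  refine RaisePath.tensor_eq hn (fun p hp => ?_) (hrow.shiftRow hn _) (isRow_of_mem hsingle) ?_ ?_ ?_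
  · rcases List.mem_append.1 hp with h | h
    · exact n1 p h
    · exact n2 p h
  · apply colTableau_heights_congr
    intro c hc
    have := H.two_le c hc
    rw [zeroColumn, if_pos (by omega)]
    simp
    omega
  · rw [e0, ← hlen, colTableau_word]
    apply length_concatCols
    intro c hc
    have := H.two_le c hc
    simp
    omega
  · rw [e0, colTableau_word]
    exact p1.append p2
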